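/- Let $\alpha=(\alpha_i)_{i\ge1}\in(0,\infty)^{\mathbb N}$ with $|\alpha|_1=\sum_i\alpha_i<\infty$ and let $\alpha_\infty>0$. Let $\Delta^{(\infty)}=\{x\in[0,1]^{\mathbb N}:|x|_1=\sum_i x_i\le1\}$ with the metric $|x-y|_1$. For $n\ge1$ let $\mu^{(n)}_{\alpha,\alpha_\infty}$ be the image, under $(x_1,\dots,x_n)\mapsto(x_1,\dots,x_n,0,0,\dots)$, of the Dirichlet distribution with parameters $(a_1,\dots,a_n,a_{n+1})=(\alpha_1,\dots,\alpha_{n-1},\sum_{i\ge n}\alpha_i,\alpha_\infty)$, that is, of the measure on $\{x\in[0,1]^n:\sum_{i\le n}x_i\le1\}$ with Lebesgue density $\frac{\Gamma(\sum_{i\le n+1}a_i)}{\prod_{i\le n+1}\Gamma(a_i)}\big(1-\sum_{i\le n}x_i\big)^{a_{n+1}-1}\prod_{i\le n}x_i^{a_i-1}$. For $r=1,2$ let $\mathcal FC^r$ be the set of functions $f(x)=\varphi(x_1,\dots,x_m)$ on $\Delta^{(\infty)}$ with $m\in\mathbb N$ and $\varphi\in C^r(\mathbb R^m)$, and $\partial_n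 f:=(\partial_n\varphi)(x_1,\dots,x_m)$ for $n\le m$, $\partial_nf:=0$ for $n>m$. (1) Each $\mu^{(n)}_{\alpha,\alpha_\infty}$ is a probability measure, and the sequence $(\mu^{(n)}_{\alpha,\alpha_\infty})_{n\ge1}$ converges weakly to a probability measure $\mu=\mu^{(\infty)}_{\alpha,\alpha_\infty}$ on $\Delta^{(\infty)}$. (2) The form $$\mathcal E(f,g)=\int_{\Delta^{(\infty)}}(1-|x|_1)\sum_{n\ge1}x_n\,\partial_nf(x)\,\partial_ng(x)\,\mu(dx),\qquad f,g\in\mathcal FC^1,$$ is closable in $L^2(\mu)$ and its closure $(\mathcal E,\mathcal D(\mathcal E))$ is a symmetric Dirichlet form. Its generator $(L,\mathcal D(L))$ (given by: $u\in\mathcal D(L)$ and $Lu=w$ if and only if $u\in\mathcal D(\mathcal E)$ and $\mathcal E(u,v)=-\mu(wv)$ for all $v\in\mathcal D(\mathcal E)$) satisfies $\mathcal FC^2\subset\mathcal D(L)$ and, $\mu$-almost everywhere, $$Lf(x)=\sum_{n\ge1}\Big(x_n(1-|x|_1)\,\partial_n^2f(x)+\{\alpha_n(1-|x|_1)-\alpha_\infty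 x_n\}\,\partial_nf(x)\Big),\qquad f\in\mathcal FC^2.$$ (3) The spectral gap of $L$ is $$\inf\{\mathcal E(f,f):f\in\mathcal D(\mathcal E),\ \mu(f)=0,\ \mu(f^2)=1\}=\alpha_\infty .$$ There is a strongly continuous semigroup $(P_t)_{t\ge0}$ on $L^2(\mu)$ with generator $L$, it is Markov (positivity preserving with $P_t1=1$), and $$\|P_t-\mu\|_{L^2(\mu)\to L^2(\mu)}\le e^{-\alpha_\infty t},\qquad t\ge0,$$ where $\mu$ also denotes the operator $f\mapsto\mu(f)$ with values in the constant functions. Moreover the Poincaré inequality $$\mu(f^2)\le\frac1{\alpha_\infty}\,\mathcal E(f,f),\qquad f\in\mathcal FC^1,\ \mu(f)=0,$$ holds and is sharp: $1/\alpha_\infty$ is the smallest constant for which it holds. -/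

import Mathlib

open MeasureTheory Filter Topology
open scoped NNReal ENNReal

noncomputable section

namespace InfDirichlet

/-! ### The simplices -/

/-- The finite-dimensional simplex `Δ^(N) = {x ∈ [0,1]^N : ∑ x_i ≤ 1}`. -/
def finSimplex (N : ℕ) : Set (Fin N → ℝ) :=
  {x | (∀ i, 0 ≤ x i) ∧ ∑ i, x i ≤ 1}

/-- The infinite-dimensional simplex `Δ^(∞) = {x ∈ [0,1]^ℕ : ∑ x_i ≤ 1}`, as a subset of `ℓ¹`.
The constraint `x_i ≤ 1` is implied. -/
def infSimplex : Set (lp (fun _ : ℕ => ℝ) 1) :=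
  {x | (∀ i, 0 ≤ x i) ∧ ∑' i, x i ≤ 1}

/-- `Δ^(∞)` as a type; it carries the metric `|x - y|_1` inherited from `ℓ¹`. -/
abbrev InfSimplex : Type := ↥infSimplex

/-- `Δ^(∞)` carries the Borel `σ`-algebra of the `ℓ¹`-metric. -/
instance : MeasurableSpace InfSimplex := borel InfSimplex

instance : BorelSpace InfSimplex := ⟨rfl⟩

/-- The sequence of coordinates of a point of `Δ^(∞)`. -/
def coords (x : InfSimplex) : ℕ → ℝ := fun i => (x : lp (fun _ : ℕ => ℝ) 1) i

/-- A finite vector continued by zeros. -/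
def padZero {N : ℕ} (x : Fin N → ℝ) : ℕ → ℝ := fun i => if h : i < N then x ⟨i, h⟩ else 0

theorem padZero_of_ge {N : ℕ} (x : Fin N → ℝ) {i : ℕ} (h : i ∉ Finset.range N) :
    padZero x i = 0 := by
  have : ¬ i < N := by simpa using h
  simp [padZero, this]

theorem memLp_padZero {N : ℕ} (x : Fin N → ℝ) :
    Memℓp (E := fun _ : ℕ => ℝ) (padZero x) 1 := by
  refine memℓp_gen (summable_of_ne_finset_zero (s := Finset.range N) fun i hi => ?_)
  simp [padZero_of_ge x hi]

theorem tsum_padZero {N : ℕ} (x : Fin N → ℝ) : ∑' i, padZero x i = ∑ i, x i := by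
  rw [tsum_eq_sum (s := Finset.range N) fun i hi => padZero_of_ge x hi, Finset.sum_range]
  simp [padZero]

/-- The embedding `Δ^(N) → Δ^(∞)`, `x ↦ (x_1, …, x_N, 0, 0, …)`. -/
def embed {N : ℕ} (x : finSimplex N) : InfSimplex :=
  ⟨⟨padZero x.1, memLp_padZero x.1⟩, by
    refine ⟨fun i => ?_, ?_⟩
    · change 0 ≤ padZero x.1 i
      unfold padZero
      split_ifs with h
      · exact x.2.1 _
      · exact le_rfl
    · change ∑' i, padZero x.1 i ≤ 1
      rw [tsum_padZero]
      exact x.2.2⟩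

/-! ### Dirichlet distributions -/

/-- The density of the Dirichlet distribution with parameters `(a_1, …, a_N, b)`. -/
def dirichletDensity {N : ℕ} (a : Fin N → ℝ) (b : ℝ) (x : Fin N → ℝ) : ℝ :=
  Real.Gamma (∑ i, a i + b) / ((∏ i, Real.Gamma (a i)) * Real.Gamma b) *
    (1 - ∑ i, x i) ^ (b - 1) * ∏ i, x i ^ (a i - 1)

/-- The Dirichlet distribution with parameters `(a_1, …, a_N, b)`, as a measure on `ℝ^N`
concentrated on `Δ^(N)`. -/
def dirichlet {N : ℕ} (a : Fin N → ℝ) (b : ℝ) : Measure (Fin N → ℝ) :=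
  (volume.restrict (finSimplex N)).withDensity fun x => ENNReal.ofReal (dirichletDensity a b x)

/-- The parameters `(α_1, …, α_k, ∑_{i > k} α_i)` of length `n = k + 1`
(the sequence `α` is indexed from `0` in the code). -/
def aggregate (α : ℕ → ℝ) (k : ℕ) : Fin (k + 1) → ℝ :=
  fun i => if (i : ℕ) < k then α i else ∑' j, α (k + j)

/-- The measure `μ^(n)_{α, α_∞}` on `Δ^(∞)` with `n = k + 1` and `β = α_∞`: the image of the
Dirichlet distribution with parameters `(α_1, …, α_{n-1}, ∑_{i ≥ n} α_i, α_∞)` under the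
embedding `Δ^(n) → Δ^(∞)`. -/
def projDirichlet (α : ℕ → ℝ) (β : ℝ) (k : ℕ) : Measure InfSimplex :=
  ((dirichlet (aggregate α k) β).comap (Subtype.val : finSimplex (k + 1) → Fin (k + 1) → ℝ)).map
    embed

/-! ### Cylinder functions -/

/-- The space `FC^r` of `C^r` cylinder functions `x ↦ φ(x_1, …, x_m)`, `m ∈ ℕ`, `φ ∈ C^r(ℝ^m)`.
They are taken on the whole space of sequences, so that partial derivatives make sense, and are
only evaluated at points of `Δ^(∞)`. -/
def FC (r : ℕ) : Submodule ℝ ((ℕ → ℝ) → ℝ) where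
  carrier := {f | ∃ (m : ℕ) (φ : (Fin m → ℝ) → ℝ), ContDiff ℝ r φ ∧
    ∀ x, f x = φ fun i => x i}
  zero_mem' := ⟨0, 0, contDiff_const, fun _ => rfl⟩
  smul_mem' := by
    rintro c f ⟨m, φ, hφ, hf⟩
    exact ⟨m, fun y => c * φ y, contDiff_const.mul hφ, fun x => by simp [hf x]⟩
  add_mem' := by
    rintro f g ⟨m, φ, hφ, hf⟩ ⟨n, ψ, hψ, hg⟩
    refine ⟨m + n, fun y => φ (fun i => y (Fin.castLE (Nat.le_add_right m n) i)) +
      ψ (fun i => y (Fin.castLE (Nat.le_add_left n m) i)), ?_, fun x => by simp [hf x, hg x]⟩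
    exact (hφ.comp (contDiff_pi.2 fun i => contDiff_apply ℝ ℝ _)).add
      (hψ.comp (contDiff_pi.2 fun i => contDiff_apply ℝ ℝ _))

/-- The partial derivative `∂_n f`. -/
def pd (n : ℕ) (f : (ℕ → ℝ) → ℝ) (x : ℕ → ℝ) : ℝ :=
  deriv (fun t => f (Function.update x n t)) (x n)

theorem continuous_coords : Continuous coords :=
  lp.uniformContinuous_coe.continuous.comp continuous_subtype_val

theorem coords_mem_Icc (x : InfSimplex) (i : ℕ) : coords x i ∈ Set.Icc (0 : ℝ) 1 := by
  have hs : Summable (coords x) := by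
    have h := (memℓp_gen_iff (E := fun _ : ℕ => ℝ) (p := 1) (by simp)).1 x.1.2
    have h' : Summable fun j => |coords x j| := by simpa [coords] using h
    exact h'.of_abs
  exact ⟨x.2.1 i, (hs.le_tsum i fun j _ => x.2.1 j).trans x.2.2⟩

theorem memLp_cylinder {r : ℕ} (f : FC r) (μ : Measure InfSimplex) [IsFiniteMeasure μ] :
    MemLp (fun x => f.1 (coords x)) 2 μ := by
  obtain ⟨f, m, φ, hφ, hf⟩ := f
  simp only [hf]
  have hcont : Continuous fun x : InfSimplex => φ fun i : Fin m => coords x i :=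
    hφ.continuous.comp (continuous_pi fun i => (continuous_apply _).comp continuous_coords)
  have hK : IsCompact (Set.univ.pi fun _ : Fin m => Set.Icc (0 : ℝ) 1) :=
    isCompact_univ_pi fun _ => isCompact_Icc
  obtain ⟨C, hC⟩ := hK.exists_bound_of_continuousOn hφ.continuous.continuousOn
  exact MemLp.of_bound hcont.aestronglyMeasurable C
    (ae_of_all _ fun x => hC _ fun i _ => coords_mem_Icc x i)

/-- The map sending a cylinder function to its class in `L²(μ)`. -/
def toL2 (r : ℕ) (μ : Measure InfSimplex) [IsFiniteMeasure μ] : FC r →ₗ[ℝ] Lp ℝ 2 μ where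
  toFun f := (memLp_cylinder f μ).toLp _
  map_add' f g := MemLp.toLp_add (memLp_cylinder f μ) (memLp_cylinder g μ)
  map_smul' c f := MemLp.toLp_const_smul c (memLp_cylinder f μ)

/-- The form `E(f,g) = ∫ (1 - |x|_1) ∑_n x_n (∂_n f)(∂_n g) dμ` on cylinder functions. -/
def energy (μ : Measure InfSimplex) (f g : FC 1) : ℝ :=
  ∫ x, (1 - ∑' n, coords x n) *
    ∑' n, coords x n * (pd n f.1 (coords x) * pd n g.1 (coords x)) ∂μ

/-- The differential expression
`∑_n (x_n (1 - |x|_1) ∂_n² f + (α_n (1 - |x|_1) - α_∞ x_n) ∂_n f)`, with `β = α_∞`. -/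
def genExpr (α : ℕ → ℝ) (β : ℝ) (f : (ℕ → ℝ) → ℝ) (x : ℕ → ℝ) : ℝ :=
  ∑' n, (x n * (1 - ∑' i, x i) * pd n (pd n f) x +
    (α n * (1 - ∑' i, x i) - β * x n) * pd n f x)

/-! ### Symmetric forms on a Hilbert space -/

section Forms

variable {H : Type*} [NormedAddCommGroup H] [InnerProductSpace ℝ H]

/-- A form `e` on a vector space `V` of functions mapped to a Hilbert space by `ι` is closable:
if `ι f_n → 0` and `(f_n)` is `e`-Cauchy, then `e(f_n, f_n) → 0`. In particular (constant
sequences) `e(f, f) = 0` whenever the class `ι f` is zero. -/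
def IsClosable {V : Type*} [AddCommGroup V] [Module ℝ V] (ι : V →ₗ[ℝ] H) (e : V → V → ℝ) :
    Prop :=
  ∀ f : ℕ → V, Tendsto (fun n => ι (f n)) atTop (𝓝 0) →
    Tendsto (fun p : ℕ × ℕ => e (f p.1 - f p.2) (f p.1 - f p.2)) atTop (𝓝 0) →
    Tendsto (fun n => e (f n) (f n)) atTop (𝓝 0)

variable (H) in
/-- A nonnegative symmetric bilinear form with a linear domain in the Hilbert space `H`. -/
structure SymmForm where
  /-- the domain -/
  domain : Submodule ℝ H
  /-- the form -/
  form : domain →ₗ[ℝ] domain →ₗ[ℝ] ℝ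
  symm : ∀ u v, form u v = form v u
  nonneg : ∀ u, 0 ≤ form u u

namespace SymmForm

/-- The squared form norm `‖u‖² + E(u,u)`. -/
def normSq (E : SymmForm H) (u : E.domain) : ℝ := ‖(u : H)‖ ^ 2 + E.form u u

/-- A form is closed if its domain is complete for the form norm. -/
def IsClosed (E : SymmForm H) : Prop :=
  ∀ u : ℕ → E.domain,
    Tendsto (fun p : ℕ × ℕ => E.normSq (u p.1 - u p.2)) atTop (𝓝 0) →
    ∃ v : E.domain, Tendsto (fun n => E.normSq (u n - v)) atTop (𝓝 0)

/-- `E` is the closure of the form `e` on `V`: it extends `e`, it is closed, and (the image of)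
`V` is dense in its domain for the form norm. There is at most one such `E`. -/
structure IsClosureOf {V : Type*} [AddCommGroup V] [Module ℝ V] (E : SymmForm H)
    (ι : V →ₗ[ℝ] H) (e : V → V → ℝ) : Prop where
  mem_domain : ∀ f, ι f ∈ E.domain
  form_eq : ∀ f g, E.form ⟨ι f, mem_domain f⟩ ⟨ι g, mem_domain g⟩ = e f g
  closed : E.IsClosed
  dense : ∀ u : E.domain, ∃ f : ℕ → V,
    Tendsto (fun n => E.normSq (⟨ι (f n), mem_domain (f n)⟩ - u)) atTop (𝓝 0)

/-- The generator graph: the pairs `(u, w)` with `u ∈ D(E)` and `E(u, v) = -⟪w, v⟫` for all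
`v ∈ D(E)`. -/
def generatorGraph (E : SymmForm H) : Submodule ℝ (H × H) where
  carrier := {p | ∃ h : p.1 ∈ E.domain, ∀ v : E.domain, E.form ⟨p.1, h⟩ v = -inner ℝ p.2 (v : H)}
  zero_mem' := ⟨E.domain.zero_mem, fun v => by
    have : (⟨(0 : H × H).1, E.domain.zero_mem⟩ : E.domain) = 0 := rfl
    rw [this]; simp⟩
  add_mem' := by
    rintro p q ⟨hp, hp'⟩ ⟨hq, hq'⟩
    refine ⟨E.domain.add_mem hp hq, fun v => ?_⟩
    have : (⟨(p + q).1, E.domain.add_mem hp hq⟩ : E.domain) = ⟨p.1, hp⟩ + ⟨q.1, hq⟩ := rfl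
    rw [this, map_add, LinearMap.add_apply, hp', hq', Prod.snd_add, inner_add_left]
    ring
  smul_mem' := by
    rintro c p ⟨hp, hp'⟩
    refine ⟨E.domain.smul_mem c hp, fun v => ?_⟩
    have : (⟨(c • p).1, E.domain.smul_mem c hp⟩ : E.domain) = c • ⟨p.1, hp⟩ := rfl
    rw [this, map_smul, LinearMap.smul_apply, hp', Prod.smul_snd, real_inner_smul_left]
    simp

/-- The generator of a densely defined form, as a partially defined linear operator. -/
def generator (E : SymmForm H) : H →ₗ.[ℝ] H := E.generatorGraph.toLinearPMap

end SymmForm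

/-- `P` is the strongly continuous semigroup of bounded operators whose infinitesimal generator
is the (partially defined) operator `L`. There is at most one such `P`. -/
structure IsSemigroupOf (P : ℝ≥0 → H →L[ℝ] H) (L : H →ₗ.[ℝ] H) : Prop where
  zero : P 0 = 1
  add : ∀ s t, P (s + t) = P s * P t
  continuous_zero : ∀ u, Tendsto (fun t => P t u) (𝓝 0) (𝓝 u)
  generator : ∀ u w, (u, w) ∈ L.graph ↔
    Tendsto (fun t : ℝ≥0 => (t : ℝ)⁻¹ • (P t u - u)) (𝓝[>] 0) (𝓝 w)

end Forms

/-! ### Forms and semigroups on `L²(μ)` for a finite measure `μ` -/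

section L2

variable {X : Type*} [MeasurableSpace X] {μ : Measure X} [IsFiniteMeasure μ]

/-- Symmetric Dirichlet forms on `L²(μ)`: densely defined, closed, and such that
`u ∈ D(E)` implies `u⁺ ∧ 1 ∈ D(E)` and `E(u⁺ ∧ 1, u⁺ ∧ 1) ≤ E(u, u)`. -/
structure IsDirichletForm (E : SymmForm (Lp ℝ 2 μ)) : Prop where
  dense : Dense (E.domain : Set (Lp ℝ 2 μ))
  closed : E.IsClosed
  markov : ∀ u : E.domain, ∃ h : ((u : Lp ℝ 2 μ) ⊔ 0) ⊓ Lp.const 2 μ (1 : ℝ) ∈ E.domain,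
    E.form ⟨_, h⟩ ⟨_, h⟩ ≤ E.form u u

/-- The spectral gap
`inf {E(u, u) : u ∈ D(E), μ(u) = 0, μ(u²) = 1}` of (the generator of) a form. -/
def spectralGap (E : SymmForm (Lp ℝ 2 μ)) : ℝ :=
  sInf {r | ∃ u : E.domain, ∫ x, (u : Lp ℝ 2 μ) x ∂μ = 0 ∧
    ∫ x, ((u : Lp ℝ 2 μ) x) ^ 2 ∂μ = 1 ∧ r = E.form u u}

/-- A family of operators on `L²(μ)` is Markov if it preserves positivity and the constant
function `1`. -/
def IsMarkov (P : ℝ≥0 → Lp ℝ 2 μ →L[ℝ] Lp ℝ 2 μ) : Prop :=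
  ∀ t, (∀ f, 0 ≤ f → 0 ≤ P t f) ∧ P t (Lp.const 2 μ (1 : ℝ)) = Lp.const 2 μ (1 : ℝ)

variable (μ) in
/-- The operator `f ↦ μ(f)` on `L²(μ)`, with values in the constant functions. -/
def meanOp : Lp ℝ 2 μ →L[ℝ] Lp ℝ 2 μ :=
  (innerSL ℝ (Lp.const 2 μ (1 : ℝ))).smulRight (Lp.const 2 μ (1 : ℝ))

theorem meanOp_apply (f : Lp ℝ 2 μ) : meanOp μ f = Lp.const 2 μ (∫ x, f x ∂μ) := by
  have h1 : inner ℝ (Lp.const 2 μ (1 : ℝ)) f = ∫ x, f x ∂μ := by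
    rw [L2.inner_def]
    refine integral_congr_ae ?_
    filter_upwards [Lp.coeFn_const (p := 2) (μ := μ) (1 : ℝ)] with x hx
    rw [hx]
    simp
  have h2 := (Lp.constₗ 2 μ ℝ (E := ℝ)).map_smul (∫ x, f x ∂μ) 1
  simp only [Lp.constₗ_apply, smul_eq_mul, mul_one] at h2
  simp [meanOp, h1, h2]

end L2

end InfDirichlet

end

open InfDirichlet

/-!
The generator of the infinite-dimensional Dirichlet diffusion has a Hilbert basis of polynomial
eigenfunctions, so the Dirichlet form, its generator and its semigroup can be written down as
diagonal objects, and the spectral gap is an eigenvalue.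

*The limit measure.* The measure `μ` is the law of a random point obtained by stick breaking with
independent beta variables (`exists_infiniteDirichlet`). It is characterized by the fact that
`(x_0, …, x_{m-1}, ∑_{i ≥ m} x_i)` has the Dirichlet distribution with parameters
`(aggregate α m, β)` for all `m`, and moving the tail of `x` into one coordinate changes `x` by
little, which gives the weak convergence (`tendsto_projDirichlet`).

*Symmetry.* Integrating by parts in one coordinate of the Dirichlet density gives
`E(f, g) = -∫ (L f) g dμ` for `f ∈ FC²`, `g ∈ FC¹`, where `L` is the differential expression
(`energy_eq_neg_integral`). Hence the closure `G` in `L² × L²` of the graph of `L` on `FC²` is a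
symmetric relation (`genRelation_symm`).

*Eigenfunctions.* A polynomial `p(x_0, …, x_{m-1}, ∑_{i ≥ m} x_i)` is a limit of cylinder functions,
and `L` acts on it as the generator of the `(m+1)`-dimensional Dirichlet distribution
(`polyClass_mem_genRelation`). That operator does not increase the degree, so by symmetry it is
diagonalizable on polynomials of bounded degree; such polynomials are dense in `L²(μ)` by the
Stone–Weierstrass theorem (`exists_polyClass_near`). Its eigenvalues are read off from the part of
top degree `d` of an eigenfunction: they are `-(β d + κ)`, where `κ ≥ 0` because the operators
`∑ (X_i ∂_i² + a_i ∂_i)` and multiplication by `∑ X_i` satisfy a commutation relation of `sl₂` type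
(`polyGen_eigenvalue`). So there is a Hilbert basis `(b_i)` of `L²(μ)` with `(b_i, -l_i b_i) ∈ G`,
and `l_i ≥ β` unless `l_i = 0` and `b_i` is constant (`exists_eigenbasis_genRelation`).

*The form.* Let `E(u, v) = ∑ l_i ⟪b_i, u⟫ ⟪b_i, v⟫`. The symmetry of `G` shows that `E` extends the
energy from `FC²`, and mollification extends this to `FC¹` (`form_eq_energy`). The map
`(1 + l)^{-1/2}` is an isometry from `L²(μ)` onto the domain with the form norm, and it transports
`b_i ∈ D(G)` into the density of cylinder functions in the domain (`diagForm_core`). Hence `E` is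
the closure of the energy. Contractions of the line operate on `E` by the chain rule and lower
semicontinuity (`form_contraction_le`); therefore the resolvents, which minimize
`s E(w, w) + ‖w - u‖²`, preserve positivity, and so does the semigroup
(`diagSemigroup_nonneg`).

*The gap.* All mean-zero functions are combinations of the `b_i` with `l_i ≥ β`, which yields the
Poincaré inequality and the exponential convergence. The function `x_0 / α_0 - x_1 / α_1` is an
eigenfunction for `-β`, so the constants are optimal (`exists_extremal`).
-/

open MeasureTheory Filter Topology ProbabilityTheory
open scoped NNReal ENNReal

noncomputable section

namespace InfDirichlet

/-! ### Diagonal operators and diagonal forms -/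

section Diagonal

variable {H ι : Type*} [NormedAddCommGroup H] [InnerProductSpace ℝ H] (b : HilbertBasis ι ℝ H)

theorem hilbertBasis_ext {u v : H} (h : ∀ i, inner ℝ (b i) u = inner ℝ (b i) v) : u = v := by
  apply b.repr.injective
  ext i
  simpa [b.repr_apply_apply] using h i

theorem hasSum_inner_sq (u : H) : HasSum (fun i => inner ℝ (b i) u ^ 2) (‖u‖ ^ 2) := by
  have h := b.hasSum_inner_mul_inner u u
  rw [real_inner_self_eq_norm_sq] at h
  refine h.congr_fun fun i => ?_
  rw [real_inner_comm, sq]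

theorem exists_forall_inner_eq (c : ι → ℝ) (hc : Summable fun i => c i ^ 2) :
    ∃ u, ∀ i, inner ℝ (b i) u = c i := by
  have hc' : Memℓp (E := fun _ : ι => ℝ) c 2 := by
    refine memℓp_gen ?_
    simpa using hc
  refine ⟨b.repr.symm ⟨c, hc'⟩, fun i => ?_⟩
  rw [← b.repr_apply_apply]
  simp

/-- Dominated convergence for the coefficients with respect to a Hilbert basis. -/
theorem tendsto_of_tendsto_inner {τ : Type*} {l : Filter τ} {F : τ → H} {v : H} (g : ι → ℝ)
    (hg : Summable fun i => g i ^ 2) (hF : ∀ᶠ t in l, ∀ i, |inner ℝ (b i) (F t)| ≤ g i)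
    (h : ∀ i, Tendsto (fun t => inner ℝ (b i) (F t)) l (𝓝 (inner ℝ (b i) v))) :
    Tendsto F l (𝓝 v) := by
  rcases l.eq_or_neBot with rfl | hl
  · exact tendsto_bot
  have hv : ∀ i, |inner ℝ (b i) v| ≤ g i := fun i =>
    le_of_tendsto (h i).abs (hF.mono fun t ht => ht i)
  have hsum : Tendsto (fun t => ∑' i, (inner ℝ (b i) (F t) - inner ℝ (b i) v) ^ 2) l
      (𝓝 (∑' i : ι, (0 : ℝ))) := by
    refine tendsto_tsum_of_dominated_convergence (bound := fun i => 4 * g i ^ 2)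
      (hg.mul_left 4) (fun i => ?_) ?_
    · have := ((h i).sub_const (inner ℝ (b i) v)).pow 2
      simpa using this
    · filter_upwards [hF] with t ht i
      rw [Real.norm_eq_abs, abs_of_nonneg (sq_nonneg _)]
      have h1 := abs_le.1 (ht i)
      have h2 := abs_le.1 (hv i)
      nlinarith
  rw [tendsto_iff_norm_sub_tendsto_zero]
  have h2 : Tendsto (fun t => ‖F t - v‖ ^ 2) l (𝓝 0) := by
    refine (hsum.congr fun t => ?_).trans (by simp)
    rw [← (hasSum_inner_sq b (F t - v)).tsum_eq]
    simp [inner_sub_right]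
  simpa using h2.sqrt

theorem norm_le_of_abs_inner_le {u v : H} {C : ℝ} (hC : 0 ≤ C)
    (h : ∀ i, |inner ℝ (b i) u| ≤ C * |inner ℝ (b i) v|) : ‖u‖ ≤ C * ‖v‖ := by
  refine le_of_sq_le_sq ?_ (by positivity)
  rw [mul_pow]
  refine hasSum_le (fun i => ?_) (hasSum_inner_sq b u) ((hasSum_inner_sq b v).mul_left (C ^ 2))
  rw [← sq_abs, ← sq_abs (inner ℝ (b i) v), ← mul_pow]
  exact pow_le_pow_left₀ (abs_nonneg _) (h i) 2

theorem summable_mul_sq {m : ι → ℝ} {C : ℝ} (hm : ∀ i, |m i| ≤ C) (u : H) :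
    Summable fun i => (m i * inner ℝ (b i) u) ^ 2 := by
  refine Summable.of_nonneg_of_le (fun i => sq_nonneg _) (fun i => ?_)
    ((hasSum_inner_sq b u).summable.mul_left (C ^ 2))
  rw [mul_pow]
  refine mul_le_mul_of_nonneg_right ?_ (sq_nonneg _)
  rw [← sq_abs]
  exact pow_le_pow_left₀ (abs_nonneg _) (hm i) 2

/-- The bounded operator that is diagonal with respect to the Hilbert basis `b`, with bounded
diagonal entries `m`. -/
def diagOp (m : ι → ℝ) (C : ℝ) (hm : ∀ i, |m i| ≤ C) : H →L[ℝ] H :=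
  LinearMap.mkContinuous
    { toFun := fun u => (exists_forall_inner_eq b _ (summable_mul_sq b hm u)).choose
      map_add' := fun u v => hilbertBasis_ext b fun i => by
        rw [inner_add_right, (exists_forall_inner_eq b _ (summable_mul_sq b hm (u + v))).choose_spec,
          (exists_forall_inner_eq b _ (summable_mul_sq b hm u)).choose_spec,
          (exists_forall_inner_eq b _ (summable_mul_sq b hm v)).choose_spec, inner_add_right,
          mul_add]
      map_smul' := fun c u => hilbertBasis_ext b fun i => by
        rw [RingHom.id_apply, real_inner_smul_right,
          (exists_forall_inner_eq b _ (summable_mul_sq b hm (c • u))).choose_spec,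
          (exists_forall_inner_eq b _ (summable_mul_sq b hm u)).choose_spec,
          real_inner_smul_right]
        ring } |C| fun u => by
    refine norm_le_of_abs_inner_le b (abs_nonneg C) fun i => ?_
    change |inner ℝ (b i) (exists_forall_inner_eq b _ (summable_mul_sq b hm u)).choose| ≤ _
    rw [(exists_forall_inner_eq b _ (summable_mul_sq b hm u)).choose_spec, abs_mul]
    exact mul_le_mul_of_nonneg_right ((hm i).trans (le_abs_self C)) (abs_nonneg _)

@[simp]
theorem inner_diagOp (m : ι → ℝ) (C : ℝ) (hm : ∀ i, |m i| ≤ C) (i : ι) (u : H) :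
    inner ℝ (b i) (diagOp b m C hm u) = m i * inner ℝ (b i) u :=
  (exists_forall_inner_eq b _ (summable_mul_sq b hm u)).choose_spec i

variable (l : ι → ℝ)

theorem summable_mul_inner_mul_inner {l : ι → ℝ} (hl : ∀ i, 0 ≤ l i) {u v : H}
    (hu : Summable fun i => l i * inner ℝ (b i) u ^ 2)
    (hv : Summable fun i => l i * inner ℝ (b i) v ^ 2) :
    Summable fun i => l i * (inner ℝ (b i) u * inner ℝ (b i) v) := by
  refine Summable.of_norm_bounded (hu.add hv) fun i => ?_
  rw [Real.norm_eq_abs, abs_mul, abs_of_nonneg (hl i), ← mul_add]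
  refine mul_le_mul_of_nonneg_left ?_ (hl i)
  rw [abs_le]
  constructor <;>
    nlinarith [sq_nonneg (inner ℝ (b i) u + inner ℝ (b i) v),
      sq_nonneg (inner ℝ (b i) u - inner ℝ (b i) v), sq_nonneg (inner ℝ (b i) u),
      sq_nonneg (inner ℝ (b i) v)]

/-- The form domain `{u | ∑ l_i ⟪b_i, u⟫² < ∞}` of a diagonal operator. -/
def diagDomain (hl : ∀ i, 0 ≤ l i) : Submodule ℝ H where
  carrier := {u | Summable fun i => l i * inner ℝ (b i) u ^ 2}
  zero_mem' := by simp [summable_zero]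
  add_mem' := fun {u v} hu hv => by
    refine (((Summable.add hu hv).add
      ((summable_mul_inner_mul_inner b hl hu hv).mul_left 2))).congr fun i => ?_
    rw [inner_add_right]
    ring
  smul_mem' := fun c u hu => by
    refine (Summable.mul_left (c ^ 2) hu).congr fun i => ?_
    rw [real_inner_smul_right]
    ring

/-- The diagonal form `∑ l_i ⟪b_i, u⟫ ⟪b_i, v⟫`. -/
def diagForm (hl : ∀ i, 0 ≤ l i) : SymmForm H where
  domain := diagDomain b l hl
  form := LinearMap.mk₂ ℝ
    (fun u v => ∑' i, l i * (inner ℝ (b i) (u : H) * inner ℝ (b i) (v : H)))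
    (fun u u' v => by
      rw [← (summable_mul_inner_mul_inner b hl u.2 v.2).tsum_add
        (summable_mul_inner_mul_inner b hl u'.2 v.2)]
      refine tsum_congr fun i => ?_
      rw [Submodule.coe_add, inner_add_right]
      ring)
    (fun c u v => by
      rw [smul_eq_mul, ← tsum_mul_left]
      refine tsum_congr fun i => ?_
      rw [Submodule.coe_smul, real_inner_smul_right]
      ring)
    (fun u v v' => by
      rw [← (summable_mul_inner_mul_inner b hl u.2 v.2).tsum_add
        (summable_mul_inner_mul_inner b hl u.2 v'.2)]
      refine tsum_congr fun i => ?_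
      rw [Submodule.coe_add, inner_add_right]
      ring)
    (fun c u v => by
      rw [smul_eq_mul, ← tsum_mul_left]
      refine tsum_congr fun i => ?_
      rw [Submodule.coe_smul, real_inner_smul_right]
      ring)
  symm := fun u v => tsum_congr fun i => by ring
  nonneg := fun u => tsum_nonneg fun i => mul_nonneg (hl i) (mul_self_nonneg _)

variable {l} (hl : ∀ i, 0 ≤ l i)

theorem mem_diagForm_domain {u : H} :
    u ∈ (diagForm b l hl).domain ↔ Summable fun i => l i * inner ℝ (b i) u ^ 2 := Iff.rfl

theorem diagForm_apply (u v : (diagForm b l hl).domain) :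
    (diagForm b l hl).form u v =
      ∑' i, l i * (inner ℝ (b i) (u : H) * inner ℝ (b i) (v : H)) := rfl

theorem hasSum_diagForm_self (u : (diagForm b l hl).domain) :
    HasSum (fun i => l i * inner ℝ (b i) (u : H) ^ 2) ((diagForm b l hl).form u u) := by
  rw [diagForm_apply]
  simp only [← sq]
  exact Summable.hasSum u.2

/-- A diagonal form is lower semicontinuous. -/
theorem diagForm_le_of_tendsto {v : ℕ → (diagForm b l hl).domain} {w : H} {C : ℕ → ℝ} {c : ℝ}
    (hv : Tendsto (fun n => (v n : H)) atTop (𝓝 w)) (hC : Tendsto C atTop (𝓝 c))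
    (h : ∀ᶠ n in atTop, (diagForm b l hl).form (v n) (v n) ≤ C n) :
    ∃ hw : w ∈ (diagForm b l hl).domain, (diagForm b l hl).form ⟨w, hw⟩ ⟨w, hw⟩ ≤ c := by
  have hfin : ∀ s : Finset ι, ∑ i ∈ s, l i * inner ℝ (b i) w ^ 2 ≤ c := fun s => by
    refine le_of_tendsto_of_tendsto (tendsto_finsetSum s fun i _ =>
      (((continuous_const.inner continuous_id).tendsto w).comp hv |>.pow 2 |>.const_mul (l i)))
      hC (h.mono fun n hn => ?_)
    exact (sum_le_hasSum s (fun i _ => mul_nonneg (hl i) (sq_nonneg _))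
      (hasSum_diagForm_self b hl (v n))).trans hn
  have hs : w ∈ (diagForm b l hl).domain :=
    summable_of_sum_le (fun i => mul_nonneg (hl i) (sq_nonneg _)) hfin
  exact ⟨hs, hasSum_le_of_sum_le (hasSum_diagForm_self b hl ⟨w, hs⟩) hfin⟩

theorem diagForm_isClosed [CompleteSpace H] : (diagForm b l hl).IsClosed := by
  intro u hu
  have hu' := Metric.tendsto_atTop.1 hu
  have hcau : ∀ ε > 0, ∃ N, ∀ m ≥ N, ∀ n ≥ N, (diagForm b l hl).normSq (u m - u n) ≤ ε := by
    intro ε hε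
    obtain ⟨N, hN⟩ := hu' ε hε
    refine ⟨max N.1 N.2, fun m hm n hn => ?_⟩
    have := hN (m, n) ⟨(le_max_left _ _).trans hm, (le_max_right _ _).trans hn⟩
    rw [Real.dist_eq, sub_zero] at this
    exact (le_abs_self _).trans this.le
  have hle : ∀ x : (diagForm b l hl).domain, ‖(x : H)‖ ^ 2 ≤ (diagForm b l hl).normSq x :=
    fun x => le_add_of_nonneg_right ((diagForm b l hl).nonneg x)
  have hcs : CauchySeq fun n => (u n : H) := by
    refine Metric.cauchySeq_iff.2 fun ε hε => ?_
    obtain ⟨N, hN⟩ := hcau (ε ^ 2 / 2) (by positivity)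
    refine ⟨N, fun m hm n hn => ?_⟩
    rw [dist_eq_norm]
    refine lt_of_pow_lt_pow_left₀ 2 hε.le ?_
    have h1 := (hle (u m - u n)).trans (hN m hm n hn)
    rw [Submodule.coe_sub] at h1
    nlinarith [sq_pos_of_pos hε]
  obtain ⟨w, hw⟩ := cauchySeq_tendsto_of_complete hcs
  -- Letting `n → ∞` in the Cauchy bound for `u m - u n`, finite sum by finite sum,
  -- gives the same bound for `u m - w`; in particular `w` lies in the domain.
  have key : ∀ ε > 0, ∃ N, ∀ m ≥ N, ∃ h : (u m : H) - w ∈ (diagForm b l hl).domain,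
      (diagForm b l hl).form ⟨_, h⟩ ⟨_, h⟩ ≤ ε := by
    intro ε hε
    obtain ⟨N, hN⟩ := hcau ε hε
    refine ⟨N, fun m hm => ?_⟩
    refine diagForm_le_of_tendsto b hl (v := fun n => u m - u n)
      (by simpa using hw.const_sub (u m : H)) (tendsto_const_nhds (x := ε)) ?_
    filter_upwards [eventually_ge_atTop N] with n hn
    exact (le_add_of_nonneg_left (sq_nonneg _)).trans (hN m hm n hn)
  obtain ⟨N, hN⟩ := key 1 one_pos
  obtain ⟨hN', -⟩ := hN N le_rfl
  have hwd : w ∈ (diagForm b l hl).domain := by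
    have := (diagForm b l hl).domain.sub_mem (u N).2 hN'
    simpa using this
  refine ⟨⟨w, hwd⟩, ?_⟩
  have h1 : Tendsto (fun n => ‖((u n - ⟨w, hwd⟩ : (diagForm b l hl).domain) : H)‖ ^ 2) atTop
      (𝓝 0) := by
    have := (tendsto_iff_norm_sub_tendsto_zero.1 hw).pow 2
    simpa using this
  have h2 : Tendsto (fun n => (diagForm b l hl).form (u n - ⟨w, hwd⟩) (u n - ⟨w, hwd⟩)) atTop
      (𝓝 0) := by
    refine Metric.tendsto_atTop.2 fun ε hε => ?_
    obtain ⟨N, hN⟩ := key (ε / 2) (by positivity)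
    refine ⟨N, fun n hn => ?_⟩
    obtain ⟨h, h'⟩ := hN n hn
    rw [Real.dist_eq, sub_zero, abs_of_nonneg ((diagForm b l hl).nonneg _)]
    have e : u n - ⟨w, hwd⟩ = ⟨(u n : H) - w, h⟩ := Subtype.ext rfl
    rw [e]
    linarith
  simpa [SymmForm.normSq] using h1.add h2

theorem hilbertBasis_inner_eq [DecidableEq ι] (i j : ι) :
    inner ℝ (b i) (b j) = if i = j then (1 : ℝ) else 0 :=
  orthonormal_iff_ite.1 b.orthonormal i j

theorem mem_diagForm_domain_basis (i : ι) : b i ∈ (diagForm b l hl).domain := by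
  classical
  rw [mem_diagForm_domain]
  refine summable_of_ne_finset_zero (s := {i}) fun j hj => ?_
  rw [hilbertBasis_inner_eq, if_neg (by simpa using hj)]
  simp

theorem diagForm_basis_right (u : (diagForm b l hl).domain) (i : ι) :
    (diagForm b l hl).form u ⟨b i, mem_diagForm_domain_basis b hl i⟩ =
      l i * inner ℝ (b i) (u : H) := by
  classical
  rw [diagForm_apply, tsum_eq_single i]
  · rw [hilbertBasis_inner_eq, if_pos rfl, mul_one]
  · intro j hj
    rw [hilbertBasis_inner_eq, if_neg hj]
    simp

theorem diagForm_dense : Dense ((diagForm b l hl).domain : Set H) := by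
  have h := b.dense_span
  rw [← Submodule.dense_iff_topologicalClosure_eq_top] at h
  refine h.mono ?_
  rw [SetLike.coe_subset_coe, Submodule.span_le]
  rintro _ ⟨i, rfl⟩
  exact mem_diagForm_domain_basis b hl i

/-- The generator of a diagonal form acts on the coefficients by multiplication with `-l_i`. -/
theorem mem_generatorGraph_diagForm {u w : H} : (u, w) ∈ (diagForm b l hl).generatorGraph ↔
    ∀ i, inner ℝ (b i) w = -(l i * inner ℝ (b i) u) := by
  constructor
  · rintro ⟨h, hv⟩ i
    have := hv ⟨b i, mem_diagForm_domain_basis b hl i⟩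
    rw [diagForm_basis_right] at this
    change l i * inner ℝ (b i) u = -inner ℝ w (b i) at this
    rw [this, neg_neg, real_inner_comm]
  · intro h
    have hu : u ∈ (diagForm b l hl).domain := by
      rw [mem_diagForm_domain]
      have := (b.summable_inner_mul_inner u w).neg
      refine this.congr fun i => ?_
      rw [h, real_inner_comm]
      ring
    refine ⟨hu, fun v => ?_⟩
    rw [diagForm_apply, ← b.tsum_inner_mul_inner w v, ← tsum_neg]
    refine tsum_congr fun i => ?_
    rw [← real_inner_comm w, h]
    ring

theorem eq_zero_of_mem_generatorGraph (p : H × H) (hp : p ∈ (diagForm b l hl).generatorGraph)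
    (h0 : p.1 = 0) : p.2 = 0 := by
  obtain ⟨u, w⟩ := p
  rw [mem_generatorGraph_diagForm] at hp
  dsimp only at h0 ⊢
  subst h0
  exact hilbertBasis_ext b fun i => by simp [hp i]

theorem diagForm_generator_graph :
    (diagForm b l hl).generator.graph = (diagForm b l hl).generatorGraph :=
  Submodule.toLinearPMap_graph_eq _ (eq_zero_of_mem_generatorGraph b hl)

theorem abs_exp_neg_le_one {s : ℝ} (hs : 0 ≤ s) : |Real.exp (-s)| ≤ 1 := by
  rw [abs_of_pos (Real.exp_pos _)]
  exact Real.exp_le_one_iff.2 (by linarith)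

/-- The semigroup `exp (-t l)` generated by the diagonal form. -/
def diagSemigroup (t : ℝ≥0) : H →L[ℝ] H :=
  diagOp b (fun i => Real.exp (-(t * l i))) 1 fun i =>
    abs_exp_neg_le_one (mul_nonneg t.2 (hl i))

theorem inner_diagSemigroup (t : ℝ≥0) (i : ι) (u : H) :
    inner ℝ (b i) (diagSemigroup b hl t u) = Real.exp (-(t * l i)) * inner ℝ (b i) u :=
  inner_diagOp ..

theorem tendsto_exp_sub_one_div (r : ℝ) :
    Tendsto (fun t : ℝ≥0 => (t : ℝ)⁻¹ * (Real.exp (-(t * r)) - 1)) (𝓝[>] 0) (𝓝 (-r)) := by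
  have h : HasDerivAt (fun t : ℝ => Real.exp (-(t * r))) (-r) 0 := by
    have := ((hasDerivAt_id (0 : ℝ)).mul_const r).neg.exp
    simpa using this
  have h2 := h.tendsto_slope_zero_right
  have h3 : Tendsto (fun t : ℝ≥0 => (t : ℝ)) (𝓝[>] 0) (𝓝[>] 0) := by
    refine tendsto_nhdsWithin_iff.2 ⟨?_, ?_⟩
    · exact (NNReal.continuous_coe.tendsto' 0 0 rfl).mono_left nhdsWithin_le_nhds
    · filter_upwards [self_mem_nhdsWithin] with t ht
      exact NNReal.coe_pos.2 ht
  have := h2.comp h3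
  simpa [Function.comp_def] using this

theorem diagSemigroup_isSemigroupOf :
    IsSemigroupOf (diagSemigroup b hl) (diagForm b l hl).generator where
  zero := by
    ext u
    exact hilbertBasis_ext b fun i => by simp [inner_diagSemigroup]
  add s t := by
    ext u
    refine hilbertBasis_ext b fun i => ?_
    rw [mul_apply_eq_comp, inner_diagSemigroup, inner_diagSemigroup,
      inner_diagSemigroup, ← mul_assoc, ← Real.exp_add]
    congr 2
    push_cast
    ring
  continuous_zero u := by
    refine tendsto_of_tendsto_inner b (fun i => |inner ℝ (b i) u|)
      (by simpa using (hasSum_inner_sq b u).summable) (Eventually.of_forall fun t i => ?_)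
      fun i => ?_
    · rw [inner_diagSemigroup, abs_mul]
      exact mul_le_of_le_one_left (abs_nonneg _) (abs_exp_neg_le_one (mul_nonneg t.2 (hl i)))
    · simp only [inner_diagSemigroup]
      have : Continuous fun t : ℝ≥0 => Real.exp (-(t * l i)) * inner ℝ (b i) u := by fun_prop
      exact this.tendsto' 0 _ (by simp)
  generator u w := by
    rw [diagForm_generator_graph, mem_generatorGraph_diagForm]
    have hcoef : ∀ (t : ℝ≥0) (i : ι), inner ℝ (b i) ((t : ℝ)⁻¹ • (diagSemigroup b hl t u - u)) =
        ((t : ℝ)⁻¹ * (Real.exp (-(t * l i)) - 1)) * inner ℝ (b i) u := fun t i => by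
      rw [real_inner_smul_right, inner_sub_right, inner_diagSemigroup]
      ring
    constructor
    · intro h
      refine tendsto_of_tendsto_inner b (fun i => |inner ℝ (b i) w|)
        (by simpa using (hasSum_inner_sq b w).summable) ?_ fun i => ?_
      -- Dominated convergence of the coefficients, by `|exp (-t l) - 1| / t ≤ l`.
      · filter_upwards [self_mem_nhdsWithin] with t ht i
        rw [hcoef, h, abs_mul, abs_neg, abs_mul (l i)]
        refine mul_le_mul_of_nonneg_right ?_ (abs_nonneg _)
        have ht' : (0 : ℝ) < t := NNReal.coe_pos.2 ht
        have hti := mul_nonneg ht'.le (hl i)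
        rw [abs_mul, abs_of_pos (inv_pos.2 ht'), inv_mul_le_iff₀ ht', abs_of_nonneg (hl i), abs_le]
        constructor
        · linarith [Real.add_one_le_exp (-((t : ℝ) * l i))]
        · linarith [Real.exp_le_one_iff.2 (neg_nonpos.2 hti)]
      · simp only [hcoef]
        rw [h, ← neg_mul]
        exact (tendsto_exp_sub_one_div (l i)).mul_const _
    · intro h i
      have h1 : Tendsto (fun x : H => inner ℝ (b i) x) (𝓝 w) (𝓝 (inner ℝ (b i) w)) :=
        (continuous_const.inner continuous_id).tendsto w
      have h2 := (tendsto_exp_sub_one_div (l i)).mul_const (inner ℝ (b i) u)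
      have h3 : Tendsto (fun t : ℝ≥0 => inner ℝ (b i) ((t : ℝ)⁻¹ • (diagSemigroup b hl t u - u)))
          (𝓝[>] 0) (𝓝 (inner ℝ (b i) w)) := h1.comp h
      simp only [hcoef] at h3
      rw [tendsto_nhds_unique h3 h2]
      ring

theorem abs_inv_one_add_le_one {s : ℝ} (hs : 0 ≤ s) : |(1 + s)⁻¹| ≤ 1 := by
  rw [abs_of_pos (by positivity)]
  exact inv_le_one_of_one_le₀ (by linarith)

/-- The resolvent `(1 + s l)⁻¹` of the diagonal form. -/
def diagResolvent (s : ℝ≥0) : H →L[ℝ] H :=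
  diagOp b (fun i => (1 + s * l i)⁻¹) 1 fun i => abs_inv_one_add_le_one (mul_nonneg s.2 (hl i))

theorem inner_diagResolvent (s : ℝ≥0) (i : ι) (u : H) :
    inner ℝ (b i) (diagResolvent b hl s u) = (1 + s * l i)⁻¹ * inner ℝ (b i) u :=
  inner_diagOp ..

theorem inner_diagResolvent_pow (s : ℝ≥0) (i : ι) (n : ℕ) (u : H) :
    inner ℝ (b i) ((diagResolvent b hl s ^ n) u) = ((1 + s * l i)⁻¹) ^ n * inner ℝ (b i) u := by
  induction n with
  | zero => simp
  | succ n ih =>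
    rw [pow_succ', mul_apply_eq_comp, inner_diagResolvent, ih]
    ring

/-- The exponential formula `P_t = lim (1 + (t/n) l)⁻ⁿ`. -/
theorem tendsto_diagResolvent_pow (t : ℝ≥0) (u : H) :
    Tendsto (fun n : ℕ => (diagResolvent b hl (t / n) ^ n) u) atTop
      (𝓝 (diagSemigroup b hl t u)) := by
  refine tendsto_of_tendsto_inner b (fun i => |inner ℝ (b i) u|)
    (by simpa using (hasSum_inner_sq b u).summable) (Eventually.of_forall fun n i => ?_)
    fun i => ?_
  · rw [inner_diagResolvent_pow, abs_mul, abs_pow]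
    exact mul_le_of_le_one_left (abs_nonneg _) (pow_le_one₀ (abs_nonneg _)
      (abs_inv_one_add_le_one (mul_nonneg (t / n).2 (hl i))))
  · simp only [inner_diagResolvent_pow, inner_diagSemigroup]
    refine Tendsto.mul_const _ ?_
    have h := (Real.tendsto_one_add_div_pow_exp (t * l i)).inv₀ (Real.exp_pos _).ne'
    rw [← Real.exp_neg] at h
    refine h.congr fun n => ?_
    rw [inv_pow]
    push_cast
    congr 3
    ring

/-- The resolvent equation in weak form. -/
theorem diagResolvent_weak (s : ℝ≥0) (hs : s ≠ 0) (u : H) :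
    ∃ h : diagResolvent b hl s u ∈ (diagForm b l hl).domain, ∀ z : (diagForm b l hl).domain,
      s * (diagForm b l hl).form ⟨_, h⟩ z + inner ℝ (diagResolvent b hl s u - u) (z : H) = 0 := by
  have hs' : (0 : ℝ) < s := NNReal.coe_pos.2 (pos_iff_ne_zero.2 hs)
  have hpos : ∀ i, 0 < 1 + s * l i := fun i => by have := mul_nonneg hs'.le (hl i); linarith
  have hg : (diagResolvent b hl s u, (s : ℝ)⁻¹ • (diagResolvent b hl s u - u)) ∈
      (diagForm b l hl).generatorGraph := by
    rw [mem_generatorGraph_diagForm]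
    intro i
    have := (hpos i).ne'
    rw [real_inner_smul_right, inner_sub_right, inner_diagResolvent]
    field_simp
    ring
  obtain ⟨h, h'⟩ := hg
  refine ⟨h, fun z => ?_⟩
  rw [h' z, real_inner_smul_left]
  field_simp
  ring

/-- The resolvent minimizes `s E(w, w) + ‖w - u‖²`, uniquely: a competitor that is not worse is
equal to it. -/
theorem diagResolvent_eq_of_le (s : ℝ≥0) (hs : s ≠ 0) (u w : H)
    (h : diagResolvent b hl s u ∈ (diagForm b l hl).domain)
    (hw : w ∈ (diagForm b l hl).domain)
    (h1 : (diagForm b l hl).form ⟨w, hw⟩ ⟨w, hw⟩ ≤ (diagForm b l hl).form ⟨_, h⟩ ⟨_, h⟩)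
    (h2 : ‖w - u‖ ≤ ‖diagResolvent b hl s u - u‖) : w = diagResolvent b hl s u := by
  obtain ⟨h0, hweak⟩ := diagResolvent_weak b hl s hs u
  generalize diagResolvent b hl s u = v at *
  generalize diagForm b l hl = E at *
  set z : E.domain := ⟨w, hw⟩ - ⟨v, h⟩ with hz
  have hz' : (z : H) = w - v := rfl
  have e1 : E.form ⟨w, hw⟩ ⟨w, hw⟩ =
      E.form ⟨v, h⟩ ⟨v, h⟩ + 2 * E.form ⟨v, h⟩ z + E.form z z := by
    have : (⟨w, hw⟩ : E.domain) = ⟨v, h⟩ + z := by rw [hz]; abel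
    rw [this]
    simp only [map_add, LinearMap.add_apply]
    rw [E.symm z ⟨v, h⟩]
    ring
  have e2 : ‖w - u‖ ^ 2 = ‖v - u‖ ^ 2 + 2 * inner ℝ (v - u) (z : H) + ‖(z : H)‖ ^ 2 := by
    have : w - u = (v - u) + z := by rw [hz']; abel
    rw [this, norm_add_sq_real]
  have e3 := hweak z
  have e4 : ‖w - u‖ ^ 2 ≤ ‖v - u‖ ^ 2 := pow_le_pow_left₀ (norm_nonneg _) h2 2
  have e5 := E.nonneg z
  have e6 : ‖(z : H)‖ ^ 2 ≤ 0 := by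
    nlinarith [mul_nonneg s.2 e5, mul_le_mul_of_nonneg_left h1 s.2]
  have e7 : (z : H) = 0 := by
    rw [← norm_eq_zero]
    exact pow_eq_zero_iff two_ne_zero |>.1 (le_antisymm e6 (sq_nonneg _))
  rw [hz', sub_eq_zero] at e7
  exact e7

end Diagonal

/-! ### Eigenbases of symmetric relations -/

universe u

section Eigenbasis

variable {H : Type u} [NormedAddCommGroup H] [InnerProductSpace ℝ H]

/-- The formal adjoint of a linear relation. -/
def formalAdjoint (G : Set (H × H)) : Submodule ℝ (H × H) where
  carrier := {p | ∀ q ∈ G, inner ℝ p.2 q.1 = inner ℝ p.1 q.2}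
  zero_mem' := fun q _ => by simp
  add_mem' := fun {p p'} hp hp' q hq => by
    simp [inner_add_left, hp q hq, hp' q hq]
  smul_mem' := fun c p hp q hq => by
    simp [real_inner_smul_left, hp q hq]

theorem isClosed_formalAdjoint (G : Set (H × H)) :
    _root_.IsClosed (formalAdjoint G : Set (H × H)) := by
  have : (formalAdjoint G : Set (H × H)) =
      ⋂ q ∈ G, {p : H × H | inner ℝ p.2 q.1 = inner ℝ p.1 q.2} := by
    ext p
    simp [formalAdjoint]
  rw [this]
  exact isClosed_biInter fun q _ => isClosed_eq (continuous_snd.inner continuous_const)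
    (continuous_fst.inner continuous_const)

/-- The closed linear relation generated by a symmetric set is symmetric. -/
theorem closure_span_symm {S : Set (H × H)}
    (hS : ∀ p ∈ S, ∀ q ∈ S, inner ℝ p.2 q.1 = inner ℝ p.1 q.2) :
    ∀ p ∈ (Submodule.span ℝ S).topologicalClosure, ∀ q ∈ (Submodule.span ℝ S).topologicalClosure,
      inner ℝ p.2 q.1 = inner ℝ p.1 q.2 := by
  have step : ∀ T : Set (H × H), S ⊆ formalAdjoint T →
      (Submodule.span ℝ S).topologicalClosure ≤ formalAdjoint T := fun T hT =>
    Submodule.topologicalClosure_minimal _ (Submodule.span_le.2 hT) (isClosed_formalAdjoint T)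
  have h1 := step S hS
  refine step _ fun p hp q hq => ?_
  have := h1 hq p hp
  rw [real_inner_comm, real_inner_comm q.2, this]

/-- A closed symmetric linear relation with a total set of eigenvectors has a Hilbert basis of
eigenvectors, each in the closed span of the given eigenvectors for its eigenvalue. -/
theorem exists_eigenbasis [CompleteSpace H] (G : Submodule ℝ (H × H))
    (hG : _root_.IsClosed (G : Set (H × H)))
    (hsymm : ∀ p ∈ G, ∀ q ∈ G, inner ℝ p.2 q.1 = inner ℝ p.1 q.2) (A : ℝ → Set H)
    (hA : ∀ l, ∀ u ∈ A l, (u, -(l • u)) ∈ G)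
    (hdense : (Submodule.span ℝ (⋃ l, A l)).topologicalClosure = ⊤) :
    ∃ (ι : Type u) (b : HilbertBasis ι ℝ H) (l : ι → ℝ), ∀ i,
      b i ∈ (Submodule.span ℝ (A (l i))).topologicalClosure ∧ (b i, -(l i • b i)) ∈ G := by
  set F : ℝ → Submodule ℝ H := fun l => (Submodule.span ℝ (A l)).topologicalClosure with hF
  have hFG : ∀ l, ∀ u ∈ F l, (u, -(l • u)) ∈ G := by
    intro l
    have : F l ≤ G.comap (LinearMap.id.prod (-(l • (LinearMap.id : H →ₗ[ℝ] H)))) := by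
      refine Submodule.topologicalClosure_minimal _ (Submodule.span_le.2 fun u hu => ?_) ?_
      · simpa using hA l u hu
      · refine hG.preimage (f := fun u : H => (u, -(l • u))) ?_
        fun_prop
    intro u hu
    simpa using this hu
  have : ∀ l, CompleteSpace (F l) := fun l =>
    (Submodule.isClosed_topologicalClosure _).completeSpace_coe
  choose w b hb using fun l => exists_hilbertBasis ℝ (F l)
  have hfam : OrthogonalFamily ℝ (fun l => F l) fun l => (F l).subtypeₗᵢ := by
    intro l l' hll u v
    have h := hsymm _ (hFG l u u.2) _ (hFG l' v v.2)
    simp only [inner_neg_left, inner_neg_right, real_inner_smul_left, real_inner_smul_right] at h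
    have h2 : (l - l') * inner ℝ (u : H) (v : H) = 0 := by linarith
    simpa [sub_eq_zero, hll] using h2
  have hon := hfam.orthonormal_sigma_orthonormal (v_family := fun l => (b l : w l → F l))
    fun l => (b l).orthonormal
  have hsp : (⊤ : Submodule ℝ H) ≤ (Submodule.span ℝ (Set.range
      fun a : Σ l, w l => (F a.1).subtypeₗᵢ (b a.1 a.2))).topologicalClosure := by
    rw [← hdense]
    refine Submodule.topologicalClosure_minimal _ (Submodule.span_le.2 ?_)
      (Submodule.isClosed_topologicalClosure _)
    refine Set.iUnion_subset fun l u hu => ?_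
    have huF : u ∈ F l := Submodule.le_topologicalClosure _ (Submodule.subset_span hu)
    have hsum := ((F l).subtypeL.hasSum ((b l).hasSum_repr ⟨u, huF⟩))
    refine mem_closure_of_tendsto hsum (Eventually.of_forall fun s => ?_)
    refine Submodule.sum_mem _ fun i _ => ?_
    rw [map_smul]
    exact Submodule.smul_mem _ _ (Submodule.subset_span ⟨⟨l, i⟩, rfl⟩)
  refine ⟨Σ l, w l, HilbertBasis.mk hon hsp, fun a => a.1, fun a => ?_⟩
  rw [HilbertBasis.coe_mk]
  exact ⟨(b a.1 a.2).2, hFG _ _ (b a.1 a.2).2⟩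

end Eigenbasis

/-! ### The generator on polynomials in finitely many variables -/

section Polynomials

open MvPolynomial

variable {σ : Type*} [Fintype σ] (a : σ → ℝ)

/-- The degree-lowering operator `∑_i (X_i ∂_i² + a_i ∂_i)`. -/
def polyLower : MvPolynomial σ ℝ →ₗ[ℝ] MvPolynomial σ ℝ :=
  ∑ i, (LinearMap.mulLeft ℝ (X i) ∘ₗ (pderiv i).toLinearMap ∘ₗ (pderiv i).toLinearMap +
    a i • (pderiv i).toLinearMap)

theorem polyLower_apply (p : MvPolynomial σ ℝ) :
    polyLower a p = ∑ i, (X i * pderiv i (pderiv i p) + a i • pderiv i p) := by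
  simp [polyLower]

/-- The Euler operator `∑_i X_i ∂_i`. -/
def polyEuler : MvPolynomial σ ℝ →ₗ[ℝ] MvPolynomial σ ℝ :=
  ∑ i, LinearMap.mulLeft ℝ (X i) ∘ₗ (pderiv i).toLinearMap

theorem polyEuler_apply (p : MvPolynomial σ ℝ) :
    polyEuler p = ∑ i, X i * pderiv i p := by
  simp [polyEuler]

/-- The generator `∑_i (X_i (1 - |X|) ∂_i² + (a_i (1 - |X|) - b X_i) ∂_i)` of the Dirichlet form
of the Dirichlet distribution with parameters `(a, b)`, acting on polynomials. -/
def polyGen (b : ℝ) (p : MvPolynomial σ ℝ) : MvPolynomial σ ℝ :=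
  (1 - ∑ i, X i) * polyLower a p - b • polyEuler p

theorem polyLower_isHomogeneous {p : MvPolynomial σ ℝ} {n : ℕ} (hp : p.IsHomogeneous n) :
    (polyLower a p).IsHomogeneous (n - 1) := by
  rw [polyLower_apply]
  refine IsHomogeneous.sum _ _ _ fun i _ => IsHomogeneous.add ?_ ?_
  · rcases Nat.lt_or_ge n 2 with h | h
    · have h1 : (pderiv i p).IsHomogeneous 0 := by
        have := hp.pderiv (i := i)
        rwa [show n - 1 = 0 by omega] at this
      obtain ⟨c, hc⟩ : ∃ c, pderiv i p = C c :=
        ⟨_, totalDegree_eq_zero_iff_eq_C.1 (Nat.le_zero.1 h1.totalDegree_le)⟩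
      rw [hc]
      simpa using isHomogeneous_zero σ ℝ _
    · have := (isHomogeneous_X ℝ i).mul ((hp.pderiv (i := i)).pderiv (i := i))
      rwa [show 1 + (n - 1 - 1) = n - 1 by omega] at this
  · rw [smul_eq_C_mul]
    simpa using (isHomogeneous_C σ (a i)).mul (hp.pderiv (i := i))

/-- The commutator of `∑_i (X_i ∂_i² + a_i ∂_i)` with the multiplication by `∑_i X_i`. -/
theorem polyLower_sum_X_mul (p : MvPolynomial σ ℝ) :
    polyLower a ((∑ i, X i) * p) =
      (∑ i, X i) * polyLower a p + 2 * polyEuler p + (∑ i, a i) • p := by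
  classical
  have h1 : ∀ i, pderiv i (∑ j, X j : MvPolynomial σ ℝ) = 1 := fun i => by
    rw [map_sum, Finset.sum_eq_single i]
    · exact pderiv_X_self i
    · intro j _ hj
      exact pderiv_X_of_ne hj
    · simp
  rw [polyLower_apply, polyLower_apply, polyEuler_apply, Finset.mul_sum, Finset.mul_sum,
    Finset.sum_smul, ← Finset.sum_add_distrib, ← Finset.sum_add_distrib]
  refine Finset.sum_congr rfl fun i _ => ?_
  rw [pderiv_mul, h1, one_mul, map_add, pderiv_mul, h1]
  simp only [smul_eq_C_mul]
  ring

/-- The operator `(∑_i X_i) ∑_i (X_i ∂_i² + a_i ∂_i)` has nonnegative eigenvalues on homogeneous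
polynomials. -/
theorem eigenvalue_nonneg_of_isHomogeneous (ha : ∀ i, 0 ≤ a i) (n : ℕ) :
    ∀ (q : MvPolynomial σ ℝ) (κ : ℝ), q.IsHomogeneous n → q ≠ 0 →
      (∑ i, X i) * polyLower a q = κ • q → 0 ≤ κ := by
  induction n with
  | zero =>
    intro q κ hq hq0 h
    obtain ⟨c, hc⟩ : ∃ c, q = C c :=
      ⟨_, totalDegree_eq_zero_iff_eq_C.1 (Nat.le_zero.1 hq.totalDegree_le)⟩
    have : polyLower a q = 0 := by
      rw [hc, polyLower_apply]
      simp
    rw [this, mul_zero] at h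
    rcases smul_eq_zero.1 h.symm with h | h
    · exact h.ge
    · exact absurd h hq0
  | succ n ih =>
    intro q κ hq hq0 h
    by_cases hD : polyLower a q = 0
    · rw [hD, mul_zero] at h
      rcases smul_eq_zero.1 h.symm with h | h
      · exact h.ge
      · exact absurd h hq0
    · -- `polyLower a q` is an eigenvector as well, of lower degree and for a smaller eigenvalue.
      have hr : (polyLower a q).IsHomogeneous n := polyLower_isHomogeneous a hq
      have h2 := congrArg (polyLower a) h
      have hE : polyEuler (polyLower a q) = (n : ℝ) • polyLower a q := by
        rw [polyEuler_apply, hr.sum_X_mul_pderiv, Nat.cast_smul_eq_nsmul]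
      rw [polyLower_sum_X_mul, map_smul, hE] at h2
      have h3 : (∑ i, X i) * polyLower a (polyLower a q) =
          (κ - 2 * n - ∑ i, a i) • polyLower a q := by
        have : (2 : MvPolynomial σ ℝ) * ((n : ℝ) • polyLower a q) =
            (2 * n : ℝ) • polyLower a q := by
          rw [mul_smul, two_smul, two_mul]
        rw [this] at h2
        rw [sub_smul, sub_smul, ← h2]
        abel
      have h4 := ih _ _ hr hD h3
      have h5 : 0 ≤ ∑ i, a i := Finset.sum_nonneg fun i _ => ha i
      have h6 : (0 : ℝ) ≤ n := n.cast_nonneg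
      linarith

theorem homogeneousComponent_polyLower (p : MvPolynomial σ ℝ) (n : ℕ) :
    homogeneousComponent n (polyLower a p) =
      polyLower a (homogeneousComponent (n + 1) p) := by
  classical
  have key : ∀ m : ℕ, homogeneousComponent n (polyLower a (homogeneousComponent m p)) =
      if m = n + 1 then polyLower a (homogeneousComponent m p) else 0 := by
    intro m
    rcases m with _ | m
    · rw [homogeneousComponent_zero, polyLower_apply]
      simp
    · rw [homogeneousComponent_of_mem ((mem_homogeneousSubmodule _ _).2
        (polyLower_isHomogeneous a (homogeneousComponent_isHomogeneous (m + 1) p)))]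
      simp [eq_comm]
  have hp := sum_homogeneousComponent p
  conv_lhs => rw [← hp, map_sum, map_sum]
  simp only [key]
  rw [Finset.sum_ite_eq']
  split_ifs with h
  · rfl
  · rw [homogeneousComponent_eq_zero _ _ (by simpa using h), map_zero]

theorem homogeneousComponent_polyEuler (p : MvPolynomial σ ℝ) (n : ℕ) :
    homogeneousComponent n (polyEuler p) = (n : ℝ) • homogeneousComponent n p := by
  classical
  have key : ∀ m : ℕ, homogeneousComponent n (polyEuler (homogeneousComponent m p)) =
      if m = n then (n : ℝ) • homogeneousComponent n p else 0 := by
    intro m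
    rw [polyEuler_apply, (homogeneousComponent_isHomogeneous m p).sum_X_mul_pderiv,
      map_nsmul, homogeneousComponent_of_mem ((mem_homogeneousSubmodule _ _).2
        (homogeneousComponent_isHomogeneous m p))]
    split_ifs with h h' h'
    · subst h; rw [Nat.cast_smul_eq_nsmul]
    · exact absurd h.symm h'
    · exact absurd h'.symm h
    · simp
  have hp := sum_homogeneousComponent p
  conv_lhs => rw [← hp, map_sum, map_sum]
  simp only [key]
  rw [Finset.sum_ite_eq']
  split_ifs with h
  · rfl
  · rw [homogeneousComponent_eq_zero _ _ (by simpa using h), smul_zero]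

theorem homogeneousComponent_sum_X_mul (p : MvPolynomial σ ℝ) (n : ℕ) :
    homogeneousComponent (n + 1) ((∑ i, X i) * p) = (∑ i, X i) * homogeneousComponent n p := by
  classical
  have hX : (∑ i, X i : MvPolynomial σ ℝ).IsHomogeneous 1 :=
    IsHomogeneous.sum _ _ _ fun i _ => isHomogeneous_X ℝ i
  have key : ∀ m : ℕ, homogeneousComponent (n + 1) ((∑ i, X i) * homogeneousComponent m p) =
      if m = n then (∑ i, X i) * homogeneousComponent m p else 0 := by
    intro m
    rw [homogeneousComponent_of_mem ((mem_homogeneousSubmodule _ _).2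
        (hX.mul (homogeneousComponent_isHomogeneous m p)))]
    exact if_congr (by omega) rfl rfl
  have hp := sum_homogeneousComponent p
  conv_lhs => rw [← hp, Finset.mul_sum, map_sum]
  simp only [key]
  rw [Finset.sum_ite_eq']
  split_ifs with h
  · rfl
  · rw [homogeneousComponent_eq_zero _ _ (by simpa using h), mul_zero]

omit [Fintype σ] in
theorem homogeneousComponent_totalDegree_ne_zero {p : MvPolynomial σ ℝ} (hp : p ≠ 0) :
    homogeneousComponent p.totalDegree p ≠ 0 := by
  obtain ⟨m, hm, hm'⟩ := Finset.exists_mem_eq_sup p.support (support_nonempty.2 hp)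
    fun s => s.sum fun _ e => e
  have hdeg : m.degree = p.totalDegree := by
    rw [totalDegree, hm', Finsupp.degree_apply]
    rfl
  intro h
  have h1 := congrArg (coeff m) h
  rw [coeff_homogeneousComponent, if_pos hdeg, coeff_zero] at h1
  exact (mem_support_iff.1 hm) h1

theorem homogeneousComponent_polyGen (b : ℝ) (p : MvPolynomial σ ℝ) (n : ℕ) :
    homogeneousComponent (n + 1) (polyGen a b p) =
      polyLower a (homogeneousComponent (n + 2) p) -
        (∑ i, X i) * polyLower a (homogeneousComponent (n + 1) p) -
        (b * (n + 1 : ℕ)) • homogeneousComponent (n + 1) p := by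
  rw [polyGen, map_sub, sub_mul, one_mul, map_sub, homogeneousComponent_polyLower,
    homogeneousComponent_sum_X_mul, homogeneousComponent_polyLower, map_smul,
    homogeneousComponent_polyEuler, mul_smul]

theorem totalDegree_polyGen_le (b : ℝ) (p : MvPolynomial σ ℝ) :
    (polyGen a b p).totalDegree ≤ p.totalDegree := by
  by_contra! h
  obtain ⟨n, hn⟩ : ∃ n, (polyGen a b p).totalDegree = n + 1 :=
    ⟨(polyGen a b p).totalDegree - 1, by omega⟩
  have h0 : polyGen a b p ≠ 0 := by
    rintro h0
    simp [h0] at h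
  refine homogeneousComponent_totalDegree_ne_zero h0 ?_
  rw [hn, homogeneousComponent_polyGen, homogeneousComponent_eq_zero (n + 2) p (by omega),
    homogeneousComponent_eq_zero (n + 1) p (by omega)]
  simp

/-- The eigenvalues of `-polyGen a b` are at least `b`, except for the eigenvalue `0` of the
constants: the part of top degree of an eigenvector of degree `d` is an eigenvector of
`b d + (∑_i X_i) ∑_i (X_i ∂_i² + a_i ∂_i)`. -/
theorem polyGen_eigenvalue (ha : ∀ i, 0 ≤ a i) {b : ℝ} (hb : 0 < b) {p : MvPolynomial σ ℝ}
    (hp : p ≠ 0) {κ : ℝ} (h : polyGen a b p = -(κ • p)) :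
    b ≤ κ ∨ (κ = 0 ∧ ∃ c, p = C c) := by
  set d := p.totalDegree with hd
  rcases Nat.eq_zero_or_pos d with h0 | hpos
  · right
    have hc := totalDegree_eq_zero_iff_eq_C.1 (hd.symm.trans h0)
    refine ⟨?_, _, hc⟩
    have : polyGen a b p = 0 := by
      rw [hc, polyGen, polyLower_apply, polyEuler_apply]
      simp
    rw [this, eq_comm, neg_eq_zero, smul_eq_zero] at h
    exact h.resolve_right hp
  · left
    obtain ⟨n, hn⟩ : ∃ n, d = n + 1 := ⟨d - 1, by omega⟩
    set q := homogeneousComponent d p with hq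
    have hq0 : q ≠ 0 := homogeneousComponent_totalDegree_ne_zero hp
    have h1 := congrArg (homogeneousComponent d) h
    rw [hn, homogeneousComponent_polyGen, homogeneousComponent_eq_zero (n + 2) p (by omega),
      map_zero, zero_sub, map_neg, map_smul, ← hn, ← hq] at h1
    have h2 : (∑ i, X i) * polyLower a q = (κ - b * d) • q := by
      rw [sub_smul, ← neg_neg (κ • q), ← h1]
      abel
    have h3 := eigenvalue_nonneg_of_isHomogeneous a ha d q _ (homogeneousComponent_isHomogeneous _ _)
      hq0 h2
    have h4 : (1 : ℝ) ≤ d := by exact_mod_cast hpos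
    nlinarith

end Polynomials

/-! ### Dirichlet distributions: integration by parts -/

section Dirichlet

theorem measurableSet_finSimplex (N : ℕ) : MeasurableSet (finSimplex N) := by
  have : finSimplex N = (⋂ i, {x : Fin N → ℝ | 0 ≤ x i}) ∩ {x | ∑ i, x i ≤ 1} := by
    ext x
    simp [finSimplex]
  rw [this]
  refine MeasurableSet.inter (MeasurableSet.iInter fun i =>
    measurableSet_le measurable_const (measurable_pi_apply i)) ?_
  exact measurableSet_le (by fun_prop) measurable_const

theorem mem_Icc_of_mem_finSimplex {N : ℕ} {x : Fin N → ℝ} (hx : x ∈ finSimplex N) (i : Fin N) :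
    x i ∈ Set.Icc (0 : ℝ) 1 :=
  ⟨hx.1 i, (Finset.single_le_sum (fun j _ => hx.1 j) (Finset.mem_univ i)).trans hx.2⟩

theorem isClosed_finSimplex (N : ℕ) : _root_.IsClosed (finSimplex N) := by
  have : finSimplex N = (⋂ i, {x : Fin N → ℝ | 0 ≤ x i}) ∩ {x | ∑ i, x i ≤ 1} := by
    ext x
    simp [finSimplex]
  rw [this]
  refine IsClosed.inter (isClosed_iInter fun i =>
    isClosed_le continuous_const (continuous_apply i)) ?_
  exact isClosed_le (by fun_prop) continuous_const

theorem isCompact_finSimplex (N : ℕ) : IsCompact (finSimplex N) :=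
  (isCompact_univ_pi fun _ : Fin N => isCompact_Icc (a := (0 : ℝ)) (b := 1)).of_isClosed_subset
    (isClosed_finSimplex N) fun _ hx i _ => mem_Icc_of_mem_finSimplex hx i

@[fun_prop]
theorem measurable_dirichletDensity {N : ℕ} (a : Fin N → ℝ) (b : ℝ) :
    Measurable (dirichletDensity a b) := by
  unfold dirichletDensity
  fun_prop

/-- The normalizing constant of the Dirichlet density. -/
def dirichletConst {N : ℕ} (a : Fin N → ℝ) (b : ℝ) : ℝ :=
  Real.Gamma (∑ i, a i + b) / ((∏ i, Real.Gamma (a i)) * Real.Gamma b)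

theorem dirichletConst_pos {N : ℕ} {a : Fin N → ℝ} {b : ℝ} (ha : ∀ i, 0 < a i) (hb : 0 < b) :
    0 < dirichletConst a b := by
  have h1 : 0 ≤ ∑ i, a i := Finset.sum_nonneg fun i _ => (ha i).le
  exact div_pos (Real.Gamma_pos_of_pos (by linarith)) (mul_pos
    (Finset.prod_pos fun i _ => Real.Gamma_pos_of_pos (ha i)) (Real.Gamma_pos_of_pos hb))

theorem dirichletDensity_nonneg {N : ℕ} {a : Fin N → ℝ} {b : ℝ} (ha : ∀ i, 0 < a i) (hb : 0 < b)
    {x : Fin N → ℝ} (hx : x ∈ finSimplex N) : 0 ≤ dirichletDensity a b x :=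
  mul_nonneg (mul_nonneg (dirichletConst_pos ha hb).le
    (Real.rpow_nonneg (by linarith [hx.2]) _))
    (Finset.prod_nonneg fun i _ => Real.rpow_nonneg (hx.1 i) _)

theorem integral_dirichlet {N : ℕ} {a : Fin N → ℝ} {b : ℝ} (ha : ∀ i, 0 < a i) (hb : 0 < b)
    (F : (Fin N → ℝ) → ℝ) : ∫ x, F x ∂(dirichlet a b) =
      ∫ x, (finSimplex N).indicator (fun x => dirichletDensity a b x * F x) x := by
  rw [dirichlet, integral_withDensity_eq_integral_toReal_smul (by fun_prop) (by simp),
    integral_indicator (measurableSet_finSimplex N)]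
  refine setIntegral_congr_fun (measurableSet_finSimplex N) fun x hx => ?_
  simp only [smul_eq_mul]
  rw [ENNReal.toReal_ofReal (dirichletDensity_nonneg ha hb hx)]

theorem integrable_indicator_dirichletDensity {N : ℕ} {a : Fin N → ℝ} {b : ℝ}
    (ha : ∀ i, 0 < a i) (hb : 0 < b) {F : (Fin N → ℝ) → ℝ} (hF : Integrable F (dirichlet a b)) :
    Integrable ((finSimplex N).indicator fun x => dirichletDensity a b x * F x) := by
  rw [integrable_indicator_iff (measurableSet_finSimplex N)]
  rw [dirichlet, integrable_withDensity_iff_integrable_smul' (by fun_prop) (by simp)] at hF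
  refine (integrableOn_congr_fun (fun x hx => ?_) (measurableSet_finSimplex N)).1 hF
  simp only [smul_eq_mul]
  rw [ENNReal.toReal_ofReal (dirichletDensity_nonneg ha hb hx)]

theorem ae_mem_finSimplex {N : ℕ} (a : Fin N → ℝ) (b : ℝ) :
    ∀ᵐ x ∂(dirichlet a b), x ∈ finSimplex N :=
  (withDensity_absolutelyContinuous _ _).ae_le (ae_restrict_mem (measurableSet_finSimplex N))

/-- A continuous function is integrable with respect to a finite Dirichlet measure. -/
theorem integrable_dirichlet {N : ℕ} (a : Fin N → ℝ) (b : ℝ) [IsFiniteMeasure (dirichlet a b)]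
    {F : (Fin N → ℝ) → ℝ} (hF : Continuous F) : Integrable F (dirichlet a b) := by
  obtain ⟨C, hC⟩ := (isCompact_finSimplex N).exists_bound_of_continuousOn hF.continuousOn
  exact Integrable.of_bound hF.aestronglyMeasurable C
    ((ae_mem_finSimplex a b).mono fun x hx => hC x hx)

/-- Integration by parts for the weight `t^(p-1) (s-t)^(q-1)` on `[0, s]`. If the integrand is not
integrable, the statement holds by convention. -/
theorem integral_betaWeight_eq_zero {p q s : ℝ} (hp : 0 < p) (hq : 0 < q) (hs : 0 ≤ s)
    {g g' : ℝ → ℝ} (hg : ∀ t, HasDerivAt g (g' t) t) :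
    ∫ t in (0 : ℝ)..s, (t ^ (p - 1) * (s - t) ^ (q - 1)) *
      (t * (s - t) * g' t + (p * (s - t) - q * t) * g t) = 0 := by
  by_cases hint : IntervalIntegrable (fun t => (t ^ (p - 1) * (s - t) ^ (q - 1)) *
      (t * (s - t) * g' t + (p * (s - t) - q * t) * g t)) volume 0 s
  swap
  · exact intervalIntegral.integral_undef hint
  have hgc : Continuous g := continuous_iff_continuousAt.2 fun t => (hg t).continuousAt
  have hcont : Continuous fun t : ℝ => t ^ p * (s - t) ^ q * g t :=
    ((Real.continuous_rpow_const hp.le).mul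
      ((continuous_const.sub continuous_id).rpow_const fun _ => Or.inr hq.le)).mul hgc
  rw [intervalIntegral.integral_eq_sub_of_hasDerivAt_of_le (f := fun t => t ^ p * (s - t) ^ q * g t)
    hs hcont.continuousOn (fun t ht => ?_) hint]
  · simp [Real.zero_rpow hp.ne', Real.zero_rpow hq.ne']
  · have ht1 : t ≠ 0 := ht.1.ne'
    have ht2 : s - t ≠ 0 := (sub_pos.2 ht.2).ne'
    have h1 : HasDerivAt (fun t : ℝ => t ^ p) (1 * p * t ^ (p - 1)) t :=
      (hasDerivAt_id t).rpow_const (Or.inl ht1)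
    have h2 : HasDerivAt (fun t : ℝ => (s - t) ^ q) (-1 * q * (s - t) ^ (q - 1)) t :=
      ((hasDerivAt_id t).const_sub s).rpow_const (Or.inl ht2)
    refine ((h1.mul h2).mul (hg t)).congr_deriv ?_
    have e1 : t ^ p = t ^ (p - 1) * t := by
      rw [Real.rpow_sub_one ht1, div_mul_cancel₀ _ ht1]
    have e2 : (s - t) ^ q = (s - t) ^ (q - 1) * (s - t) := by
      rw [Real.rpow_sub_one ht2, div_mul_cancel₀ _ ht2]
    simp only [Pi.mul_apply]
    rw [e1, e2]
    ring

theorem sum_insertNth {N : ℕ} (n : Fin (N + 1)) (t : ℝ) (y : Fin N → ℝ) :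
    ∑ i, (n.insertNth t y : Fin (N + 1) → ℝ) i = t + ∑ j, y j := by
  rw [Fin.sum_univ_succAbove _ n]
  simp

theorem dirichletDensity_insertNth {N : ℕ} (a : Fin (N + 1) → ℝ) (b : ℝ) (n : Fin (N + 1))
    (t : ℝ) (y : Fin N → ℝ) :
    dirichletDensity a b (n.insertNth t y) = dirichletConst a b *
      (∏ j, y j ^ (a (n.succAbove j) - 1)) *
      (t ^ (a n - 1) * ((1 - ∑ j, y j) - t) ^ (b - 1)) := by
  have h : ∏ i, (n.insertNth t y : Fin (N + 1) → ℝ) i ^ (a i - 1) =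
      t ^ (a n - 1) * ∏ j, y j ^ (a (n.succAbove j) - 1) := by
    rw [Fin.prod_univ_succAbove _ n]
    simp
  rw [dirichletDensity, sum_insertNth, h, dirichletConst, sub_sub, add_comm t]
  ring

theorem insertNth_mem_finSimplex {N : ℕ} (n : Fin (N + 1)) (t : ℝ) (y : Fin N → ℝ) :
    (n.insertNth t y : Fin (N + 1) → ℝ) ∈ finSimplex (N + 1) ↔
      (∀ j, 0 ≤ y j) ∧ 0 ≤ t ∧ t ≤ 1 - ∑ j, y j := by
  rw [finSimplex, Set.mem_ofPred_eq, sum_insertNth, n.forall_iff_succAbove]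
  simp only [Fin.insertNth_apply_same, Fin.insertNth_apply_succAbove]
  constructor
  · rintro ⟨⟨h1, h2⟩, h3⟩
    exact ⟨h2, h1, by linarith⟩
  · rintro ⟨h1, h2, h3⟩
    exact ⟨⟨h2, h1⟩, by linarith⟩

/-- Integration by parts in the `n`-th coordinate for the Dirichlet distribution; the boundary
terms vanish, because the density is multiplied by `x_n (1 - |x|)`. -/
theorem integral_dirichlet_by_parts {N : ℕ} {a : Fin (N + 1) → ℝ} {b : ℝ} (ha : ∀ i, 0 < a i)
    (hb : 0 < b) [IsFiniteMeasure (dirichlet a b)] (n : Fin (N + 1))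
    {h h' : (Fin (N + 1) → ℝ) → ℝ} (hc : Continuous h) (hc' : Continuous h')
    (hd : ∀ x, HasDerivAt (fun t => h (Function.update x n t)) (h' x) (x n)) :
    ∫ x, (x n * (1 - ∑ i, x i) * h' x + (a n * (1 - ∑ i, x i) - b * x n) * h x)
      ∂(dirichlet a b) = 0 := by
  set F : (Fin (N + 1) → ℝ) → ℝ := fun x =>
    x n * (1 - ∑ i, x i) * h' x + (a n * (1 - ∑ i, x i) - b * x n) * h x with hF
  have hFc : Continuous F := by fun_prop
  have hint := integrable_indicator_dirichletDensity ha hb (integrable_dirichlet a b hFc)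
  rw [integral_dirichlet ha hb]
  have hmp := (volume_preserving_piFinSuccAbove (fun _ : Fin (N + 1) => ℝ) n).symm
  -- Integrate over the `n`-th coordinate first: the inner integral already vanishes
  -- for every value `y` of the other coordinates.
  rw [← hmp.integral_comp (MeasurableEquiv.measurableEmbedding _)]
  have hint' := (hmp.integrable_comp_emb (MeasurableEquiv.measurableEmbedding _)).2 hint
  refine (integral_prod_symm _ hint').trans ?_
  refine integral_eq_zero_of_ae (Eventually.of_forall fun y => ?_)
  change ∫ t, (finSimplex (N + 1)).indicator (fun x => dirichletDensity a b x * F x)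
    (n.insertNth t y) = 0
  by_cases hy : (∀ j, 0 ≤ y j) ∧ 0 ≤ 1 - ∑ j, y j
  swap
  · refine integral_eq_zero_of_ae (Eventually.of_forall fun t => Set.indicator_of_notMem ?_ _)
    rw [insertNth_mem_finSimplex]
    exact fun ⟨h1, h2, h3⟩ => hy ⟨h1, h2.trans h3⟩
  obtain ⟨hy0, hs⟩ := hy
  set s := 1 - ∑ j, y j with hsdef
  have hderiv : ∀ t, HasDerivAt (fun t => h (n.insertNth t y)) (h' (n.insertNth t y)) t := by
    intro t
    have := hd (n.insertNth t y)
    simpa only [Fin.insertNth_apply_same, Fin.update_insertNth] using this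
  have hz := integral_betaWeight_eq_zero (ha n) hb hs hderiv
  rw [intervalIntegral.integral_of_le hs, ← integral_Icc_eq_integral_Ioc] at hz
  have key : ∀ t, (finSimplex (N + 1)).indicator (fun x => dirichletDensity a b x * F x)
      (n.insertNth t y) = (Set.Icc 0 s).indicator (fun t => (dirichletConst a b *
        (∏ j, y j ^ (a (n.succAbove j) - 1))) * ((t ^ (a n - 1) * (s - t) ^ (b - 1)) *
      (t * (s - t) * h' (n.insertNth t y) + (a n * (s - t) - b * t) * h (n.insertNth t y)))) t := by
    intro t
    by_cases ht : t ∈ Set.Icc 0 s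
    · rw [Set.indicator_of_mem ht, Set.indicator_of_mem
        ((insertNth_mem_finSimplex n t y).2 ⟨hy0, ht⟩), dirichletDensity_insertNth, hF]
      simp only [Fin.insertNth_apply_same, sum_insertNth]
      rw [show 1 - (t + ∑ j, y j) = s - t by rw [hsdef]; ring]
      ring
    · rw [Set.indicator_of_notMem ht, Set.indicator_of_notMem
        fun h => ht ((insertNth_mem_finSimplex n t y).1 h).2]
  simp_rw [key]
  rw [integral_indicator measurableSet_Icc, integral_const_mul, hz, mul_zero]

/-- The means of the Dirichlet distribution. -/
theorem integral_dirichlet_coord {N : ℕ} {a : Fin (N + 1) → ℝ} {b : ℝ} (ha : ∀ i, 0 < a i)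
    (hb : 0 < b) [IsProbabilityMeasure (dirichlet a b)] (n : Fin (N + 1)) :
    ∫ x, x n ∂(dirichlet a b) = a n / (∑ i, a i + b) := by
  have hI : ∀ {F : (Fin (N + 1) → ℝ) → ℝ}, Continuous F → Integrable F (dirichlet a b) :=
    fun hF => integrable_dirichlet a b hF
  set c := ∫ x, (1 - ∑ i, x i) ∂(dirichlet a b) with hc
  have h1 : ∀ i, b * ∫ x, x i ∂(dirichlet a b) = a i * c := by
    intro i
    -- Integration by parts against the constant `1`.
    have h := integral_dirichlet_by_parts ha hb i (h := fun _ => 1) (h' := fun _ => 0)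
      continuous_const continuous_const fun x => hasDerivAt_const _ _
    simp only [mul_zero, zero_add, mul_one] at h
    rw [integral_sub (hI (by fun_prop)) (hI (by fun_prop)), integral_const_mul,
      integral_const_mul] at h
    linarith
  have h2 : c = 1 - ∑ i, ∫ x, x i ∂(dirichlet a b) := by
    rw [hc, integral_sub (hI (by fun_prop)) (hI (by fun_prop)),
      integral_finsetSum _ fun i _ => hI (by fun_prop)]
    simp
  have h3 : (∑ i, a i + b) * c = b := by
    have : b * c = b - ∑ i, a i * c := by
      rw [← Finset.sum_congr rfl fun i _ => h1 i, ← Finset.mul_sum, h2]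
      ring
    rw [add_mul, this, Finset.sum_mul]
    ring
  have h4 : 0 < ∑ i, a i + b := by
    have : 0 ≤ ∑ i, a i := Finset.sum_nonneg fun i _ => (ha i).le
    linarith
  rw [eq_div_iff h4.ne']
  have := h1 n
  apply mul_left_cancel₀ hb.ne'
  linear_combination (∑ i, a i + b) * this + a n * h3

/-- A polynomial that vanishes almost everywhere for a Dirichlet distribution is zero, because the
density is positive in the interior of the simplex. -/
theorem eq_zero_of_ae_dirichlet {N : ℕ} {a : Fin N → ℝ} {b : ℝ} (ha : ∀ i, 0 < a i) (hb : 0 < b)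
    {p : MvPolynomial (Fin N) ℝ} (hp : ∀ᵐ x ∂(dirichlet a b), MvPolynomial.eval x p = 0) :
    p = 0 := by
  set U : Set (Fin N → ℝ) := Set.univ.pi fun _ => Set.Ioo 0 ((N : ℝ) + 1)⁻¹ with hU
  have hUo : IsOpen U := isOpen_set_pi Set.finite_univ fun _ _ => isOpen_Ioo
  have hN : (0 : ℝ) < (N : ℝ) + 1 := by positivity
  have hUsum : ∀ x ∈ U, ∑ i, x i < 1 := by
    intro x hx
    have h1 : ∑ i, x i ≤ ∑ _i : Fin N, ((N : ℝ) + 1)⁻¹ :=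
      Finset.sum_le_sum fun i _ => (hx i trivial).2.le
    refine h1.trans_lt ?_
    rw [Finset.sum_const, Finset.card_univ, Fintype.card_fin, nsmul_eq_mul,
      mul_inv_lt_iff₀ hN]
    linarith
  have hUs : U ⊆ finSimplex N := fun x hx =>
    ⟨fun i => (hx i trivial).1.le, (hUsum x hx).le⟩
  have hdens : ∀ x ∈ U, 0 < dirichletDensity a b x := fun x hx =>
    mul_pos (mul_pos (dirichletConst_pos ha hb)
      (Real.rpow_pos_of_pos (by linarith [hUsum x hx]) _))
      (Finset.prod_pos fun i _ => Real.rpow_pos_of_pos (hx i trivial).1 _)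
  rw [dirichlet, ae_withDensity_iff (by fun_prop)] at hp
  have h1 : ∀ᵐ x ∂(volume.restrict U), MvPolynomial.eval x p = 0 := by
    filter_upwards [ae_mono (Measure.restrict_mono hUs le_rfl) hp,
      ae_restrict_mem hUo.measurableSet] with x hx hxU
    exact hx (ENNReal.ofReal_pos.2 (hdens x hxU)).ne'
  have h2 : Set.EqOn (fun x => MvPolynomial.eval x p) (fun _ => 0) U :=
    Measure.eqOn_open_of_ae_eq h1 hUo (MvPolynomial.continuous_eval p).continuousOn
      continuousOn_const
  refine MvPolynomial.funext_set (fun _ => Set.Ioo 0 ((N : ℝ) + 1)⁻¹)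
    (fun _ => Set.Ioo_infinite (by positivity)) fun x hx => ?_
  simpa using h2 hx

end Dirichlet

/-! ### The infinite-dimensional simplex -/

section Simplex

theorem summable_coords (x : InfSimplex) : Summable (coords x) := by
  have h := (memℓp_gen_iff (E := fun _ : ℕ => ℝ) (p := 1) (by simp)).1 x.1.2
  have h' : Summable fun j => |coords x j| := by simpa [coords] using h
  exact h'.of_abs

theorem coords_nonneg (x : InfSimplex) (i : ℕ) : 0 ≤ coords x i := x.2.1 i

theorem tsum_coords_le_one (x : InfSimplex) : ∑' i, coords x i ≤ 1 := x.2.2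

theorem tsum_coords_nonneg (x : InfSimplex) : 0 ≤ ∑' i, coords x i :=
  tsum_nonneg (coords_nonneg x)

theorem continuous_coord (i : ℕ) : Continuous fun x : InfSimplex => coords x i :=
  (continuous_apply i).comp continuous_coords

theorem dist_eq_tsum (x y : InfSimplex) : dist x y = ∑' i, |coords x i - coords y i| := by
  rw [Subtype.dist_eq, dist_eq_norm, lp.norm_eq_tsum_rpow (by simp)]
  simp [coords]

theorem abs_tsum_sub_le_dist (x y : InfSimplex) :
    |∑' i, coords x i - ∑' i, coords y i| ≤ dist x y := by
  have hs := (summable_coords x).sub (summable_coords y)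
  rw [dist_eq_tsum, ← (summable_coords x).tsum_sub (summable_coords y)]
  exact norm_tsum_le_tsum_norm hs.norm

theorem continuous_tsum_coords : Continuous fun x : InfSimplex => ∑' i, coords x i := by
  refine LipschitzWith.continuous (K := 1) (LipschitzWith.of_dist_le_mul fun x y => ?_)
  simpa [Real.dist_eq] using abs_tsum_sub_le_dist x y

theorem summable_coords_tail (x : InfSimplex) (k : ℕ) : Summable fun j => coords x (k + j) := by
  simpa [add_comm] using (summable_nat_add_iff k).2 (summable_coords x)

theorem sum_add_tsum_tail (x : InfSimplex) (k : ℕ) :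
    ∑ i ∈ Finset.range k, coords x i + ∑' j, coords x (k + j) = ∑' i, coords x i := by
  simpa [add_comm] using (summable_coords x).sum_add_tsum_nat_add k

theorem tendsto_tsum_tail (x : InfSimplex) :
    Tendsto (fun k => ∑' j, coords x (k + j)) atTop (𝓝 0) := by
  simpa [add_comm] using tendsto_sum_nat_add (coords x)

/-- Two points of the simplex with the same first `k` coordinates are at most the sum of their
tails apart. -/
theorem dist_le_tails {x y : InfSimplex} {k : ℕ} (h : ∀ i < k, coords x i = coords y i) :
    dist x y ≤ ∑' j, coords x (k + j) + ∑' j, coords y (k + j) := by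
  have hs : Summable fun i => |coords x i - coords y i| :=
    ((summable_coords x).sub (summable_coords y)).abs
  have hs' : Summable fun j => |coords x (k + j) - coords y (k + j)| :=
    ((summable_coords_tail x k).sub (summable_coords_tail y k)).abs
  have h0 := hs.sum_add_tsum_nat_add k
  rw [Finset.sum_eq_zero fun i hi => by simp [h i (Finset.mem_range.1 hi)], zero_add] at h0
  rw [dist_eq_tsum, ← h0,
    ← (summable_coords_tail x k).tsum_add (summable_coords_tail y k)]
  simp only [add_comm _ k]
  refine hs'.tsum_le_tsum (fun j => ?_)
    ((summable_coords_tail x k).add (summable_coords_tail y k))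
  have h1 := coords_nonneg x (k + j)
  have h2 := coords_nonneg y (k + j)
  exact abs_le.2 ⟨by linarith, by linarith⟩

theorem coords_embed {N : ℕ} (x : finSimplex N) : coords (embed x) = padZero x.1 := rfl

theorem coords_embed_of_lt {N : ℕ} (x : finSimplex N) {i : ℕ} (h : i < N) :
    coords (embed x) i = x.1 ⟨i, h⟩ := by
  simp [coords_embed, padZero, h]

theorem coords_embed_of_ge {N : ℕ} (x : finSimplex N) {i : ℕ} (h : N ≤ i) :
    coords (embed x) i = 0 := padZero_of_ge _ (by simpa using h)

theorem continuous_embed (N : ℕ) : Continuous (embed (N := N)) := by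
  have h : ∀ x y : finSimplex N, dist (embed x) (embed y) = ∑ i, |x.1 i - y.1 i| := by
    intro x y
    rw [dist_eq_tsum, tsum_eq_sum (s := Finset.range N), Finset.sum_range]
    · simp [coords_embed, padZero]
    · intro i hi
      rw [coords_embed_of_ge x (by simpa using hi), coords_embed_of_ge y (by simpa using hi)]
      simp
  refine continuous_iff_continuousAt.2 fun y => ?_
  rw [ContinuousAt, tendsto_iff_dist_tendsto_zero]
  simp only [h]
  have : Continuous fun x : finSimplex N => ∑ i, |x.1 i - y.1 i| :=
    continuous_finsetSum _ fun i _ =>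
      (((continuous_apply i).comp continuous_subtype_val).sub continuous_const).abs
  exact this.tendsto' y 0 (by simp)

theorem truncation_mem (x : InfSimplex) (k : ℕ) : (fun i : Fin k => coords x i) ∈ finSimplex k := by
  refine ⟨fun i => coords_nonneg x i, ?_⟩
  rw [← Finset.sum_range fun i => coords x i]
  exact ((summable_coords x).sum_le_tsum _ fun i _ => coords_nonneg x i).trans
    (tsum_coords_le_one x)

/-- The truncation `(x_0, …, x_{k-1}, 0, 0, …)` of a point of the simplex. -/
def truncation (k : ℕ) (x : InfSimplex) : InfSimplex := embed ⟨_, truncation_mem x k⟩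

theorem tendsto_truncation (x : InfSimplex) :
    Tendsto (fun k => truncation k x) atTop (𝓝 x) := by
  rw [tendsto_iff_dist_tendsto_zero]
  refine squeeze_zero (fun _ => dist_nonneg) (fun k => dist_le_tails (k := k) fun i hi => ?_) ?_
  · exact coords_embed_of_lt _ hi
  · have : ∀ k, ∑' j, coords (truncation k x) (k + j) = 0 := fun k => by
      rw [← tsum_zero (β := ℕ)]
      exact tsum_congr fun j => coords_embed_of_ge _ (by simp)
    simpa only [this, zero_add] using tendsto_tsum_tail x

/-- A map into the simplex is measurable if its coordinates are. -/
theorem measurable_of_coords {Ω : Type*} [MeasurableSpace Ω] {f : Ω → InfSimplex}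
    (hf : ∀ i, Measurable fun ω => coords (f ω) i) : Measurable f := by
  refine measurable_of_tendsto_metrizable (f := fun k ω => truncation k (f ω)) (fun k => ?_)
    (tendsto_pi_nhds.2 fun ω => tendsto_truncation (f ω))
  have h : Measurable fun ω => fun i : Fin k => coords (f ω) i :=
    measurable_pi_lambda _ fun i => hf i
  exact (continuous_embed k).measurable.comp h.subtype_mk

theorem aggregate_eq_snoc (c : ℕ → ℝ) (k : ℕ) :
    aggregate c k = Fin.snoc (α := fun _ => ℝ) (fun i : Fin k => c i) (∑' j, c (k + j)) := by
  ext i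
  refine Fin.lastCases ?_ (fun j => ?_) i
  · simp [aggregate]
  · simp [aggregate]

theorem sum_aggregate (c : ℕ → ℝ) (k : ℕ) :
    ∑ i, aggregate c k i = ∑ i ∈ Finset.range k, c i + ∑' j, c (k + j) := by
  rw [aggregate_eq_snoc, Fin.sum_snoc, Finset.sum_range]

theorem sum_aggregate_coords (x : InfSimplex) (k : ℕ) :
    ∑ i, aggregate (coords x) k i = ∑' i, coords x i := by
  rw [sum_aggregate, sum_add_tsum_tail]

theorem aggregate_mem (x : InfSimplex) (k : ℕ) : aggregate (coords x) k ∈ finSimplex (k + 1) := by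
  refine ⟨fun i => ?_, ?_⟩
  · unfold aggregate
    split_ifs
    · exact coords_nonneg x i
    · exact tsum_nonneg fun j => coords_nonneg x (k + j)
  · rw [sum_aggregate_coords]
    exact tsum_coords_le_one x

theorem continuous_aggregate (k : ℕ) : Continuous fun x : InfSimplex => aggregate (coords x) k := by
  refine continuous_pi fun i => ?_
  unfold aggregate
  split_ifs
  · exact continuous_coord i
  · have h : (fun x : InfSimplex => ∑' j, coords x (k + j)) =
        fun x => ∑' i, coords x i - ∑ i ∈ Finset.range k, coords x i := by
      ext x
      rw [← sum_add_tsum_tail x k]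
      ring
    rw [h]
    exact continuous_tsum_coords.sub (continuous_finsetSum _ fun i _ => continuous_coord i)

/-- Collecting the tail of `x` in one coordinate. -/
def collect (k : ℕ) (x : InfSimplex) : finSimplex (k + 1) := ⟨_, aggregate_mem x k⟩

theorem continuous_collect (k : ℕ) : Continuous (collect k) :=
  (continuous_aggregate k).subtype_mk _

theorem tendsto_embed_collect (x : InfSimplex) :
    Tendsto (fun k => embed (collect k x)) atTop (𝓝 x) := by
  rw [tendsto_iff_dist_tendsto_zero]
  refine squeeze_zero (fun _ => dist_nonneg) (fun k => dist_le_tails (k := k) fun i hi => ?_) ?_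
  · rw [coords_embed_of_lt _ (hi.trans k.lt_succ_self)]
    simp [collect, aggregate, hi]
  · have : ∀ k, ∑' j, coords (embed (collect k x)) (k + j) = ∑' j, coords x (k + j) := fun k => by
      rw [tsum_eq_single 0]
      · rw [coords_embed_of_lt _ (by simp)]
        simp [collect, aggregate]
      · intro j hj
        exact coords_embed_of_ge _ (by omega)
    simpa only [this, add_zero] using (tendsto_tsum_tail x).add (tendsto_tsum_tail x)

end Simplex

/-! ### Stick breaking for Dirichlet distributions -/

section Stick

/-- The change of variables `u = s t`, `v = s (1 - t)` on the positive quadrant. -/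
theorem lintegral_quadrant (G : ℝ → ℝ → ℝ≥0∞) (hG : Measurable (Function.uncurry G)) :
    ∫⁻ u in Set.Ioi 0, ∫⁻ v in Set.Ioi 0, G u v =
      ∫⁻ s in Set.Ioi 0, ENNReal.ofReal s *
        ∫⁻ t in Set.Ioo 0 1, G (s * t) (s * (1 - t)) := by
  set K : ℝ → ℝ → ℝ≥0∞ := fun u s => (Set.Ioi 0).indicator (fun u => (Set.Ioi u).indicator
    (fun s => G u (s - u)) s) u with hK
  have hKm : Measurable (Function.uncurry K) := by
    have : Function.uncurry K = {z : ℝ × ℝ | 0 < z.1 ∧ z.1 < z.2}.indicator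
        fun z => Function.uncurry G (z.1, z.2 - z.1) := by
      ext ⟨u, s⟩
      by_cases hu : 0 < u <;> by_cases hs : u < s <;> simp [hK, Function.uncurry, hu, hs]
    rw [this]
    refine (hG.comp (by fun_prop)).indicator ?_
    exact (measurableSet_lt measurable_const measurable_fst).inter
      (measurableSet_lt measurable_fst measurable_snd)
  have h1 : ∫⁻ u in Set.Ioi 0, ∫⁻ v in Set.Ioi 0, G u v = ∫⁻ u, ∫⁻ s, K u s := by
    rw [← lintegral_indicator measurableSet_Ioi]
    refine lintegral_congr fun u => ?_
    by_cases hu : 0 < u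
    · rw [Set.indicator_of_mem (by exact hu), ← lintegral_indicator measurableSet_Ioi,
        ← lintegral_sub_right_eq_self _ u]
      refine lintegral_congr fun s => ?_
      by_cases hs : u < s <;> simp [hK, hu, hs]
    · simp [hK, hu]
  rw [h1, lintegral_lintegral_swap hKm.aemeasurable, ← lintegral_indicator measurableSet_Ioi]
  refine lintegral_congr fun s => ?_
  by_cases hs : 0 < s
  · rw [Set.indicator_of_mem (by exact hs)]
    have hvol := Real.smul_map_volume_mul_left hs.ne'
    conv_lhs => rw [← hvol]
    have hm : Measurable fun u => K u s := hKm.comp (measurable_id.prodMk measurable_const)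
    rw [lintegral_smul_measure, lintegral_map hm (by fun_prop), abs_of_pos hs, smul_eq_mul,
      ← lintegral_indicator measurableSet_Ioo]
    congr 1
    refine lintegral_congr fun t => ?_
    by_cases ht : 0 < t
    · by_cases ht1 : t < 1
      · have e1 : s * t < s := by nlinarith
        have e2 : 0 < s * t := by positivity
        simp [hK, ht, ht1, e1, e2, mul_sub]
      · have e1 : ¬ s * t < s := by nlinarith
        simp [hK, ht1, e1]
    · have e2 : ¬ 0 < s * t := by nlinarith
      simp [hK, ht, e2]
  · have : ∀ u, K u s = 0 := fun u => by
      by_cases hu : 0 < u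
      · have : ¬ u < s := by linarith
        simp [hK, this]
      · simp [hK, hu]
    simp [this, hs]

theorem lintegral_fin_succ {n : ℕ} {Φ : (Fin (n + 1) → ℝ) → ℝ≥0∞} (hΦ : Measurable Φ) :
    ∫⁻ x, Φ x = ∫⁻ w : Fin n → ℝ, ∫⁻ v : ℝ, Φ ((Fin.last n).insertNth v w) := by
  have hmp := (volume_preserving_piFinSuccAbove (fun _ : Fin (n + 1) => ℝ) (Fin.last n)).symm
  rw [← hmp.lintegral_comp hΦ]
  exact lintegral_prod_symm' _ (hΦ.comp hmp.measurable)

theorem lintegral_dirichlet {N : ℕ} (a : Fin N → ℝ) (b : ℝ) {F : (Fin N → ℝ) → ℝ≥0∞}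
    (hF : Measurable F) : ∫⁻ x, F x ∂(dirichlet a b) = ∫⁻ x, (finSimplex N).indicator
      (fun x => ENNReal.ofReal (dirichletDensity a b x) * F x) x := by
  rw [dirichlet, lintegral_withDensity_eq_lintegral_mul _ (by fun_prop) hF,
    lintegral_indicator (measurableSet_finSimplex N)]
  rfl

@[fun_prop]
theorem measurable_insertNth_last {n : ℕ} :
    Measurable fun z : ℝ × (Fin n → ℝ) => (Fin.last n).insertNth (α := fun _ => ℝ) z.1 z.2 :=
  (MeasurableEquiv.piFinSuccAbove (fun _ : Fin (n + 1) => ℝ) (Fin.last n)).symm.measurable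

/-- Splitting the last coordinate of a vector in the proportions `t` and `1 - t`. -/
def splitLast {k : ℕ} (x : Fin (k + 1) → ℝ) (t : ℝ) : Fin (k + 2) → ℝ :=
  Fin.snoc (α := fun _ => ℝ)
    (Fin.snoc (α := fun _ => ℝ) (Fin.init x) (x (Fin.last k) * t)) (x (Fin.last k) * (1 - t))

theorem measurable_snoc {n : ℕ} :
    Measurable fun z : (Fin n → ℝ) × ℝ => Fin.snoc (α := fun _ => ℝ) z.1 z.2 := by
  refine measurable_pi_lambda _ fun i => Fin.lastCases ?_ (fun j => ?_) i
  · simpa using measurable_snd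
  · simp only [Fin.snoc_castSucc]
    exact (measurable_pi_apply j).comp measurable_fst

theorem measurable_splitLast (k : ℕ) :
    Measurable fun z : (Fin (k + 1) → ℝ) × ℝ => splitLast z.1 z.2 := by
  have h : Measurable fun z : (Fin (k + 1) → ℝ) × ℝ => Fin.init z.1 :=
    measurable_pi_lambda _ fun i => (measurable_pi_apply (Fin.castSucc i)).comp measurable_fst
  have hl : Measurable fun z : (Fin (k + 1) → ℝ) × ℝ => z.1 (Fin.last k) :=
    (measurable_pi_apply _).comp measurable_fst
  exact measurable_snoc.comp ((measurable_snoc.comp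
    (h.prodMk (hl.mul measurable_snd))).prodMk (hl.mul (measurable_const.sub measurable_snd)))

theorem setLIntegral_Ioi_eq {f : ℝ → ℝ≥0∞} (hf : ∀ u < 0, f u = 0) :
    ∫⁻ u, f u = ∫⁻ u in Set.Ioi 0, f u := by
  rw [setLIntegral_congr Ioi_ae_eq_Ici, ← lintegral_indicator measurableSet_Ici]
  refine lintegral_congr fun u => ?_
  by_cases hu : 0 ≤ u
  · rw [Set.indicator_of_mem (by exact hu)]
  · rw [Set.indicator_of_notMem (by exact hu), hf u (not_le.1 hu)]

theorem dirichletConst_split {k : ℕ} (a : Fin k → ℝ) {p q : ℝ} (hp : 0 < p) (hq : 0 < q) (b : ℝ) :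
    dirichletConst (Fin.snoc (α := fun _ => ℝ) (Fin.snoc (α := fun _ => ℝ) a p) q) b =
      dirichletConst (Fin.snoc (α := fun _ => ℝ) a (p + q)) b * (1 / beta p q) := by
  have h1 := (Real.Gamma_pos_of_pos (add_pos hp hq)).ne'
  have h2 := (Real.Gamma_pos_of_pos hp).ne'
  have h3 := (Real.Gamma_pos_of_pos hq).ne'
  simp only [dirichletConst, beta, Fin.prod_univ_castSucc, Fin.sum_univ_castSucc, Fin.snoc_castSucc,
    Fin.snoc_last, add_assoc]
  rw [one_div_div]
  by_cases h4 : ∏ i, Real.Gamma (a i) = 0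
  · simp [h4]
  by_cases h5 : Real.Gamma b = 0
  · simp [h5]
  field_simp

theorem measurable_betaPDF (p q : ℝ) : Measurable (betaPDF p q) :=
  (measurable_betaPDFReal p q).ennreal_ofReal

theorem lintegral_betaMeasure (p q : ℝ) {g : ℝ → ℝ≥0∞} (hg : Measurable g) :
    ∫⁻ t, g t ∂(betaMeasure p q) = ∫⁻ t in Set.Ioo 0 1,
      ENNReal.ofReal (1 / beta p q * t ^ (p - 1) * (1 - t) ^ (q - 1)) * g t := by
  rw [betaMeasure, lintegral_withDensity_eq_lintegral_mul _
    (measurable_betaPDF p q) hg, ← lintegral_indicator measurableSet_Ioo]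
  refine lintegral_congr fun t => ?_
  by_cases ht : t ∈ Set.Ioo (0 : ℝ) 1
  · rw [Set.indicator_of_mem ht, Pi.mul_apply, betaPDF_of_pos_lt_one ht.1 ht.2]
  · rw [Set.indicator_of_notMem ht, Pi.mul_apply, betaPDF_eq, if_neg (by exact ht)]
    simp

theorem ae_betaMeasure_mem (p q : ℝ) : ∀ᵐ t ∂(betaMeasure p q), t ∈ Set.Ioo (0 : ℝ) 1 := by
  rw [betaMeasure, ae_withDensity_iff (measurable_betaPDF p q)]
  refine Eventually.of_forall fun t ht => ?_
  by_contra h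
  rw [betaPDF_eq, if_neg (by exact h)] at ht
  simp at ht

theorem splitLast_snoc {k : ℕ} (y : Fin k → ℝ) (s t : ℝ) :
    splitLast (Fin.snoc (α := fun _ => ℝ) y s) t = Fin.snoc (α := fun _ => ℝ)
      (Fin.snoc (α := fun _ => ℝ) y (s * t)) (s * (1 - t)) := by
  rw [splitLast, Fin.init_snoc, Fin.snoc_last]

theorem snoc_mem_finSimplex {N : ℕ} (y : Fin N → ℝ) (t : ℝ) :
    (Fin.snoc (α := fun _ => ℝ) y t : Fin (N + 1) → ℝ) ∈ finSimplex (N + 1) ↔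
      (∀ j, 0 ≤ y j) ∧ 0 ≤ t ∧ t ≤ 1 - ∑ j, y j := by
  rw [← Fin.insertNth_last', insertNth_mem_finSimplex]

/-- Stick breaking: the Dirichlet distribution with parameters `(a, p, q; b)` arises from the one
with parameters `(a, p + q; b)` by splitting the last coordinate in a `Beta(p, q)` proportion. -/
theorem lintegral_dirichlet_split {k : ℕ} (a : Fin k → ℝ) {p q : ℝ} (hp : 0 < p) (hq : 0 < q)
    (ha : ∀ i, 0 < a i) {b : ℝ} (hb : 0 < b) {F : (Fin (k + 2) → ℝ) → ℝ≥0∞} (hF : Measurable F) :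
    ∫⁻ x, F x ∂(dirichlet (Fin.snoc (α := fun _ => ℝ) (Fin.snoc (α := fun _ => ℝ) a p) q) b) =
      ∫⁻ x, ∫⁻ t, F (splitLast x t) ∂(betaMeasure p q)
        ∂(dirichlet (Fin.snoc (α := fun _ => ℝ) a (p + q)) b) := by
  have hbeta := isProbabilityMeasureBeta hp hq
  set a2 := Fin.snoc (α := fun _ => ℝ) (Fin.snoc (α := fun _ => ℝ) a p) q with ha2
  set a1 := Fin.snoc (α := fun _ => ℝ) a (p + q) with ha1
  have hFs : Measurable fun z : (Fin (k + 1) → ℝ) × ℝ => F (splitLast z.1 z.2) :=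
    hF.comp (measurable_splitLast k)
  have hm2 : Measurable ((finSimplex (k + 2)).indicator
      fun x => ENNReal.ofReal (dirichletDensity a2 b x) * F x) :=
    ((measurable_dirichletDensity a2 b).ennreal_ofReal.mul hF).indicator
      (measurableSet_finSimplex _)
  have hFi : Measurable fun x => ∫⁻ t, F (splitLast x t) ∂(betaMeasure p q) :=
    Measurable.lintegral_prod_right' hFs
  have hm1 : Measurable ((finSimplex (k + 1)).indicator
      fun x => ENNReal.ofReal (dirichletDensity a1 b x) *
        ∫⁻ t, F (splitLast x t) ∂(betaMeasure p q)) :=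
    ((measurable_dirichletDensity a1 b).ennreal_ofReal.mul hFi).indicator
      (measurableSet_finSimplex _)
  rw [lintegral_dirichlet _ _ hF, lintegral_dirichlet _ _ hFi, lintegral_fin_succ hm1,
    lintegral_fin_succ hm2, lintegral_fin_succ]
  swap
  · exact Measurable.lintegral_prod_right' (f := fun z : (Fin (k + 1) → ℝ) × ℝ =>
      (finSimplex (k + 2)).indicator (fun x => ENNReal.ofReal (dirichletDensity a2 b x) * F x)
        ((Fin.last (k + 1)).insertNth z.2 z.1))
      (hm2.comp (measurable_insertNth_last.comp measurable_swap))
  refine lintegral_congr fun y => ?_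
  simp only [Fin.insertNth_last']
  set G : ℝ → ℝ → ℝ≥0∞ := fun u v => (finSimplex (k + 2)).indicator
    (fun x => ENNReal.ofReal (dirichletDensity a2 b x) * F x)
    (Fin.snoc (α := fun _ => ℝ) (Fin.snoc (α := fun _ => ℝ) y u) v) with hG
  have hGm : Measurable (Function.uncurry G) := by
    refine hm2.comp (measurable_snoc.comp ((measurable_snoc.comp
      (measurable_const.prodMk measurable_fst)).prodMk measurable_snd))
  have hG1 : ∀ u < 0, ∫⁻ v, G u v = 0 := fun u hu => by
    have : ∀ v, G u v = 0 := fun v => by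
      refine Set.indicator_of_notMem (fun h => ?_) _
      have := ((snoc_mem_finSimplex _ _).1 h).1 (Fin.last k)
      rw [Fin.snoc_last] at this
      linarith
    simp [this]
  have hG2 : ∀ u, ∀ v < 0, G u v = 0 := fun u v hv => by
    refine Set.indicator_of_notMem (fun h => ?_) _
    have := ((snoc_mem_finSimplex _ _).1 h).2.1
    linarith
  change ∫⁻ u, ∫⁻ v, G u v = _
  rw [setLIntegral_Ioi_eq hG1]
  simp_rw [fun u => setLIntegral_Ioi_eq (hG2 u)]
  -- Substitute `(u, v) = (s t, s (1 - t))` in the last two coordinates; points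
  -- outside the quadrant and the simplex contribute nothing.
  rw [lintegral_quadrant G hGm, setLIntegral_Ioi_eq]
  swap
  · intro s hs
    refine Set.indicator_of_notMem (fun h => ?_) _
    have := ((snoc_mem_finSimplex _ _).1 h).2.1
    linarith
  refine setLIntegral_congr_fun measurableSet_Ioi fun s (hs : 0 < s) => ?_
  by_cases hy : (∀ j, 0 ≤ y j) ∧ s ≤ 1 - ∑ j, y j
  swap
  · have h1 : ∀ t ∈ Set.Ioo (0 : ℝ) 1, G (s * t) (s * (1 - t)) = 0 := fun t ht => by
      refine Set.indicator_of_notMem (fun h => hy ?_) _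
      obtain ⟨h1, -, h3⟩ := (snoc_mem_finSimplex _ _).1 h
      rw [Fin.sum_snoc] at h3
      exact ⟨fun j => by simpa using h1 j.castSucc, by linarith⟩
    rw [setLIntegral_congr_fun measurableSet_Ioo h1]
    rw [Set.indicator_of_notMem fun h =>
      hy ⟨((snoc_mem_finSimplex _ _).1 h).1, ((snoc_mem_finSimplex _ _).1 h).2.2⟩]
    simp
  obtain ⟨hy0, hys⟩ := hy
  rw [Set.indicator_of_mem ((snoc_mem_finSimplex _ _).2 ⟨hy0, hs.le, hys⟩),
    lintegral_betaMeasure _ _ (show Measurable fun t : ℝ =>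
      F (splitLast (Fin.snoc (α := fun _ => ℝ) y s) t) from
        hFs.comp (measurable_const.prodMk measurable_id)),
    ← lintegral_const_mul' _ _ ENNReal.ofReal_ne_top,
    ← lintegral_const_mul' _ _ ENNReal.ofReal_ne_top]
  refine setLIntegral_congr_fun measurableSet_Ioo fun t ht => ?_
  have ht1 : 0 < 1 - t := by linarith [ht.2]
  have hd1 : 0 ≤ dirichletDensity a1 b (Fin.snoc (α := fun _ => ℝ) y s) := by
    refine dirichletDensity_nonneg (fun i => ?_) hb ((snoc_mem_finSimplex _ _).2 ⟨hy0, hs.le, hys⟩)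
    refine Fin.lastCases ?_ (fun j => ?_) i
    · simpa [ha1] using add_pos hp hq
    · simpa [ha1] using ha j
  have hmem : (Fin.snoc (α := fun _ => ℝ) (Fin.snoc (α := fun _ => ℝ) y (s * t)) (s * (1 - t)) :
      Fin (k + 2) → ℝ) ∈ finSimplex (k + 2) := by
    refine (snoc_mem_finSimplex _ _).2 ⟨fun j => ?_, by positivity, ?_⟩
    · refine Fin.lastCases ?_ (fun j => ?_) j
      · simpa using (mul_pos hs ht.1).le
      · simpa using hy0 j
    · rw [Fin.sum_snoc]
      linarith
  rw [hG]
  dsimp only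
  rw [Set.indicator_of_mem hmem, splitLast_snoc, ← mul_assoc, ← mul_assoc,
    ← ENNReal.ofReal_mul hs.le, ← ENNReal.ofReal_mul hd1]
  congr 2
  have e0 : s * (s * t) ^ (p - 1) * (s * (1 - t)) ^ (q - 1) =
      s ^ (p + q - 1) * t ^ (p - 1) * (1 - t) ^ (q - 1) := by
    rw [Real.mul_rpow hs.le ht.1.le, Real.mul_rpow hs.le ht1.le,
      show p + q - 1 = 1 + (p - 1) + (q - 1) by ring, Real.rpow_add hs, Real.rpow_add hs,
      Real.rpow_one]
    ring
  have hC := dirichletConst_split a hp hq b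
  have e1 : 1 - (∑ i, y i + s * t + s * (1 - t)) = 1 - (∑ i, y i + s) := by ring
  have hD : ∀ {N : ℕ} (c : Fin N → ℝ) (x : Fin N → ℝ), dirichletDensity c b x =
      dirichletConst c b * (1 - ∑ i, x i) ^ (b - 1) * ∏ i, x i ^ (c i - 1) := fun _ _ => rfl
  rw [hD, hD, ha2, hC, ← ha1, Fin.sum_snoc, Fin.sum_snoc, Fin.sum_snoc, e1]
  generalize dirichletConst a1 b = C
  simp only [Fin.prod_univ_castSucc, ha1, Fin.snoc_castSucc, Fin.snoc_last]
  linear_combination (C * (1 / beta p q) * (1 - (∑ i, y i + s)) ^ (b - 1) *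
    ∏ i : Fin k, y i ^ (a i - 1)) * e0

theorem map_splitLast {k : ℕ} (a : Fin k → ℝ) {p q : ℝ} (hp : 0 < p) (hq : 0 < q)
    (ha : ∀ i, 0 < a i) {b : ℝ} (hb : 0 < b) :
    ((dirichlet (Fin.snoc (α := fun _ => ℝ) a (p + q)) b).prod (betaMeasure p q)).map
      (fun z => splitLast z.1 z.2) =
      dirichlet (Fin.snoc (α := fun _ => ℝ) (Fin.snoc (α := fun _ => ℝ) a p) q) b := by
  have hbeta := isProbabilityMeasureBeta hp hq
  refine Measure.ext_of_lintegral _ fun F hF => ?_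
  rw [lintegral_map hF (measurable_splitLast k), lintegral_dirichlet_split a hp hq ha hb hF]
  exact lintegral_prod _ (hF.comp (measurable_splitLast k)).aemeasurable

theorem map_betaMeasure_eq_dirichlet (p b : ℝ) :
    (betaMeasure p b).map (fun t => fun _ : Fin 1 => t) = dirichlet (fun _ : Fin 1 => p) b := by
  have hm : Measurable fun t : ℝ => fun _ : Fin 1 => t := by fun_prop
  refine Measure.ext_of_lintegral _ fun F hF => ?_
  have hmp : MeasurePreserving (MeasurableEquiv.funUnique (Fin 1) ℝ).symm
      (volume : Measure ℝ) (volume : Measure (Fin 1 → ℝ)) := by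
    convert! (volume_preserving_funUnique (Fin 1) ℝ).symm
  have hm1 : Measurable ((finSimplex 1).indicator
      fun x => ENNReal.ofReal (dirichletDensity (fun _ : Fin 1 => p) b x) * F x) :=
    ((measurable_dirichletDensity _ b).ennreal_ofReal.mul hF).indicator
      (measurableSet_finSimplex _)
  rw [lintegral_map hF hm, lintegral_betaMeasure _ _ (show Measurable fun t : ℝ => F fun _ => t from hF.comp hm),
    lintegral_dirichlet _ _ hF,
    ← hmp.lintegral_comp hm1, ← lintegral_indicator measurableSet_Ioo]
  have hne : ∀ c : ℝ, ∀ᵐ t : ℝ, t ≠ c := fun c => by simp [ae_iff]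
  refine lintegral_congr_ae ?_
  filter_upwards [hne 0, hne 1] with t h0 h1
  change _ = (finSimplex 1).indicator _ (fun _ : Fin 1 => t)
  by_cases ht : t ∈ Set.Ioo (0 : ℝ) 1
  · rw [Set.indicator_of_mem ht, Set.indicator_of_mem
      (by exact ⟨fun _ => ht.1.le, by simpa using ht.2.le⟩)]
    congr 2
    simp [dirichletDensity, beta]
    ring
  · rw [Set.indicator_of_notMem ht, Set.indicator_of_notMem]
    rintro ⟨h2, h3⟩
    exact ht ⟨lt_of_le_of_ne (h2 0) (Ne.symm h0), lt_of_le_of_ne (by simpa using h3) h1⟩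

end Stick

/-! ### The infinite-dimensional Dirichlet distribution -/

section Construction

/-- The laws of the independent proportions of the stick breaking construction: first the total
mass `|x|_1`, then the share of `x_k` in the mass that is left for `x_k, x_{k+1}, …`. -/
def stickLaw (α : ℕ → ℝ) (β : ℝ) : ℕ → Measure ℝ
  | 0 => betaMeasure (∑' j, α (0 + j)) β
  | k + 1 => betaMeasure (α k) (∑' j, α (k + 1 + j))

/-- The mass that is left for `x_k, x_{k+1}, …`. -/
def stickRest (ω : ℕ → ℝ) : ℕ → ℝ
  | 0 => ω 0
  | k + 1 => stickRest ω k * (1 - ω (k + 1))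

/-- The `k`-th piece of the stick. -/
def stickPiece (ω : ℕ → ℝ) (k : ℕ) : ℝ := stickRest ω k * ω (k + 1)

/-- The first `k` pieces of the stick together with the rest. -/
def stickVec (ω : ℕ → ℝ) (k : ℕ) : Fin (k + 1) → ℝ :=
  Fin.snoc (α := fun _ => ℝ) (fun j : Fin k => stickPiece ω j) (stickRest ω k)

theorem stickVec_succ (ω : ℕ → ℝ) (k : ℕ) :
    stickVec ω (k + 1) = splitLast (stickVec ω k) (ω (k + 1)) := by
  rw [stickVec, stickVec, splitLast_snoc]
  congr 1
  ext i
  refine Fin.lastCases ?_ (fun j => ?_) i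
  · simp [stickPiece]
  · simp

@[fun_prop]
theorem measurable_stickRest (k : ℕ) : Measurable fun ω => stickRest ω k := by
  induction k with
  | zero => exact measurable_pi_apply 0
  | succ k ih => exact ih.mul (by fun_prop)

@[fun_prop]
theorem measurable_stickPiece (k : ℕ) : Measurable fun ω => stickPiece ω k :=
  (measurable_stickRest k).mul (measurable_pi_apply (k + 1))

theorem measurable_stickVec (k : ℕ) : Measurable fun ω => stickVec ω k :=
  measurable_snoc.comp ((measurable_pi_lambda _ fun j : Fin k => measurable_stickPiece j).prodMk
    (measurable_stickRest k))

theorem stickRest_congr {ω ω' : ℕ → ℝ} {k : ℕ} (h : ∀ i ≤ k, ω i = ω' i) :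
    stickRest ω k = stickRest ω' k := by
  induction k with
  | zero => exact h 0 le_rfl
  | succ k ih =>
    rw [stickRest, stickRest, ih fun i hi => h i (hi.trans k.le_succ), h (k + 1) le_rfl]

theorem stickVec_congr {ω ω' : ℕ → ℝ} {k : ℕ} (h : ∀ i ≤ k, ω i = ω' i) :
    stickVec ω k = stickVec ω' k := by
  rw [stickVec, stickVec, stickRest_congr h]
  congr 1
  ext j
  rw [stickPiece, stickPiece, h (j + 1) j.2, stickRest_congr fun i hi => h i (hi.trans j.2.le)]

variable {α : ℕ → ℝ} {β : ℝ}

theorem tsum_tail_pos (hα : ∀ i, 0 < α i) (hsum : Summable α) (k : ℕ) :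
    0 < ∑' j, α (k + j) := by
  have hs : Summable fun j => α (k + j) := by
    simpa [add_comm] using (summable_nat_add_iff k).2 hsum
  exact hs.tsum_pos (fun j => (hα _).le) 0 (hα _)

theorem tsum_tail_eq_add (hsum : Summable α) (k : ℕ) :
    ∑' j, α (k + j) = α k + ∑' j, α (k + 1 + j) := by
  have hs : Summable fun j => α (k + j) := by
    simpa [add_comm] using (summable_nat_add_iff k).2 hsum
  rw [hs.tsum_eq_zero_add]
  simp [add_comm, add_left_comm]

theorem aggregate_pos (hα : ∀ i, 0 < α i) (hsum : Summable α) (k : ℕ) (i : Fin (k + 1)) :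
    0 < aggregate α k i := by
  unfold aggregate
  split_ifs
  · exact hα _
  · exact tsum_tail_pos hα hsum k

theorem isProbabilityMeasure_stickLaw (hα : ∀ i, 0 < α i) (hsum : Summable α) (hβ : 0 < β)
    (k : ℕ) : IsProbabilityMeasure (stickLaw α β k) := by
  cases k with
  | zero => exact isProbabilityMeasureBeta (tsum_tail_pos hα hsum 0) hβ
  | succ k => exact isProbabilityMeasureBeta (hα k) (tsum_tail_pos hα hsum (k + 1))

/-- The vector of the first pieces of the stick and the rest has a Dirichlet distribution. -/
theorem map_stickVec (hα : ∀ i, 0 < α i) (hsum : Summable α) (hβ : 0 < β)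
    [∀ k, IsProbabilityMeasure (stickLaw α β k)] (k : ℕ) :
    (Measure.infinitePi (stickLaw α β)).map (fun ω => stickVec ω k) =
      dirichlet (aggregate α k) β := by
  induction k with
  | zero =>
    have h1 : (fun ω : ℕ → ℝ => stickVec ω 0) = (fun t => fun _ : Fin 1 => t) ∘ fun ω => ω 0 := by
      ext ω i
      obtain rfl : i = Fin.last 0 := Subsingleton.elim (α := Fin 1) _ _
      exact Fin.snoc_last (α := fun _ => ℝ) (ω 0) _
    have h2 : aggregate α 0 = fun _ => ∑' j, α (0 + j) := by
      ext i
      simp [aggregate]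
    rw [h1, ← Measure.map_map (by fun_prop) (by fun_prop), Measure.infinitePi_map_eval, h2]
    exact map_betaMeasure_eq_dirichlet _ _
  | succ k ih =>
    set P := Measure.infinitePi (stickLaw α β)
    -- `stickVec ω k` is a function of `ω 0, …, ω k` only.
    have hind : IndepFun (fun ω => stickVec ω k) (fun ω : ℕ → ℝ => ω (k + 1)) P := by
      have h1 := (iIndepFun_infinitePi (P := stickLaw α β) (X := fun _ t => t)
        fun _ => measurable_id).indepFun_finset (Finset.range (k + 1)) {k + 1}
        (by simp) fun i => measurable_pi_apply i
      let g : (Finset.range (k + 1) → ℝ) → Fin (k + 1) → ℝ := fun z =>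
        stickVec (fun i => if h : i ∈ Finset.range (k + 1) then z ⟨i, h⟩ else 0) k
      have hg : Measurable g := by
        refine (measurable_stickVec k).comp (measurable_pi_lambda _ fun i => ?_)
        by_cases h : i ∈ Finset.range (k + 1)
        · simp only [h, dif_pos]
          exact measurable_pi_apply _
        · simp only [h, dif_neg, not_false_eq_true]
          exact measurable_const
      let g' : (({k + 1} : Finset ℕ) → ℝ) → ℝ := fun z => z ⟨k + 1, by simp⟩
      have h2 := h1.comp hg (measurable_pi_apply _ : Measurable g')
      convert! h2 using 1
      ext1 ω
      refine stickVec_congr fun i hi => ?_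
      simp [Nat.lt_succ_of_le hi]
    have h1 : (fun ω : ℕ → ℝ => stickVec ω (k + 1)) =
        (fun z => splitLast z.1 z.2) ∘ fun ω => (stickVec ω k, ω (k + 1)) := by
      ext1 ω
      exact stickVec_succ ω k
    rw [h1, ← Measure.map_map (measurable_splitLast k)
      ((measurable_stickVec k).prodMk (measurable_pi_apply _)),
      (indepFun_iff_map_prod_eq_prod_map_map (measurable_stickVec k).aemeasurable
        (measurable_pi_apply _).aemeasurable).1 hind, ih, Measure.infinitePi_map_eval, stickLaw,
      aggregate_eq_snoc, aggregate_eq_snoc, tsum_tail_eq_add hsum k,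
      map_splitLast _ (hα k) (tsum_tail_pos hα hsum (k + 1)) (fun i => hα i) hβ]
    congr 2
    ext i
    refine Fin.lastCases ?_ (fun j => ?_) i
    · simp
    · simp

theorem isProbabilityMeasure_dirichlet_aggregate (hα : ∀ i, 0 < α i) (hsum : Summable α)
    (hβ : 0 < β) (k : ℕ) : IsProbabilityMeasure (dirichlet (aggregate α k) β) := by
  have := isProbabilityMeasure_stickLaw hα hsum hβ
  rw [← map_stickVec hα hsum hβ k]
  exact Measure.isProbabilityMeasure_map (measurable_stickVec k).aemeasurable

theorem stickRest_nonneg {ω : ℕ → ℝ} (hω : ∀ i, ω i ∈ Set.Icc (0 : ℝ) 1) (k : ℕ) :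
    0 ≤ stickRest ω k := by
  induction k with
  | zero => exact (hω 0).1
  | succ k ih => exact mul_nonneg ih (by linarith [(hω (k + 1)).2])

theorem stickPiece_nonneg {ω : ℕ → ℝ} (hω : ∀ i, ω i ∈ Set.Icc (0 : ℝ) 1) (k : ℕ) :
    0 ≤ stickPiece ω k := mul_nonneg (stickRest_nonneg hω k) (hω _).1

theorem sum_stickPiece (ω : ℕ → ℝ) (k : ℕ) :
    ∑ i ∈ Finset.range k, stickPiece ω i = ω 0 - stickRest ω k := by
  induction k with
  | zero => simp [stickRest]
  | succ k ih =>
    rw [Finset.sum_range_succ, ih, stickPiece, stickRest]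
    ring

theorem sum_stickPiece_le {ω : ℕ → ℝ} (hω : ∀ i, ω i ∈ Set.Icc (0 : ℝ) 1) (k : ℕ) :
    ∑ i ∈ Finset.range k, stickPiece ω i ≤ ω 0 := by
  rw [sum_stickPiece]
  linarith [stickRest_nonneg hω k]

theorem summable_stickPiece {ω : ℕ → ℝ} (hω : ∀ i, ω i ∈ Set.Icc (0 : ℝ) 1) :
    Summable (stickPiece ω) :=
  summable_of_sum_range_le (stickPiece_nonneg hω) (sum_stickPiece_le hω)

/-- The point of the infinite-dimensional simplex formed by the pieces of a stick. -/
def stickPoint (ω : ℕ → ℝ) (hω : ∀ i, ω i ∈ Set.Icc (0 : ℝ) 1) : InfSimplex :=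
  ⟨⟨stickPiece ω, memℓp_gen (by simpa using (summable_stickPiece hω).abs)⟩,
    stickPiece_nonneg hω, (Real.tsum_le_of_sum_range_le (stickPiece_nonneg hω)
      (sum_stickPiece_le hω)).trans (hω 0).2⟩

/-- The clamping of a real sequence to `[0, 1]`. -/
def clamp (ω : ℕ → ℝ) (i : ℕ) : ℝ := max 0 (min 1 (ω i))

theorem clamp_mem (ω : ℕ → ℝ) (i : ℕ) : clamp ω i ∈ Set.Icc (0 : ℝ) 1 :=
  ⟨le_max_left _ _, max_le zero_le_one (min_le_left _ _)⟩

theorem measurable_clamp : Measurable clamp :=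
  measurable_pi_lambda _ fun i => measurable_const.max (measurable_const.min (measurable_pi_apply i))

theorem clamp_eq_self {ω : ℕ → ℝ} (hω : ∀ i, ω i ∈ Set.Ioo (0 : ℝ) 1) : clamp ω = ω := by
  ext i
  rw [clamp, min_eq_right (hω i).2.le, max_eq_right (hω i).1.le]

/-- The infinite-dimensional Dirichlet distribution: a probability measure on `Δ^(∞)` under which
the first `k` coordinates together with the sum of the others have the Dirichlet distribution with
parameters `(α_1, …, α_k, ∑_{i > k} α_i; β)`, for all `k`. -/
theorem exists_infiniteDirichlet (hα : ∀ i, 0 < α i) (hsum : Summable α) (hβ : 0 < β) :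
    ∃ μ : Measure InfSimplex, IsProbabilityMeasure μ ∧
      ∀ k, μ.map (fun x => aggregate (coords x) k) = dirichlet (aggregate α k) β := by
  have hprob := isProbabilityMeasure_stickLaw hα hsum hβ
  have hdir := isProbabilityMeasure_dirichlet_aggregate hα hsum hβ
  set P := Measure.infinitePi (stickLaw α β) with hP
  set X : (ℕ → ℝ) → InfSimplex := fun ω => stickPoint (clamp ω) (clamp_mem ω) with hX
  have hXc : ∀ ω, coords (X ω) = stickPiece (clamp ω) := fun ω => rfl
  have hXm : Measurable X := by
    refine measurable_of_coords fun i => ?_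
    simp only [hXc]
    exact (measurable_stickPiece i).comp measurable_clamp
  have hgood : ∀ᵐ ω ∂P, ∀ i, ω i ∈ Set.Ioo (0 : ℝ) 1 := by
    rw [ae_all_iff]
    intro i
    have h1 : ∀ᵐ t ∂(stickLaw α β i), t ∈ Set.Ioo (0 : ℝ) 1 := by
      cases i <;> exact ae_betaMeasure_mem _ _
    rw [← Measure.infinitePi_map_eval (stickLaw α β) i] at h1
    exact ae_of_ae_map (measurable_pi_apply i).aemeasurable h1
  -- The rest of the stick vanishes in the limit, because its mean does.
  set r : (ℕ → ℝ) → ℝ := fun ω => clamp ω 0 - ∑' i, stickPiece (clamp ω) i with hr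
  have hsumm : ∀ ω, Summable (stickPiece (clamp ω)) := fun ω => summable_stickPiece (clamp_mem ω)
  have hr0 : ∀ ω, 0 ≤ r ω := fun ω => sub_nonneg.2 (Real.tsum_le_of_sum_range_le
    (stickPiece_nonneg (clamp_mem ω)) (sum_stickPiece_le (clamp_mem ω)))
  have hrle : ∀ k ω, r ω ≤ stickRest (clamp ω) k := fun k ω => by
    have h1 := (hsumm ω).sum_le_tsum (Finset.range k) fun i _ => stickPiece_nonneg (clamp_mem ω) i
    rw [sum_stickPiece] at h1
    simp only [hr]
    linarith
  have hrest : ∀ k, ∫ ω, stickRest (clamp ω) k ∂P =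
      (∑' j, α (k + j)) / (∑ i, aggregate α k i + β) := by
    intro k
    have h1 := integral_dirichlet_coord (aggregate_pos hα hsum k) hβ (Fin.last k)
    rw [← map_stickVec hα hsum hβ k, integral_map (measurable_stickVec k).aemeasurable
      (measurable_pi_apply _).aestronglyMeasurable] at h1
    have h2 : aggregate α k (Fin.last k) = ∑' j, α (k + j) := by simp [aggregate]
    rw [h2] at h1
    rw [← h1]
    refine integral_congr_ae ?_
    filter_upwards [hgood] with ω hω
    rw [clamp_eq_self hω, stickVec, Fin.snoc_last]
  have hrmeas : Measurable r := by
    have : Measurable fun ω => ∑' i, coords (X ω) i :=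
      continuous_tsum_coords.measurable.comp hXm
    exact ((measurable_pi_apply 0).comp measurable_clamp).sub this
  have hrbdd : ∀ ω, ‖r ω‖ ≤ 1 := fun ω => by
    rw [Real.norm_eq_abs, abs_of_nonneg (hr0 ω)]
    exact (hrle 0 ω).trans (clamp_mem ω 0).2
  have hrint : Integrable r P := Integrable.of_bound hrmeas.aestronglyMeasurable 1
    (Eventually.of_forall hrbdd)
  have hrz : ∫ ω, r ω ∂P = 0 := by
    refine le_antisymm ?_ (integral_nonneg hr0)
    have hlim : Tendsto (fun k => (∑' j, α (k + j)) / (∑' i, α i + β)) atTop (𝓝 0) := by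
      have h1 : Tendsto (fun k => ∑' j, α (k + j)) atTop (𝓝 0) := by
        simpa [add_comm] using tendsto_sum_nat_add α
      simpa using h1.div_const (∑' i, α i + β)
    refine ge_of_tendsto' hlim fun k => ?_
    have h2 : ∑ i, aggregate α k i = ∑' i, α i := by
      rw [sum_aggregate]
      simpa [add_comm] using hsum.sum_add_tsum_nat_add k
    rw [← h2, ← hrest k]
    have hb : ∀ ω, ‖stickRest (clamp ω) k‖ ≤ 1 := fun ω => by
      rw [Real.norm_eq_abs, abs_of_nonneg (stickRest_nonneg (clamp_mem ω) k)]
      have h3 := sum_stickPiece (clamp ω) k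
      have h4 : 0 ≤ ∑ i ∈ Finset.range k, stickPiece (clamp ω) i :=
        Finset.sum_nonneg fun i _ => stickPiece_nonneg (clamp_mem ω) i
      linarith [(clamp_mem ω 0).2]
    refine integral_mono hrint (Integrable.of_bound (C := 1)
      ((measurable_stickRest k).comp measurable_clamp).aestronglyMeasurable
      (Eventually.of_forall hb)) (hrle k)
  have hr_ae : r =ᵐ[P] 0 := (integral_eq_zero_iff_of_nonneg hr0 hrint).1 hrz
  refine ⟨P.map X, Measure.isProbabilityMeasure_map hXm.aemeasurable, fun k => ?_⟩
  rw [Measure.map_map (continuous_aggregate k).measurable hXm, ← map_stickVec hα hsum hβ k]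
  refine Measure.map_congr ?_
  filter_upwards [hgood, hr_ae] with ω hω hrω
  rw [Function.comp_apply, hXc, aggregate_eq_snoc, ← clamp_eq_self hω]
  rw [clamp_eq_self (by rwa [clamp_eq_self hω]), stickVec]
  congr 1
  have h1 := sum_add_tsum_tail (X ω) k
  rw [hXc, sum_stickPiece] at h1
  simp only [hr, Pi.zero_apply] at hrω
  linarith

theorem projDirichlet_eq_map {μ : Measure InfSimplex}
    (hμ : ∀ k, μ.map (fun x => aggregate (coords x) k) = dirichlet (aggregate α k) β) (k : ℕ) :
    projDirichlet α β k = μ.map fun x => embed (collect k x) := by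
  have hemb := MeasurableEmbedding.subtype_coe (measurableSet_finSimplex (k + 1))
  have h1 : (fun x => aggregate (coords x) k) = (Subtype.val : finSimplex (k + 1) → _) ∘
    collect k := rfl
  rw [projDirichlet, ← hμ k, h1, ← Measure.map_map hemb.measurable (continuous_collect k).measurable,
    hemb.comap_map, Measure.map_map (continuous_embed _).measurable (continuous_collect k).measurable]
  rfl

theorem isProbabilityMeasure_projDirichlet {μ : Measure InfSimplex} [IsProbabilityMeasure μ]
    (hμ : ∀ k, μ.map (fun x => aggregate (coords x) k) = dirichlet (aggregate α k) β) (k : ℕ) :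
    IsProbabilityMeasure (projDirichlet α β k) := by
  rw [projDirichlet_eq_map hμ]
  exact Measure.isProbabilityMeasure_map
    ((continuous_embed _).comp (continuous_collect k)).measurable.aemeasurable

theorem tendsto_projDirichlet (μ : ProbabilityMeasure InfSimplex)
    (hμ : ∀ k, (μ : Measure InfSimplex).map (fun x => aggregate (coords x) k) =
      dirichlet (aggregate α k) β) (hprob : ∀ k, IsProbabilityMeasure (projDirichlet α β k)) :
    Tendsto (β := ProbabilityMeasure InfSimplex) (fun k => ⟨projDirichlet α β k, hprob k⟩) atTop
      (𝓝 μ) := by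
  refine ProbabilityMeasure.tendsto_iff_forall_integral_tendsto.2 fun f => ?_
  have hc : ∀ k, Continuous fun x => embed (collect k x) := fun k =>
    (continuous_embed _).comp (continuous_collect k)
  have h1 : ∀ k, ∫ x, f x ∂(projDirichlet α β k) = ∫ x, f (embed (collect k x)) ∂(μ : Measure _) :=
    fun k => by
      rw [projDirichlet_eq_map hμ, integral_map (hc k).measurable.aemeasurable
        f.continuous.aestronglyMeasurable]
  simp only [ProbabilityMeasure.coe_mk, h1]
  refine tendsto_integral_of_dominated_convergence (fun _ => ‖f‖)
    (fun k => (f.continuous.comp (hc k)).aestronglyMeasurable) (integrable_const _)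
    (fun k => Eventually.of_forall fun x => f.norm_coe_le_norm _)
    (Eventually.of_forall fun x => (f.continuous.tendsto x).comp (tendsto_embed_collect x))

end Construction

/-! ### Calculus of cylinder functions -/

section Cylinder

variable {r : ℕ} {f g : (ℕ → ℝ) → ℝ}

theorem FC.continuous (hf : f ∈ FC r) : Continuous f := by
  obtain ⟨m, φ, hφ, hf⟩ := hf
  rw [funext hf]
  exact hφ.continuous.comp (by fun_prop)

theorem FC.continuous_coords (hf : f ∈ FC r) : Continuous fun x : InfSimplex => f (coords x) :=
  (FC.continuous hf).comp InfDirichlet.continuous_coords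

theorem FC.exists_bound (hf : f ∈ FC r) : ∃ C, ∀ x : InfSimplex, |f (coords x)| ≤ C := by
  obtain ⟨m, φ, hφ, hf⟩ := hf
  have hK : IsCompact (Set.univ.pi fun _ : Fin m => Set.Icc (0 : ℝ) 1) :=
    isCompact_univ_pi fun _ => isCompact_Icc
  obtain ⟨C, hC⟩ := hK.exists_bound_of_continuousOn hφ.continuous.continuousOn
  exact ⟨C, fun x => by
    rw [hf]
    exact hC _ fun i _ => coords_mem_Icc x i⟩

/-- A cylinder function depends on finitely many coordinates. -/
theorem FC.exists_congr (hf : f ∈ FC r) :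
    ∃ m : ℕ, ∀ x y : ℕ → ℝ, (∀ i < m, x i = y i) → f x = f y := by
  obtain ⟨m, φ, hφ, hf⟩ := hf
  refine ⟨m, fun x y h => ?_⟩
  rw [hf, hf]
  congr 1
  ext i
  exact h i i.2

theorem FC.mono {s : ℕ} (h : s ≤ r) (hf : f ∈ FC r) : f ∈ FC s := by
  obtain ⟨m, φ, hφ, hf⟩ := hf
  exact ⟨m, φ, hφ.of_le (by exact_mod_cast h), hf⟩

theorem FC.mul (hf : f ∈ FC r) (hg : g ∈ FC r) : (fun x => f x * g x) ∈ FC r := by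
  obtain ⟨m, φ, hφ, hf⟩ := hf
  obtain ⟨n, ψ, hψ, hg⟩ := hg
  refine ⟨m + n, fun y => φ (fun i => y (Fin.castLE (Nat.le_add_right m n) i)) *
      ψ (fun i => y (Fin.castLE (Nat.le_add_left n m) i)), ?_, fun x => by simp [hf x, hg x]⟩
  exact (hφ.comp (contDiff_pi.2 fun i => contDiff_apply ℝ ℝ _)).mul
      (hψ.comp (contDiff_pi.2 fun i => contDiff_apply ℝ ℝ _))

theorem FC.comp {ψ : ℝ → ℝ} (hψ : ContDiff ℝ r ψ) (hf : f ∈ FC r) : (fun x => ψ (f x)) ∈ FC r := by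
  obtain ⟨m, φ, hφ, hf⟩ := hf
  exact ⟨m, fun y => ψ (φ y), hψ.comp hφ, fun x => congrArg ψ (hf x)⟩

theorem FC.const (c : ℝ) : (fun _ => c) ∈ FC r := ⟨0, fun _ => c, contDiff_const, fun _ => rfl⟩

theorem FC.coord (i : ℕ) : (fun x => x i) ∈ FC r :=
  ⟨i + 1, fun y => y (Fin.last i), contDiff_apply ℝ ℝ _, fun x => by simp⟩

/-- The directional derivative of a cylinder function in terms of its base function. -/
theorem hasDerivAt_update {m : ℕ} {φ : (Fin m → ℝ) → ℝ} (hφ : ContDiff ℝ 1 φ) (n : ℕ)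
    (x : ℕ → ℝ) :
    HasDerivAt (fun t => φ fun i => Function.update x n t i)
      (fderiv ℝ φ (fun i => x i) fun i => if (i : ℕ) = n then 1 else 0) (x n) := by
  have h1 : HasDerivAt (fun t => fun i : Fin m => Function.update x n t i)
      (fun i : Fin m => if (i : ℕ) = n then (1 : ℝ) else 0) (x n) := by
    rw [hasDerivAt_pi]
    intro i
    by_cases hi : (i : ℕ) = n
    · simp only [hi, Function.update_self, if_true]
      exact hasDerivAt_id _
    · simp only [hi, ne_eq, not_false_eq_true, Function.update_of_ne, if_false]
      exact hasDerivAt_const _ _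
  have h2 := (hφ.differentiable one_ne_zero (fun i : Fin m => x i)).hasFDerivAt
  have h3 : (fun i : Fin m => x i) = fun i : Fin m => Function.update x n (x n) i := by simp
  rw [h3] at h2
  have := h2.comp_hasDerivAt (x n) h1
  rwa [← h3] at this

theorem pd_eq_fderiv {m : ℕ} {φ : (Fin m → ℝ) → ℝ} (hφ : ContDiff ℝ 1 φ)
    (hf : ∀ x, f x = φ fun i => x i) (n : ℕ) (x : ℕ → ℝ) :
    pd n f x = fderiv ℝ φ (fun i => x i) fun i => if (i : ℕ) = n then 1 else 0 := by
  rw [pd, funext hf]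
  exact (hasDerivAt_update hφ n x).deriv

theorem FC.hasDerivAt (hf : f ∈ FC 1) (n : ℕ) (x : ℕ → ℝ) :
    HasDerivAt (fun t => f (Function.update x n t)) (pd n f x) (x n) := by
  obtain ⟨m, φ, hφ, hf⟩ := hf
  rw [pd_eq_fderiv hφ hf, funext hf]
  exact hasDerivAt_update hφ n x

theorem FC.pd_mem (hf : f ∈ FC (r + 1)) (n : ℕ) : pd n f ∈ FC r := by
  obtain ⟨m, φ, hφ, hf⟩ := hf
  refine ⟨m, fun y => fderiv ℝ φ y fun i => if (i : ℕ) = n then 1 else 0, ?_, fun x => ?_⟩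
  · exact (hφ.fderiv_right (m := r) (by simp)).clm_apply contDiff_const
  · exact pd_eq_fderiv (hφ.of_le (by simp)) hf n x

theorem FC.exists_pd_eq_zero (hf : f ∈ FC 1) : ∃ m, ∀ n ≥ m, ∀ x, pd n f x = 0 := by
  obtain ⟨m, φ, hφ, hf⟩ := hf
  refine ⟨m, fun n hn x => ?_⟩
  rw [pd_eq_fderiv hφ hf]
  have : (fun i : Fin m => if (i : ℕ) = n then (1 : ℝ) else 0) = 0 := by
    ext i
    have := i.2
    rw [if_neg (by omega), Pi.zero_apply]
  rw [this, map_zero]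

theorem pd_zero (n : ℕ) (x : ℕ → ℝ) : pd n (fun _ => (0 : ℝ)) x = 0 := by simp [pd]

theorem pd_mul (hf : f ∈ FC 1) (hg : g ∈ FC 1) (n : ℕ) (x : ℕ → ℝ) :
    pd n (fun x => f x * g x) x = pd n f x * g x + f x * pd n g x := by
  have h := ((FC.hasDerivAt hf n x).mul (FC.hasDerivAt hg n x)).deriv
  rw [Function.update_eq_self] at h
  exact h

theorem pd_add (hf : f ∈ FC 1) (hg : g ∈ FC 1) (n : ℕ) (x : ℕ → ℝ) :
    pd n (f + g) x = pd n f x + pd n g x :=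
  ((FC.hasDerivAt hf n x).add (FC.hasDerivAt hg n x)).deriv

theorem pd_sub (hf : f ∈ FC 1) (hg : g ∈ FC 1) (n : ℕ) (x : ℕ → ℝ) :
    pd n (f - g) x = pd n f x - pd n g x :=
  ((FC.hasDerivAt hf n x).sub (FC.hasDerivAt hg n x)).deriv

theorem pd_comp {ψ : ℝ → ℝ} (hψ : ContDiff ℝ 1 ψ) (hf : f ∈ FC 1) (n : ℕ) (x : ℕ → ℝ) :
    pd n (fun x => ψ (f x)) x = deriv ψ (f x) * pd n f x := by
  have h1 : HasDerivAt ψ (deriv ψ (f x)) (f (Function.update x n (x n))) := by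
    rw [Function.update_eq_self]
    exact (hψ.differentiable one_ne_zero _).hasDerivAt
  exact (h1.comp (x n) (FC.hasDerivAt hf n x)).deriv

theorem genExpr_eq_sum {α : ℕ → ℝ} {β : ℝ} {m : ℕ} (hm : ∀ n ≥ m, ∀ x, pd n f x = 0)
    (x : ℕ → ℝ) : genExpr α β f x = ∑ n ∈ Finset.range m, (x n * (1 - ∑' i, x i) *
      pd n (pd n f) x + (α n * (1 - ∑' i, x i) - β * x n) * pd n f x) := by
  rw [genExpr, tsum_eq_sum (s := Finset.range m)]
  intro n hn
  have hn' : m ≤ n := by simpa using hn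
  have h1 : pd n f = fun _ => 0 := funext fun y => hm n hn' y
  rw [h1, pd_zero, mul_zero, mul_zero, add_zero]

theorem continuous_padZero (N : ℕ) : Continuous (padZero (N := N)) := by
  refine continuous_pi fun i => ?_
  unfold padZero
  split_ifs
  · exact continuous_apply _
  · exact continuous_const

theorem padZero_update {N : ℕ} (y : Fin N → ℝ) (n : Fin N) (t : ℝ) :
    padZero (Function.update y n t) = Function.update (padZero y) n t := by
  ext i
  by_cases hi : i < N
  · by_cases hin : (⟨i, hi⟩ : Fin N) = n
    · subst hin
      simp [padZero, hi]
    · have : i ≠ n := fun h => hin (Fin.ext h)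
      simp [padZero, hi, hin, this]
  · have : i ≠ n := fun h => hi (h ▸ n.2)
    simp [padZero, hi, this]

theorem padZero_aggregate (x : InfSimplex) {k i : ℕ} (hi : i < k) :
    padZero (aggregate (coords x) k) i = coords x i := by
  simp [padZero, aggregate, hi, hi.trans k.lt_succ_self]

variable {α : ℕ → ℝ} {β : ℝ} {μ : Measure InfSimplex} [IsProbabilityMeasure μ]

theorem integrable_of_bound {F : InfSimplex → ℝ} (hF : Continuous F) {C : ℝ}
    (hC : ∀ x, |F x| ≤ C) : Integrable F μ :=
  Integrable.of_bound hF.aestronglyMeasurable C (Eventually.of_forall hC)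

theorem integrable_FC (hf : f ∈ FC r) : Integrable (fun x => f (coords x)) μ := by
  obtain ⟨C, hC⟩ := FC.exists_bound hf
  exact integrable_of_bound (FC.continuous_coords hf) hC

theorem abs_one_sub_le (x : InfSimplex) : |1 - ∑' i, coords x i| ≤ 1 :=
  abs_le.2 ⟨by linarith [tsum_coords_le_one x], by linarith [tsum_coords_nonneg x]⟩

theorem integrable_weight_mul (n : ℕ) (hf : f ∈ FC r) :
    Integrable (fun x => coords x n * (1 - ∑' i, coords x i) * f (coords x)) μ := by
  refine Integrable.bdd_mul (c := 1) (integrable_FC hf) ((continuous_coord n).mul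
    (continuous_const.sub continuous_tsum_coords)).aestronglyMeasurable
    (Eventually.of_forall fun x => ?_)
  rw [norm_mul]
  refine mul_le_one₀ ?_ (norm_nonneg _) (abs_one_sub_le x)
  rw [Real.norm_eq_abs, abs_of_nonneg (coords_nonneg x n)]
  exact (coords_mem_Icc x n).2

theorem integrable_drift_mul (α : ℕ → ℝ) (β : ℝ) (n : ℕ) (hf : f ∈ FC r) :
    Integrable (fun x => (α n * (1 - ∑' i, coords x i) - β * coords x n) * f (coords x)) μ := by
  refine Integrable.bdd_mul (c := |α n| + |β|) (integrable_FC hf)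
    ((continuous_const.mul (continuous_const.sub continuous_tsum_coords)).sub
    (continuous_const.mul (continuous_coord n))).aestronglyMeasurable
    (Eventually.of_forall fun x => ?_)
  rw [Real.norm_eq_abs]
  refine (abs_sub _ _).trans (add_le_add ?_ ?_)
  · rw [abs_mul]
    exact mul_le_of_le_one_right (abs_nonneg _) (abs_one_sub_le x)
  · rw [abs_mul, abs_of_nonneg (coords_nonneg x n)]
    exact mul_le_of_le_one_right (abs_nonneg _) (coords_mem_Icc x n).2

/-- Integration by parts in the `n`-th coordinate for the infinite-dimensional Dirichlet
distribution. -/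
theorem integral_by_parts (hα : ∀ i, 0 < α i) (hsum : Summable α) (hβ : 0 < β)
    (hμ : ∀ k, μ.map (fun x => aggregate (coords x) k) = dirichlet (aggregate α k) β)
    (hf : f ∈ FC 1) (n : ℕ) :
    ∫ x, coords x n * (1 - ∑' i, coords x i) * pd n f (coords x) ∂μ =
      -∫ x, (α n * (1 - ∑' i, coords x i) - β * coords x n) * f (coords x) ∂μ := by
  obtain ⟨m, hm⟩ := FC.exists_congr hf
  obtain ⟨m', hm'⟩ := FC.exists_congr (FC.pd_mem (r := 0) hf n)
  set k := max (max m m') (n + 1) with hk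
  have hkm : m ≤ k := (le_max_left _ _).trans (le_max_left _ _)
  have hkm' : m' ≤ k := (le_max_right _ _).trans (le_max_left _ _)
  have hkn : n < k := (Nat.lt_succ_self n).trans_le (le_max_right _ _)
  have hprob := isProbabilityMeasure_dirichlet_aggregate hα hsum hβ k
  set N : Fin (k + 1) := ⟨n, hkn.trans k.lt_succ_self⟩ with hN
  have h := integral_dirichlet_by_parts (aggregate_pos hα hsum k) hβ N
    (h := fun y => f (padZero y)) (h' := fun y => pd n f (padZero y))
    ((FC.continuous hf).comp (continuous_padZero _))
    ((FC.continuous (FC.pd_mem (r := 0) hf n)).comp (continuous_padZero _)) fun y => by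
      have := FC.hasDerivAt hf n (padZero y)
      have e : padZero y n = y N := by
        simp [padZero, hN, hkn.trans k.lt_succ_self]
      rw [e] at this
      simpa only [padZero_update, hN] using this
  have hc1 : Continuous fun y : Fin (k + 1) → ℝ => f (padZero y) :=
    (FC.continuous hf).comp (continuous_padZero _)
  have hc2 : Continuous fun y : Fin (k + 1) → ℝ => pd n f (padZero y) :=
    (FC.continuous (FC.pd_mem (r := 0) hf n)).comp (continuous_padZero _)
  have hs : Continuous fun y : Fin (k + 1) → ℝ => 1 - ∑ i, y i := by fun_prop
  have hF : Continuous fun y : Fin (k + 1) → ℝ => y N * (1 - ∑ i, y i) * pd n f (padZero y) +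
      (aggregate α k N * (1 - ∑ i, y i) - β * y N) * f (padZero y) :=
    (((continuous_apply N).mul hs).mul hc2).add
      (((continuous_const.mul hs).sub (continuous_const.mul (continuous_apply N))).mul hc1)
  rw [← hμ k, integral_map (continuous_aggregate k).measurable.aemeasurable
    hF.aestronglyMeasurable] at h
  have e1 : ∀ x : InfSimplex, aggregate (coords x) k N = coords x n := fun x => by
    simp [aggregate, hN, hkn]
  have e2 : aggregate α k N = α n := by simp [aggregate, hN, hkn]
  have e3 : ∀ x : InfSimplex, f (padZero (aggregate (coords x) k)) = f (coords x) := fun x =>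
    hm _ _ fun i hi => padZero_aggregate x (hi.trans_le hkm)
  have e4 : ∀ x : InfSimplex, pd n f (padZero (aggregate (coords x) k)) = pd n f (coords x) :=
    fun x => hm' _ _ fun i hi => padZero_aggregate x (hi.trans_le hkm')
  simp only [e1, e2, e3, e4, sum_aggregate_coords] at h
  rw [integral_add (integrable_weight_mul n (FC.pd_mem (r := 0) hf n))
    (integrable_drift_mul α β n hf)] at h
  linarith

theorem energy_integrand_eq {f g : (ℕ → ℝ) → ℝ} {m : ℕ} (hm : ∀ n ≥ m, ∀ x, pd n f x = 0)
    (x : ℕ → ℝ) : (1 - ∑' n, x n) * ∑' n, x n * (pd n f x * pd n g x) =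
      ∑ n ∈ Finset.range m, x n * (1 - ∑' i, x i) * (pd n f x * pd n g x) := by
  rw [tsum_eq_sum (f := fun n => x n * (pd n f x * pd n g x)) (s := Finset.range m),
    Finset.mul_sum]
  · exact Finset.sum_congr rfl fun n _ => by ring
  · intro n hn
    rw [hm n (by simpa using hn)]
    ring

/-- On `C²` cylinder functions, the form is given by the generator. -/
theorem energy_eq_neg_integral (hα : ∀ i, 0 < α i) (hsum : Summable α) (hβ : 0 < β)
    (hμ : ∀ k, μ.map (fun x => aggregate (coords x) k) = dirichlet (aggregate α k) β)
    (f g : FC 1) (hf : f.1 ∈ FC 2) :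
    energy μ f g = -∫ x, genExpr α β f.1 (coords x) * g.1 (coords x) ∂μ := by
  obtain ⟨m, hm⟩ := FC.exists_pd_eq_zero f.2
  have hp : ∀ n, pd n f.1 ∈ FC 1 := fun n => FC.pd_mem hf n
  have hpp : ∀ n, pd n (pd n f.1) ∈ FC 0 := fun n => FC.pd_mem (hp n) n
  have hg0 : ∀ n, pd n g.1 ∈ FC 0 := fun n => FC.pd_mem g.2 n
  have h0 : (0 : ℕ) ≤ 1 := zero_le_one
  have hI1 : ∀ n, Integrable (fun x => coords x n * (1 - ∑' i, coords x i) *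
      (pd n f.1 (coords x) * pd n g.1 (coords x))) μ := fun n =>
    integrable_weight_mul (f := fun y => pd n f.1 y * pd n g.1 y) n
      (FC.mul (FC.mono h0 (hp n)) (hg0 n))
  have hI2 : ∀ n, Integrable (fun x => coords x n * (1 - ∑' i, coords x i) *
      (pd n (pd n f.1) (coords x) * g.1 (coords x))) μ := fun n =>
    integrable_weight_mul (f := fun y => pd n (pd n f.1) y * g.1 y) n
      (FC.mul (hpp n) (FC.mono h0 g.2))
  have hI3 : ∀ n, Integrable (fun x => (α n * (1 - ∑' i, coords x i) - β * coords x n) *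
      (pd n f.1 (coords x) * g.1 (coords x))) μ := fun n =>
    integrable_drift_mul (f := fun y => pd n f.1 y * g.1 y) α β n (FC.mul (hp n) g.2)
  have key : ∀ n, ∫ x, coords x n * (1 - ∑' i, coords x i) *
      (pd n f.1 (coords x) * pd n g.1 (coords x)) ∂μ =
      -∫ x, (coords x n * (1 - ∑' i, coords x i) * pd n (pd n f.1) (coords x) +
        (α n * (1 - ∑' i, coords x i) - β * coords x n) * pd n f.1 (coords x)) *
        g.1 (coords x) ∂μ := by
    intro n
    have h := integral_by_parts hα hsum hβ hμ (FC.mul (hp n) g.2) n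
    simp only [pd_mul (hp n) g.2] at h
    have e1 : ∀ x : InfSimplex, coords x n * (1 - ∑' i, coords x i) *
        (pd n (pd n f.1) (coords x) * g.1 (coords x) + pd n f.1 (coords x) * pd n g.1 (coords x)) =
        coords x n * (1 - ∑' i, coords x i) * (pd n (pd n f.1) (coords x) * g.1 (coords x)) +
        coords x n * (1 - ∑' i, coords x i) * (pd n f.1 (coords x) * pd n g.1 (coords x)) :=
      fun x => by ring
    simp only [e1] at h
    rw [integral_add (hI2 n) (hI1 n)] at h
    have e2 : ∀ x : InfSimplex, (coords x n * (1 - ∑' i, coords x i) * pd n (pd n f.1) (coords x) +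
        (α n * (1 - ∑' i, coords x i) - β * coords x n) * pd n f.1 (coords x)) * g.1 (coords x) =
        coords x n * (1 - ∑' i, coords x i) * (pd n (pd n f.1) (coords x) * g.1 (coords x)) +
        (α n * (1 - ∑' i, coords x i) - β * coords x n) *
          (pd n f.1 (coords x) * g.1 (coords x)) := fun x => by ring
    simp only [e2]
    rw [integral_add (hI2 n) (hI3 n)]
    linarith
  rw [energy]
  simp only [energy_integrand_eq hm, genExpr_eq_sum hm, Finset.sum_mul]
  rw [integral_finsetSum _ fun n _ => hI1 n, integral_finsetSum, ← Finset.sum_neg_distrib]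
  · exact Finset.sum_congr rfl fun n _ => key n
  · intro n _
    refine ((hI2 n).add (hI3 n)).congr (Eventually.of_forall fun x => ?_)
    simp only [Pi.add_apply]
    ring

omit [IsProbabilityMeasure μ] in
theorem energy_comm (f g : FC 1) : energy μ f g = energy μ g f := by
  simp only [energy, mul_comm (pd _ f.1 _)]

/-- The energy is continuous under bounded pointwise convergence of the gradients. -/
theorem tendsto_energy {τ : Type*} {l : Filter τ} [l.IsCountablyGenerated] {F G : τ → FC 1}
    {f g : FC 1} {C : ℝ} (hF : ∀ t n (x : InfSimplex), |pd n (F t).1 (coords x)| ≤ C)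
    (hG : ∀ t n (x : InfSimplex), |pd n (G t).1 (coords x)| ≤ C)
    (hFf : ∀ n (x : InfSimplex), Tendsto (fun t => pd n (F t).1 (coords x)) l
      (𝓝 (pd n f.1 (coords x))))
    (hGg : ∀ n (x : InfSimplex), Tendsto (fun t => pd n (G t).1 (coords x)) l
      (𝓝 (pd n g.1 (coords x)))) :
    Tendsto (fun t => energy μ (F t) (G t)) l (𝓝 (energy μ f g)) := by
  have hb : ∀ t n (x : InfSimplex), ‖coords x n * (pd n (F t).1 (coords x) *
      pd n (G t).1 (coords x))‖ ≤ coords x n * (C * C) := fun t n x => by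
    have hC : 0 ≤ C := (abs_nonneg _).trans (hF t n x)
    rw [norm_mul, norm_mul, Real.norm_eq_abs, abs_of_nonneg (coords_nonneg x n)]
    exact mul_le_mul_of_nonneg_left (mul_le_mul (hF t n x) (hG t n x) (abs_nonneg _) hC)
      (coords_nonneg x n)
  refine tendsto_integral_filter_of_dominated_convergence (fun _ => C * C)
    (Eventually.of_forall fun t => ?_) (Eventually.of_forall fun t => ?_) (integrable_const _) ?_
  · obtain ⟨m, hm⟩ := FC.exists_pd_eq_zero (F t).2
    simp only [energy_integrand_eq hm]
    refine Continuous.aestronglyMeasurable (continuous_finsetSum _ fun n _ => ?_)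
    exact ((continuous_coord n).mul (continuous_const.sub continuous_tsum_coords)).mul
      ((FC.continuous_coords (FC.pd_mem (r := 0) (F t).2 n)).mul
        (FC.continuous_coords (FC.pd_mem (r := 0) (G t).2 n)))
  · refine Eventually.of_forall fun x => ?_
    rw [norm_mul]
    have h1 := tsum_of_norm_bounded ((summable_coords x).mul_right (C * C)).hasSum (hb t · x)
    rw [tsum_mul_right] at h1
    have hCC : 0 ≤ C * C := mul_self_nonneg C
    calc _ ≤ 1 * ((∑' n, coords x n) * (C * C)) :=
          mul_le_mul (abs_one_sub_le x) h1 (norm_nonneg _) zero_le_one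
      _ ≤ C * C := by
          rw [one_mul]
          exact mul_le_of_le_one_left hCC (tsum_coords_le_one x)
  · refine Eventually.of_forall fun x => Tendsto.const_mul _ ?_
    refine tendsto_tsum_of_dominated_convergence ((summable_coords x).mul_right (C * C))
      (fun n => ((hFf n x).mul (hGg n x)).const_mul _) (Eventually.of_forall fun t n => hb t n x)

end Cylinder

/-! ### Classes in `L²` and bounded convergence -/

section ClassL2

variable {X : Type*} [MeasurableSpace X] (μ : Measure X)

/-- The class in `L²(μ)` of a function, with the junk value `0` if it is not square integrable. -/
def classL2 (F : X → ℝ) : Lp ℝ 2 μ :=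
  open Classical in if h : MemLp F 2 μ then h.toLp F else 0

variable {μ} {F G : X → ℝ}

theorem classL2_of_memLp (h : MemLp F 2 μ) : classL2 μ F = h.toLp F := dif_pos h

theorem coeFn_classL2 (h : MemLp F 2 μ) : classL2 μ F =ᵐ[μ] F := by
  rw [classL2_of_memLp h]
  exact h.coeFn_toLp

theorem eq_classL2 (h : MemLp F 2 μ) {u : Lp ℝ 2 μ} (hu : u =ᵐ[μ] F) : u = classL2 μ F :=
  Lp.ext (hu.trans (coeFn_classL2 h).symm)

theorem inner_classL2 (hF : MemLp F 2 μ) (hG : MemLp G 2 μ) :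
    inner ℝ (classL2 μ F) (classL2 μ G) = ∫ x, F x * G x ∂μ := by
  rw [L2.inner_def]
  refine integral_congr_ae ?_
  filter_upwards [coeFn_classL2 hF, coeFn_classL2 hG] with x h1 h2
  rw [h1, h2, real_inner_eq_re_inner, RCLike.inner_apply]
  simp [mul_comm]

theorem classL2_add (hF : MemLp F 2 μ) (hG : MemLp G 2 μ) :
    classL2 μ (fun x => F x + G x) = classL2 μ F + classL2 μ G := by
  refine (eq_classL2 (hF.add hG) ?_).symm
  filter_upwards [Lp.coeFn_add (classL2 μ F) (classL2 μ G), coeFn_classL2 hF, coeFn_classL2 hG]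
    with x h1 h2 h3
  rw [h1, Pi.add_apply, h2, h3, Pi.add_apply]

theorem classL2_sub (hF : MemLp F 2 μ) (hG : MemLp G 2 μ) :
    classL2 μ (fun x => F x - G x) = classL2 μ F - classL2 μ G := by
  refine (eq_classL2 (hF.sub hG) ?_).symm
  filter_upwards [Lp.coeFn_sub (classL2 μ F) (classL2 μ G), coeFn_classL2 hF, coeFn_classL2 hG]
    with x h1 h2 h3
  rw [h1, Pi.sub_apply, h2, h3, Pi.sub_apply]

theorem classL2_const_mul (c : ℝ) (hF : MemLp F 2 μ) :
    classL2 μ (fun x => c * F x) = c • classL2 μ F := by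
  refine (eq_classL2 (hF.const_mul c) ?_).symm
  filter_upwards [Lp.coeFn_smul c (classL2 μ F), coeFn_classL2 hF] with x h1 h2
  rw [h1, Pi.smul_apply, h2, smul_eq_mul]

theorem norm_classL2_sq (hF : MemLp F 2 μ) : ‖classL2 μ F‖ ^ 2 = ∫ x, F x ^ 2 ∂μ := by
  rw [← real_inner_self_eq_norm_sq, inner_classL2 hF hF]
  simp only [sq]

/-- Bounded convergence in `L²`. -/
theorem tendsto_classL2 [IsFiniteMeasure μ] {Φ : ℕ → X → ℝ} {C : ℝ}
    (hΦ : ∀ k, AEStronglyMeasurable (Φ k) μ) (hC : ∀ k x, |Φ k x| ≤ C)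
    (h : ∀ x, Tendsto (fun k => Φ k x) atTop (𝓝 (F x))) :
    Tendsto (fun k => classL2 μ (Φ k)) atTop (𝓝 (classL2 μ F)) := by
  have hFC : ∀ x, |F x| ≤ C := fun x =>
    le_of_tendsto (h x).abs (Eventually.of_forall fun k => hC k x)
  have hFm : AEStronglyMeasurable F μ := aestronglyMeasurable_of_tendsto_ae atTop hΦ (ae_of_all _ h)
  have hF2 : MemLp F 2 μ := MemLp.of_bound hFm C (ae_of_all _ hFC)
  have hΦ2 : ∀ k, MemLp (Φ k) 2 μ := fun k => MemLp.of_bound (hΦ k) C (ae_of_all _ (hC k))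
  have hb : ∀ k x, ‖(Φ k x - F x) ^ 2‖ ≤ (2 * C) ^ 2 := fun k x => by
    rw [norm_pow, Real.norm_eq_abs]
    refine pow_le_pow_left₀ (abs_nonneg _) ?_ 2
    have := (abs_sub (Φ k x) (F x)).trans (add_le_add (hC k x) (hFC x))
    linarith
  have h1 : Tendsto (fun k => ∫ x, (Φ k x - F x) ^ 2 ∂μ) atTop (𝓝 (∫ _, (0 : ℝ) ∂μ)) := by
    refine tendsto_integral_of_dominated_convergence (fun _ => (2 * C) ^ 2)
      (fun k => ((hΦ k).sub hFm).pow 2) (integrable_const _) (fun k => ae_of_all _ (hb k))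
      (ae_of_all _ fun x => ?_)
    simpa using ((h x).sub_const (F x)).pow 2
  rw [tendsto_iff_norm_sub_tendsto_zero]
  have h2 := h1.sqrt
  simp only [integral_zero, Real.sqrt_zero] at h2
  refine h2.congr fun k => ?_
  rw [← classL2_sub (hΦ2 k) hF2, ← Real.sqrt_sq (norm_nonneg (classL2 μ _)),
    norm_classL2_sq (F := fun x => Φ k x - F x) ((hΦ2 k).sub hF2)]

theorem classL2_const [IsFiniteMeasure μ] (c : ℝ) :
    classL2 μ (fun _ : X => c) = Lp.const 2 μ c :=
  (eq_classL2 (memLp_const c) (Lp.coeFn_const (p := 2) (μ := μ) c)).symm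

theorem inner_const_one [IsFiniteMeasure μ] (u : Lp ℝ 2 μ) :
    inner ℝ (Lp.const 2 μ (1 : ℝ)) u = ∫ x, u x ∂μ := by
  rw [L2.inner_def]
  refine integral_congr_ae ?_
  filter_upwards [Lp.coeFn_const (p := 2) (μ := μ) (1 : ℝ)] with x hx
  rw [hx]
  simp

theorem norm_sq_eq_integral (u : Lp ℝ 2 μ) : ‖u‖ ^ 2 = ∫ x, u x ^ 2 ∂μ := by
  rw [← real_inner_self_eq_norm_sq, L2.inner_def]
  refine integral_congr_ae (Eventually.of_forall fun x => ?_)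
  simp [sq]

end ClassL2

/-! ### Approximation of cylinder functions -/

section Approximation

variable {μ : Measure InfSimplex} [IsProbabilityMeasure μ] {r : ℕ} {f : (ℕ → ℝ) → ℝ}

theorem toL2_eq_classL2 (f : FC r) : toL2 r μ f = classL2 μ fun x => f.1 (coords x) :=
  (classL2_of_memLp (memLp_cylinder f μ)).symm

theorem memLp_of_bound {F : InfSimplex → ℝ} (hF : Continuous F) {C : ℝ} (hC : ∀ x, |F x| ≤ C) :
    MemLp F 2 μ :=
  MemLp.of_bound hF.aestronglyMeasurable C (ae_of_all _ hC)

/-- A compactly supported `C¹` function is a uniform `C¹`-limit of smooth functions. -/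
theorem exists_contDiff_near {m : ℕ} {φ : (Fin m → ℝ) → ℝ} (hφ : ContDiff ℝ 1 φ)
    (hc : HasCompactSupport φ) {ε : ℝ} (hε : 0 < ε) :
    ∃ ψ : (Fin m → ℝ) → ℝ, ContDiff ℝ 2 ψ ∧ (∀ y, dist (ψ y) (φ y) ≤ ε) ∧
      ∀ y, dist (fderiv ℝ ψ y) (fderiv ℝ φ y) ≤ ε := by
  have hu := hc.uniformContinuous_of_continuous hφ.continuous
  have hu' := (hc.fderiv ℝ).uniformContinuous_of_continuous (hφ.continuous_fderiv one_ne_zero)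
  obtain ⟨δ, hδ, h1⟩ := Metric.uniformContinuous_iff.1 hu ε hε
  obtain ⟨δ', hδ', h2⟩ := Metric.uniformContinuous_iff.1 hu' ε hε
  set ρ := min δ δ'
  have hρ : 0 < ρ := lt_min hδ hδ'
  set χ : ContDiffBump (0 : Fin m → ℝ) := ⟨ρ / 2, ρ, half_pos hρ, half_lt_self hρ⟩ with hχ
  refine ⟨convolution (χ.normed volume) φ (ContinuousLinearMap.lsmul ℝ ℝ) volume, ?_, fun y => ?_,
    fun y => ?_⟩
  · exact χ.hasCompactSupport_normed.contDiff_convolution_left _ χ.contDiff_normed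
      hφ.continuous.locallyIntegrable
  · refine χ.dist_normed_convolution_le hφ.continuous.aestronglyMeasurable fun x hx => ?_
    exact (h1 ((Metric.mem_ball.1 hx).trans_le (min_le_left _ _))).le
  · have h3 := hc.hasFDerivAt_convolution_right (ContinuousLinearMap.lsmul ℝ ℝ)
      ((χ.continuous_normed (μ := volume)).locallyIntegrable (μ := volume)) hφ y
    have h4 : (ContinuousLinearMap.lsmul ℝ ℝ).precompR (Fin m → ℝ) =
        (ContinuousLinearMap.lsmul ℝ ℝ : ℝ →L[ℝ] ((Fin m → ℝ) →L[ℝ] ℝ) →L[ℝ] _) := by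
      ext c L
      simp
    rw [h3.fderiv, h4]
    refine χ.dist_normed_convolution_le
      (hφ.continuous_fderiv one_ne_zero).aestronglyMeasurable fun x hx => ?_
    exact (h2 ((Metric.mem_ball.1 hx).trans_le (min_le_right _ _))).le

/-- On the simplex, `C¹` cylinder functions are uniform `C¹`-limits of `C²` cylinder functions. -/
theorem FC.exists_near (hf : f ∈ FC 1) {ε : ℝ} (hε : 0 < ε) :
    ∃ F ∈ FC 2, (∀ x : InfSimplex, |F (coords x) - f (coords x)| ≤ ε) ∧
      ∀ n (x : InfSimplex), |pd n F (coords x) - pd n f (coords x)| ≤ ε := by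
  obtain ⟨m, φ, hφ, hf⟩ := hf
  -- a cutoff equal to one near the cube that contains the first coordinates of the simplex
  set χ : ContDiffBump (0 : Fin m → ℝ) := ⟨2, 3, by norm_num, by norm_num⟩ with hχ
  have hg : ContDiff ℝ 1 fun y => χ y * φ y := χ.contDiff.mul hφ
  obtain ⟨ψ, hψ, h1, h2⟩ := exists_contDiff_near hg χ.hasCompactSupport.mul_right hε
  have hball : ∀ x : InfSimplex, (fun i : Fin m => coords x i) ∈ Metric.ball (0 : Fin m → ℝ) 2 := by
    intro x
    rw [mem_ball_zero_iff]
    refine lt_of_le_of_lt ((pi_norm_le_iff_of_nonneg zero_le_one).2 fun i => ?_) one_lt_two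
    rw [Real.norm_eq_abs, abs_of_nonneg (coords_nonneg x i)]
    exact (coords_mem_Icc x i).2
  have hone : ∀ x : InfSimplex,
      (fun y => χ y * φ y) =ᶠ[𝓝 fun i : Fin m => coords x i] φ := fun x => by
    filter_upwards [Metric.isOpen_ball.mem_nhds (hball x)] with y hy
    rw [χ.one_of_mem_closedBall (Metric.ball_subset_closedBall hy), one_mul]
  refine ⟨fun x => ψ fun i => x i, ⟨m, ψ, hψ, fun _ => rfl⟩, fun x => ?_, fun n x => ?_⟩
  · have := h1 fun i => coords x i
    rw [(hone x).eq_of_nhds, Real.dist_eq] at this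
    rw [hf]
    exact this
  · have := h2 fun i => coords x i
    rw [(hone x).fderiv_eq, dist_eq_norm] at this
    rw [pd_eq_fderiv hφ hf, pd_eq_fderiv (hψ.of_le one_le_two) (fun _ => rfl),
      ← _root_.sub_apply, ← Real.norm_eq_abs]
    refine (ContinuousLinearMap.le_opNorm _ _).trans ?_
    refine (mul_le_mul this ?_ (norm_nonneg _) hε.le).trans (mul_one ε).le
    refine (pi_norm_le_iff_of_nonneg zero_le_one).2 fun i => ?_
    split_ifs <;> simp

theorem FC.exists_pd_bound (hf : f ∈ FC 1) :
    ∃ C, ∀ n (x : InfSimplex), |pd n f (coords x)| ≤ C := by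
  obtain ⟨m, hm⟩ := FC.exists_pd_eq_zero hf
  choose C hC using fun n => FC.exists_bound (FC.pd_mem (r := 0) hf n)
  refine ⟨∑ n ∈ Finset.range m, |C n|, fun n x => ?_⟩
  by_cases hn : n < m
  · exact ((hC n x).trans (le_abs_self _)).trans
      (Finset.single_le_sum (fun i _ => abs_nonneg (C i)) (Finset.mem_range.2 hn))
  · rw [hm n (by omega), abs_zero]
    exact Finset.sum_nonneg fun i _ => abs_nonneg _

/-- `C²` cylinder functions approximate a `C¹` cylinder function in `L²` and in energy. -/
theorem exists_seq_FC_two (f : FC 1) : ∃ F : ℕ → FC 1, (∀ k, (F k).1 ∈ FC 2) ∧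
    Tendsto (fun k => toL2 1 μ (F k)) atTop (𝓝 (toL2 1 μ f)) ∧
    Tendsto (fun k => energy μ (F k) (F k)) atTop (𝓝 (energy μ f f)) ∧
    (∀ g : FC 1, Tendsto (fun k => energy μ (F k) g) atTop (𝓝 (energy μ f g))) ∧
    Tendsto (fun k => energy μ (f - F k) (f - F k)) atTop (𝓝 0) := by
  choose F hF h1 h2 using fun k : ℕ => FC.exists_near f.2 (ε := 1 / ((k : ℝ) + 1)) (by positivity)
  have hF1 : ∀ k, F k ∈ FC 1 := fun k => FC.mono one_le_two (hF k)
  have hle : ∀ k : ℕ, 1 / ((k : ℝ) + 1) ≤ 1 := fun k => by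
    rw [div_le_one (by positivity)]
    linarith [k.cast_nonneg (α := ℝ)]
  let F' : ℕ → FC 1 := fun k => ⟨F k, hF1 k⟩
  have hlim : Tendsto (fun k : ℕ => 1 / ((k : ℝ) + 1)) atTop (𝓝 0) :=
    tendsto_one_div_add_atTop_nhds_zero_nat
  obtain ⟨C, hC⟩ := FC.exists_bound f.2
  obtain ⟨D, hD⟩ := FC.exists_pd_bound f.2
  have hdiff : ∀ n (x : InfSimplex),
      Tendsto (fun k => pd n (F k) (coords x) - pd n f.1 (coords x)) atTop (𝓝 0) := fun n x =>
    squeeze_zero_norm (fun k => h2 k n x) hlim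
  have hb : ∀ (k : ℕ) n (x : InfSimplex), |pd n (F' k).1 (coords x)| ≤ D + 1 := fun k n x => by
    have := abs_add_le (pd n (F k) (coords x) - pd n f.1 (coords x)) (pd n f.1 (coords x))
    rw [sub_add_cancel] at this
    exact this.trans (by linarith [h2 k n x, hle k, hD n x])
  have hl : ∀ n (x : InfSimplex),
      Tendsto (fun k => pd n (F' k).1 (coords x)) atTop (𝓝 (pd n f.1 (coords x))) := fun n x => by
    simpa using (hdiff n x).add_const (pd n f.1 (coords x))
  refine ⟨F', hF, ?_, ?_, fun g => ?_, ?_⟩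
  · simp only [toL2_eq_classL2]
    refine tendsto_classL2 (C := C + 1)
      (fun k => (FC.continuous_coords (hF k)).aestronglyMeasurable) (fun k x => ?_) fun x => ?_
    · have := abs_add_le (F k (coords x) - f.1 (coords x)) (f.1 (coords x))
      rw [sub_add_cancel] at this
      linarith [h1 k x, hle k, hC x]
    · rw [tendsto_iff_norm_sub_tendsto_zero]
      exact squeeze_zero (fun _ => norm_nonneg _) (fun k => h1 k x) hlim
  · exact tendsto_energy (F := F') (G := F') hb hb hl hl
  · obtain ⟨D', hD'⟩ := FC.exists_pd_bound g.2
    exact tendsto_energy (F := F') (G := fun _ => g) (C := max (D + 1) D')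
      (fun k n x => (hb k n x).trans (le_max_left _ _))
      (fun _ n x => (hD' n x).trans (le_max_right _ _)) hl fun n x => tendsto_const_nhds
  · have hp : ∀ (k : ℕ) n (x : ℕ → ℝ),
        pd n (f - F' k).1 x = pd n f.1 x - pd n (F k) x :=
      fun k n x => pd_sub f.2 (hF1 k) n x
    have hb : ∀ (k : ℕ) n (x : InfSimplex),
        |pd n (f - F' k).1 (coords x)| ≤ 1 := fun k n x => by
      rw [hp, abs_sub_comm]
      exact (h2 k n x).trans (hle k)
    have hl : ∀ n (x : InfSimplex), Tendsto (fun k => pd n (f - F' k).1 (coords x))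
        atTop (𝓝 (pd n (0 : FC 1).1 (coords x))) := fun n x => by
      have : pd n (0 : FC 1).1 (coords x) = 0 := pd_zero n _
      rw [this]
      simpa only [hp, neg_sub, neg_zero] using (hdiff n x).neg
    have h0 : energy μ (0 : FC 1) 0 = 0 := by
      have : ∀ n x, pd n (0 : FC 1).1 x = 0 := pd_zero
      simp only [energy, this, mul_zero, tsum_zero, integral_zero]
    rw [← h0]
    exact tendsto_energy (F := fun k => f - F' k) (G := fun k => f - F' k)
      hb hb hl hl

end Approximation

/-! ### Polynomials with an aggregated tail -/

section PolynomialClasses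

open MvPolynomial

variable {N r : ℕ} {Y : Fin N → (ℕ → ℝ) → ℝ}

theorem FC.eval_mem (hY : ∀ i, Y i ∈ FC r) (p : MvPolynomial (Fin N) ℝ) :
    (fun x => eval (fun i => Y i x) p) ∈ FC r := by
  induction p using MvPolynomial.induction_on with
  | C c => simpa using FC.const c
  | add p q hp hq =>
    simp only [map_add]
    exact (FC r).add_mem hp hq
  | mul_X p i hp => simpa using FC.mul hp (hY i)

theorem pd_eval (hY : ∀ i, Y i ∈ FC 1) (p : MvPolynomial (Fin N) ℝ) (n : ℕ) (x : ℕ → ℝ) :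
    pd n (fun x => eval (fun i => Y i x) p) x =
      ∑ i, eval (fun j => Y j x) (pderiv i p) * pd n (Y i) x := by
  induction p using MvPolynomial.induction_on with
  | C c => simp [pd]
  | add p q hp hq =>
    have h := pd_add (FC.eval_mem hY p) (FC.eval_mem hY q) n x
    simp only [map_add, add_mul, Finset.sum_add_distrib, ← hp, ← hq, ← h]
    rfl
  | mul_X p k hp =>
    have h := pd_mul (FC.eval_mem hY p) (hY k) n x
    simp only [map_mul, eval_X, h, hp, Derivation.leibniz, smul_eq_mul, map_add, add_mul,
      Finset.sum_add_distrib, pderiv_X, Finset.sum_mul]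
    rw [add_comm]
    refine congrArg₂ _ ?_ (Finset.sum_congr rfl fun i _ => by ring)
    rw [Finset.sum_eq_single k (fun i _ hik => by simp [Ne.symm hik])
      (by simp)]
    simp

/-- The coordinate of `aggregate c m` to which `c n` contributes. -/
def cell (m n : ℕ) : Fin (m + 1) := ⟨min n m, Nat.lt_succ_of_le (min_le_right n m)⟩

/-- The finite part `∑_{n < M} c_n` of the sums in `aggregate c m`. -/
def partialAggregate (m M : ℕ) (i : Fin (m + 1)) (c : ℕ → ℝ) : ℝ :=
  ∑ n ∈ Finset.range M, if cell m n = i then c n else 0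

theorem hasSum_aggregate {c : ℕ → ℝ} (hc : Summable c) (m : ℕ) (i : Fin (m + 1)) :
    HasSum (fun n => if cell m n = i then c n else 0) (aggregate c m i) := by
  unfold aggregate
  split_ifs with h
  · have : ∀ n : ℕ, n ≠ i → (if cell m n = i then c n else 0) = 0 := fun n hn => by
      rw [if_neg]
      intro h'
      have := congrArg Fin.val h'
      simp only [cell] at this
      omega
    have h1 := hasSum_single (f := fun n => if cell m n = i then c n else 0) (i : ℕ) this
    have h2 : cell m i = i := Fin.ext (min_eq_left h.le)
    simpa only [h2, if_true] using h1
  · have hi : (i : ℕ) = m := by have := i.2; omega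
    rw [← hasSum_nat_add_iff' m]
    have h1 : ∀ n, cell m (n + m) = i := fun n => Fin.ext (by simp [cell, hi])
    have h2 : ∑ n ∈ Finset.range m, (if cell m n = i then c n else 0) = 0 := by
      refine Finset.sum_eq_zero fun n hn => if_neg fun h' => ?_
      have := congrArg Fin.val h'
      have := Finset.mem_range.1 hn
      simp only [cell] at *
      omega
    simp only [h1, if_true, h2, sub_zero, add_comm m]
    exact ((summable_nat_add_iff m).2 hc).hasSum

theorem partialAggregate_mem_FC (m M : ℕ) (i : Fin (m + 1)) : partialAggregate m M i ∈ FC r := by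
  have : partialAggregate m M i =
      ∑ n ∈ Finset.range M, if cell m n = i then fun c : ℕ → ℝ => c n else 0 := by
    ext c
    simp only [partialAggregate, Finset.sum_apply]
    refine Finset.sum_congr rfl fun n _ => ?_
    split_ifs <;> rfl
  rw [this]
  refine Submodule.sum_mem _ fun n _ => ?_
  split_ifs
  · exact FC.coord n
  · exact Submodule.zero_mem _

theorem pd_partialAggregate (m M : ℕ) (i : Fin (m + 1)) (n : ℕ) (x : ℕ → ℝ) :
    pd n (partialAggregate m M i) x = if n < M ∧ cell m n = i then 1 else 0 := by
  refine HasDerivAt.deriv ?_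
  have h : ∀ k ∈ Finset.range M, HasDerivAt
      (fun t => if cell m k = i then Function.update x n t k else 0)
      (if k = n then (if cell m n = i then 1 else 0) else 0) (x n) := by
    intro k _
    by_cases hk : k = n
    · subst hk
      by_cases h1 : cell m k = i
      · simpa [h1] using hasDerivAt_id' (x k)
      · simpa [h1] using hasDerivAt_const (x k) (0 : ℝ)
    · by_cases h1 : cell m k = i
      · simpa [h1, hk] using hasDerivAt_const (x n) (x k)
      · simpa [h1, hk] using hasDerivAt_const (x n) (0 : ℝ)
  have h2 := HasDerivAt.fun_sum h
  rw [Finset.sum_ite_eq' (Finset.range M) n] at h2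
  refine h2.congr_deriv ?_
  by_cases h3 : n < M <;> simp [h3]

theorem sum_range_cell {m M : ℕ} (c : ℕ → ℝ) (Q : Fin (m + 1) → ℝ) :
    ∑ n ∈ Finset.range M, c n * Q (cell m n) = ∑ i, partialAggregate m M i c * Q i := by
  simp only [partialAggregate, Finset.sum_mul, ite_mul, zero_mul]
  rw [Finset.sum_comm]
  exact Finset.sum_congr rfl fun n _ => by simp

/-- The differential expression of the finite-dimensional generator, with the factor
`1 - |y|` as an additional variable `s`. -/
def polyExpr {m : ℕ} (β : ℝ) (p : MvPolynomial (Fin (m + 1)) ℝ) (A y : Fin (m + 1) → ℝ) (s : ℝ) :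
    ℝ :=
  ∑ i, (y i * s * eval y (pderiv i (pderiv i p)) + (A i * s - β * y i) * eval y (pderiv i p))

theorem polyExpr_eq_eval_polyGen {m : ℕ} (β : ℝ) (p : MvPolynomial (Fin (m + 1)) ℝ)
    (A y : Fin (m + 1) → ℝ) : polyExpr β p A y (1 - ∑ i, y i) = eval y (polyGen A β p) := by
  rw [polyGen, polyLower_apply, polyEuler_apply]
  simp only [polyExpr, map_sub, map_mul, map_one, map_sum, eval_X, map_add, smul_eval,
    Finset.mul_sum]
  rw [← Finset.sum_sub_distrib]
  exact Finset.sum_congr rfl fun i _ => by ring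

theorem continuous_polyExpr {m : ℕ} (β : ℝ) (p : MvPolynomial (Fin (m + 1)) ℝ) :
    Continuous fun z : (Fin (m + 1) → ℝ) × (Fin (m + 1) → ℝ) × ℝ =>
      polyExpr β p z.1 z.2.1 z.2.2 := by
  have h : ∀ q : MvPolynomial (Fin (m + 1)) ℝ,
      Continuous fun z : (Fin (m + 1) → ℝ) × (Fin (m + 1) → ℝ) × ℝ => eval z.2.1 q :=
    fun q => (MvPolynomial.continuous_eval q).comp (continuous_fst.comp continuous_snd)
  have hA : ∀ i, Continuous fun z : (Fin (m + 1) → ℝ) × (Fin (m + 1) → ℝ) × ℝ => z.1 i :=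
    fun i => (continuous_apply i).comp continuous_fst
  have hy : ∀ i, Continuous fun z : (Fin (m + 1) → ℝ) × (Fin (m + 1) → ℝ) × ℝ => z.2.1 i :=
    fun i => (continuous_apply i).comp (continuous_fst.comp continuous_snd)
  have hs : Continuous fun z : (Fin (m + 1) → ℝ) × (Fin (m + 1) → ℝ) × ℝ => z.2.2 :=
    continuous_snd.comp continuous_snd
  exact continuous_finsetSum _ fun i _ => (((hy i).mul hs).mul (h _)).add
    ((((hA i).mul hs).sub (continuous_const.mul (hy i))).mul (h _))

/-- The cylinder function `p(x_0, …, x_{m-1}, x_m + ⋯ + x_{M-1})`. -/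
def partialPoly (m M : ℕ) (p : MvPolynomial (Fin (m + 1)) ℝ) (x : ℕ → ℝ) : ℝ :=
  eval (fun i => partialAggregate m M i x) p

theorem partialPoly_mem_FC (m M : ℕ) (p : MvPolynomial (Fin (m + 1)) ℝ) :
    partialPoly m M p ∈ FC r :=
  FC.eval_mem (fun i => partialAggregate_mem_FC m M i) p

theorem pd_partialPoly (m M : ℕ) (p : MvPolynomial (Fin (m + 1)) ℝ) (n : ℕ) (x : ℕ → ℝ) :
    pd n (partialPoly m M p) x =
      if n < M then partialPoly m M (pderiv (cell m n) p) x else 0 := by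
  have h := pd_eval (fun i => partialAggregate_mem_FC m M i) p n x
  simp only [pd_partialAggregate] at h
  refine h.trans ?_
  by_cases hn : n < M
  · simp [hn, partialPoly]
  · simp [hn]

theorem genExpr_partialPoly (α : ℕ → ℝ) (β : ℝ) (m M : ℕ) (p : MvPolynomial (Fin (m + 1)) ℝ)
    (x : ℕ → ℝ) : genExpr α β (partialPoly m M p) x =
      polyExpr β p (fun i => partialAggregate m M i α) (fun i => partialAggregate m M i x)
        (1 - ∑' i, x i) := by
  have h0 : ∀ n ≥ M, ∀ x, pd n (partialPoly m M p) x = 0 := fun n hn x => by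
    rw [pd_partialPoly, if_neg (by omega)]
  have h1 : ∀ n ∈ Finset.range M, pd n (partialPoly m M p) =
      partialPoly m M (pderiv (cell m n) p) := fun n hn => funext fun x => by
    rw [pd_partialPoly, if_pos (Finset.mem_range.1 hn)]
  rw [genExpr_eq_sum h0, polyExpr]
  set s := 1 - ∑' i, x i
  set y : Fin (m + 1) → ℝ := fun i => partialAggregate m M i x
  have e1 := sum_range_cell (M := M) x fun i =>
    s * eval y (pderiv i (pderiv i p)) - β * eval y (pderiv i p)
  have e2 := sum_range_cell (M := M) α fun i => s * eval y (pderiv i p)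
  calc _ = ∑ n ∈ Finset.range M, (x n * (s * eval y (pderiv (cell m n) (pderiv (cell m n) p)) -
          β * eval y (pderiv (cell m n) p)) + α n * (s * eval y (pderiv (cell m n) p))) := by
        refine Finset.sum_congr rfl fun n hn => ?_
        rw [h1 n hn, pd_partialPoly, if_pos (Finset.mem_range.1 hn)]
        simp only [partialPoly]
        ring
    _ = _ := by
        rw [Finset.sum_add_distrib, e1, e2, ← Finset.sum_add_distrib]
        exact Finset.sum_congr rfl fun i _ => by ring

variable {α : ℕ → ℝ} {β : ℝ} {μ : Measure InfSimplex} [IsProbabilityMeasure μ]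

theorem continuous_eval_aggregate (m : ℕ) (p : MvPolynomial (Fin (m + 1)) ℝ) :
    Continuous fun x : InfSimplex => eval (aggregate (coords x) m) p :=
  (MvPolynomial.continuous_eval p).comp (continuous_aggregate m)

theorem exists_eval_aggregate_bound (m : ℕ) (p : MvPolynomial (Fin (m + 1)) ℝ) :
    ∃ C, ∀ x : InfSimplex, |eval (aggregate (coords x) m) p| ≤ C := by
  obtain ⟨C, hC⟩ := (isCompact_finSimplex (m + 1)).exists_bound_of_continuousOn
    (MvPolynomial.continuous_eval p).continuousOn
  exact ⟨C, fun x => hC _ (aggregate_mem x m)⟩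

theorem memLp_eval_aggregate (m : ℕ) (p : MvPolynomial (Fin (m + 1)) ℝ) :
    MemLp (fun x : InfSimplex => eval (aggregate (coords x) m) p) 2 μ := by
  obtain ⟨C, hC⟩ := exists_eval_aggregate_bound m p
  exact memLp_of_bound (continuous_eval_aggregate m p) hC

variable (μ) in
/-- The class in `L²(μ)` of the polynomial `p(x_0, …, x_{m-1}, ∑_{i ≥ m} x_i)`. -/
def polyClass (m : ℕ) : MvPolynomial (Fin (m + 1)) ℝ →ₗ[ℝ] Lp ℝ 2 μ where
  toFun p := classL2 μ fun x => eval (aggregate (coords x) m) p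
  map_add' p q := by
    simp only [map_add]
    exact classL2_add (memLp_eval_aggregate m p) (memLp_eval_aggregate m q)
  map_smul' c p := by
    simp only [smul_eval]
    exact classL2_const_mul c (memLp_eval_aggregate m p)

theorem polyClass_apply (m : ℕ) (p : MvPolynomial (Fin (m + 1)) ℝ) :
    polyClass μ m p = classL2 μ fun x => eval (aggregate (coords x) m) p := rfl

theorem polyClass_injective (hα : ∀ i, 0 < α i) (hsum : Summable α) (hβ : 0 < β)
    (hμ : ∀ k, μ.map (fun x => aggregate (coords x) k) = dirichlet (aggregate α k) β) (m : ℕ) :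
    Function.Injective (polyClass μ m) := by
  rw [injective_iff_map_eq_zero]
  intro p hp
  have h1 : (fun x => eval (aggregate (coords x) m) p) =ᵐ[μ] 0 := by
    refine (coeFn_classL2 (memLp_eval_aggregate m p)).symm.trans ?_
    rw [← polyClass_apply, hp]
    exact Lp.coeFn_zero _ _ _
  refine eq_zero_of_ae_dirichlet (aggregate_pos hα hsum m) hβ ?_
  rw [← hμ m]
  exact (ae_map_iff (continuous_aggregate m).measurable.aemeasurable
    (isClosed_eq (MvPolynomial.continuous_eval p) continuous_const).measurableSet).2 h1

/-- The polynomials in finitely many coordinates and the remaining tail are dense in `L²(μ)`. -/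
theorem exists_polyClass_near (u : Lp ℝ 2 μ) {ε : ℝ} (hε : 0 < ε) :
    ∃ m p, dist u (polyClass μ m p) < ε := by
  obtain ⟨F, hF⟩ := (BoundedContinuousFunction.toLp_denseRange (α := InfSimplex) (E := ℝ) ℝ
    (μ := μ) (p := 2) (by simp)).exists_dist_lt u (ε := ε / 3) (by positivity)
  have hF' : BoundedContinuousFunction.toLp 2 μ ℝ F = classL2 μ F :=
    eq_classL2 (memLp_of_bound F.continuous fun x => F.norm_coe_le_norm x)
      (BoundedContinuousFunction.coeFn_toLp 2 μ ℝ F)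
  rw [hF'] at hF
  have hlim := tendsto_classL2 (μ := μ) (F := F) (Φ := fun k x => F (embed (collect k x)))
    (C := ‖F‖) (fun k => (F.continuous.comp ((continuous_embed _).comp
      (continuous_collect k))).aestronglyMeasurable) (fun k x => F.norm_coe_le_norm _)
    fun x => (F.continuous.tendsto x).comp (tendsto_embed_collect x)
  obtain ⟨m, hm⟩ := (Metric.tendsto_nhds.1 hlim (ε / 3) (by positivity)).exists
  have : CompactSpace (finSimplex (m + 1)) :=
    isCompact_iff_compactSpace.1 (isCompact_finSimplex (m + 1))
  -- the Stone–Weierstrass theorem on the finite-dimensional simplex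
  set ev : MvPolynomial (Fin (m + 1)) ℝ →ₐ[ℝ] C(finSimplex (m + 1), ℝ) :=
    aeval fun i => ⟨fun y => y.1 i, (continuous_apply i).comp continuous_subtype_val⟩ with hev
  have hev' : ∀ p (y : finSimplex (m + 1)), ev p y = eval y.1 p := by
    intro p y
    induction p using MvPolynomial.induction_on with
    | C c => simp [hev, _root_.algebraMap_apply]
    | add p q hp hq => simp [hp, hq]
    | mul_X p i hp =>
      have hX : ev (X i) y = y.1 i := by simp [hev]
      rw [map_mul, ContinuousMap.mul_apply, hp, hX, map_mul, eval_X]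
  obtain ⟨⟨g, hg⟩, hgε⟩ :=
    ContinuousMap.exists_mem_subalgebra_near_continuousMap_of_separatesPoints ev.range
      (fun y z hyz => by
        obtain ⟨i, hi⟩ := Function.ne_iff.1 (fun h => hyz (Subtype.ext h))
        exact ⟨_, ⟨_, ⟨X i, rfl⟩, rfl⟩, by simpa [hev'] using hi⟩)
      ⟨fun y => F (embed y), F.continuous.comp (continuous_embed _)⟩ (ε / 3) (by positivity)
  obtain ⟨p, rfl⟩ := hg
  refine ⟨m, p, ?_⟩
  have h3 : dist (classL2 μ fun x => F (embed (collect m x))) (polyClass μ m p) ≤ ε / 3 := by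
    have hM : MemLp (fun x => F (embed (collect m x))) 2 μ :=
      memLp_of_bound (F.continuous.comp ((continuous_embed _).comp (continuous_collect m)))
        fun x => F.norm_coe_le_norm _
    rw [dist_eq_norm, polyClass_apply, ← classL2_sub hM (memLp_eval_aggregate m p)]
    refine (sq_le_sq₀ (norm_nonneg _) (by positivity)).1 ?_
    rw [norm_classL2_sq (F := fun x => F (embed (collect m x)) - eval (aggregate (coords x) m) p)
      (hM.sub (memLp_eval_aggregate m p))]
    refine (integral_mono_of_nonneg (Eventually.of_forall fun x => sq_nonneg _)
      (integrable_const ((ε / 3) ^ 2)) (Eventually.of_forall fun x => ?_)).trans (by simp)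
    have h := ContinuousMap.norm_lt_iff _ (by positivity) |>.1 hgε (collect m x)
    have h' : |ev p (collect m x) - F (embed (collect m x))| < ε / 3 := h
    rw [hev' p (collect m x)] at h'
    change |eval (aggregate (coords x) m) p - F (embed (collect m x))| < ε / 3 at h'
    rw [abs_sub_comm] at h'
    exact sq_le_sq' (abs_lt.1 h').1.le (abs_lt.1 h').2.le
  calc dist u (polyClass μ m p) ≤ dist u (classL2 μ F) +
        dist (classL2 μ F) (classL2 μ fun x => F (embed (collect m x))) +
        dist (classL2 μ fun x => F (embed (collect m x))) (polyClass μ m p) :=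
        dist_triangle4 _ _ _ _
    _ < ε / 3 + ε / 3 + ε / 3 := by
        rw [dist_comm (classL2 μ F)]
        exact add_lt_add_of_lt_of_le (add_lt_add hF hm) h3
    _ = ε := by ring

end PolynomialClasses

/-! ### The eigenbasis of the generator -/

/-- Let `L` be symmetric for the inner product pulled back along the injective map `J`. Then the
finite-dimensional `L`-invariant subspaces are spanned by eigenvectors of `L`. -/
theorem mem_span_eigenvectors {V H : Type*} [AddCommGroup V] [Module ℝ V] [NormedAddCommGroup H]
    [InnerProductSpace ℝ H] (J : V →ₗ[ℝ] H) (hJ : Function.Injective J) (L : V →ₗ[ℝ] V)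
    (hsymm : ∀ q q', inner ℝ (J (L q)) (J q') = inner ℝ (J q) (J (L q')))
    {W : Submodule ℝ V} [FiniteDimensional ℝ W] (hW : ∀ q ∈ W, L q ∈ W) {p : V} (hp : p ∈ W) :
    J p ∈ Submodule.span ℝ {u | ∃ q, ∃ κ : ℝ, L q = κ • q ∧ u = J q} := by
  have hJW : Function.Injective (J.domRestrict W) := fun q q' h => Subtype.ext (hJ h)
  let e : W ≃ₗ[ℝ] LinearMap.range (J.domRestrict W) := LinearEquiv.ofInjective _ hJW
  have he : ∀ q : W, (e q : H) = J q.1 := fun q => rfl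
  let T : LinearMap.range (J.domRestrict W) →ₗ[ℝ] LinearMap.range (J.domRestrict W) :=
    e.toLinearMap ∘ₗ (L.restrict hW) ∘ₗ e.symm.toLinearMap
  have hTe : ∀ q : W, T (e q) = e (L.restrict hW q) := fun q => by simp [T]
  have hT : T.IsSymmetric := by
    intro u v
    obtain ⟨q, rfl⟩ := e.surjective u
    obtain ⟨q', rfl⟩ := e.surjective v
    rw [hTe, hTe]
    exact hsymm q.1 q'.1
  have hw : J p = (e ⟨p, hp⟩ : H) := rfl
  rw [hw, ← (hT.eigenvectorBasis rfl).sum_repr (e ⟨p, hp⟩), Submodule.coe_sum]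
  refine Submodule.sum_mem _ fun i _ => ?_
  rw [Submodule.coe_smul]
  refine Submodule.smul_mem _ _ (Submodule.subset_span
    ⟨(e.symm (hT.eigenvectorBasis rfl i)).1, hT.eigenvalues rfl i, ?_, ?_⟩)
  · have h1 := hT.apply_eigenvectorBasis rfl i
    obtain ⟨q, hq⟩ := e.surjective (hT.eigenvectorBasis rfl i)
    rw [← hq, hTe] at h1
    have h2 : L.restrict hW q = (hT.eigenvalues rfl i : ℝ) • q := e.injective (by
      rw [h1, map_smul]
      rfl)
    rw [← hq, e.symm_apply_apply]
    exact congrArg Subtype.val h2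
  · rw [← he, e.apply_symm_apply]

section Eigenfunctions

open MvPolynomial

variable {α : ℕ → ℝ} {β : ℝ} {μ : Measure InfSimplex} [IsProbabilityMeasure μ]
  {f : (ℕ → ℝ) → ℝ}

theorem continuous_genExpr (α : ℕ → ℝ) (β : ℝ) (hf : f ∈ FC 2) :
    Continuous fun x : InfSimplex => genExpr α β f (coords x) := by
  obtain ⟨m, hm⟩ := FC.exists_pd_eq_zero (FC.mono one_le_two hf)
  simp only [genExpr_eq_sum hm]
  have hs : Continuous fun x : InfSimplex => 1 - ∑' i, coords x i :=
    continuous_const.sub continuous_tsum_coords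
  have hp : ∀ n, pd n f ∈ FC 1 := fun n => FC.pd_mem hf n
  exact continuous_finsetSum _ fun n _ => (((continuous_coord n).mul hs).mul
    (FC.continuous_coords (FC.pd_mem (r := 0) (hp n) n))).add
    (((continuous_const.mul hs).sub (continuous_const.mul (continuous_coord n))).mul
      (FC.continuous_coords (hp n)))

theorem exists_genExpr_bound (α : ℕ → ℝ) (β : ℝ) (hf : f ∈ FC 2) :
    ∃ C, ∀ x : InfSimplex, |genExpr α β f (coords x)| ≤ C := by
  obtain ⟨m, hm⟩ := FC.exists_pd_eq_zero (FC.mono one_le_two hf)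
  have hp : ∀ n, pd n f ∈ FC 1 := fun n => FC.pd_mem hf n
  choose C hC using fun n => FC.exists_bound (hp n)
  choose D hD using fun n => FC.exists_bound (FC.pd_mem (r := 0) (hp n) n)
  refine ⟨∑ n ∈ Finset.range m, (1 * D n + (|α n| + |β|) * C n), fun x => ?_⟩
  rw [genExpr_eq_sum hm]
  refine (Finset.abs_sum_le_sum_abs _ _).trans (Finset.sum_le_sum fun n _ => ?_)
  have h1 : |coords x n| ≤ 1 := by
    rw [abs_of_nonneg (coords_nonneg x n)]
    exact (coords_mem_Icc x n).2
  have h2 := abs_one_sub_le x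
  refine (abs_add_le _ _).trans (add_le_add ?_ ?_)
  · rw [abs_mul, abs_mul]
    exact mul_le_mul (mul_le_one₀ h1 (abs_nonneg _) h2) (hD n x) (abs_nonneg _) zero_le_one
  · rw [abs_mul]
    refine mul_le_mul ((abs_sub _ _).trans (add_le_add ?_ ?_)) (hC n x) (abs_nonneg _)
      (by positivity)
    · rw [abs_mul]
      exact mul_le_of_le_one_right (abs_nonneg _) h2
    · rw [abs_mul]
      exact mul_le_of_le_one_right (abs_nonneg _) h1

theorem memLp_genExpr (α : ℕ → ℝ) (β : ℝ) (hf : f ∈ FC 2) :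
    MemLp (fun x : InfSimplex => genExpr α β f (coords x)) 2 μ := by
  obtain ⟨C, hC⟩ := exists_genExpr_bound α β hf
  exact memLp_of_bound (continuous_genExpr α β hf) hC

variable (α β μ) in
/-- The pairs of classes `(f, Lf)`, where `f` is a `C²` cylinder function and `Lf` is given by the
differential expression. -/
def genPairs : Set (Lp ℝ 2 μ × Lp ℝ 2 μ) :=
  {P | ∃ f : FC 2, P = (toL2 2 μ f, classL2 μ fun x => genExpr α β f.1 (coords x))}

variable (α β μ) in
/-- The closure, as a linear relation in `L²(μ)`, of the differential expression on `C²` cylinder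
functions. -/
def genRelation : Submodule ℝ (Lp ℝ 2 μ × Lp ℝ 2 μ) :=
  (Submodule.span ℝ (genPairs α β μ)).topologicalClosure

theorem isClosed_genRelation : _root_.IsClosed (genRelation α β μ : Set (Lp ℝ 2 μ × Lp ℝ 2 μ)) :=
  Submodule.isClosed_topologicalClosure _

theorem mem_genRelation (f : FC 2) :
    (toL2 2 μ f, classL2 μ fun x => genExpr α β f.1 (coords x)) ∈ genRelation α β μ :=
  Submodule.le_topologicalClosure _ (Submodule.subset_span ⟨f, rfl⟩)

theorem toL2_mono (f : FC 2) :
    toL2 2 μ f = toL2 1 μ ⟨f.1, FC.mono one_le_two f.2⟩ := rfl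

theorem energy_eq_neg_inner (hα : ∀ i, 0 < α i) (hsum : Summable α) (hβ : 0 < β)
    (hμ : ∀ k, μ.map (fun x => aggregate (coords x) k) = dirichlet (aggregate α k) β)
    (f : FC 2) (g : FC 1) :
    energy μ ⟨f.1, FC.mono one_le_two f.2⟩ g =
      -inner ℝ (classL2 μ fun x => genExpr α β f.1 (coords x)) (toL2 1 μ g) := by
  rw [energy_eq_neg_integral hα hsum hβ hμ _ g f.2, toL2_eq_classL2,
    inner_classL2 (memLp_genExpr α β f.2) (memLp_cylinder g μ)]

theorem genRelation_symm (hα : ∀ i, 0 < α i) (hsum : Summable α) (hβ : 0 < β)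
    (hμ : ∀ k, μ.map (fun x => aggregate (coords x) k) = dirichlet (aggregate α k) β) :
    ∀ p ∈ genRelation α β μ, ∀ q ∈ genRelation α β μ, inner ℝ p.2 q.1 = inner ℝ p.1 q.2 := by
  refine closure_span_symm ?_
  rintro _ ⟨f, rfl⟩ _ ⟨g, rfl⟩
  have h1 := energy_eq_neg_inner hα hsum hβ hμ f ⟨g.1, FC.mono one_le_two g.2⟩
  have h2 := energy_eq_neg_inner hα hsum hβ hμ g ⟨f.1, FC.mono one_le_two f.2⟩
  rw [energy_comm, h1, ← toL2_mono, ← toL2_mono, neg_inj] at h2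
  rw [h2, real_inner_comm]

theorem tendsto_partialAggregate {c : ℕ → ℝ} (hc : Summable c) (m : ℕ) :
    Tendsto (fun M => fun i => partialAggregate m M i c) atTop (𝓝 (aggregate c m)) :=
  tendsto_pi_nhds.2 fun i => (hasSum_aggregate hc m i).tendsto_sum_nat

theorem partialAggregate_mem_Icc {c : ℕ → ℝ} (hc : Summable c) (h0 : ∀ n, 0 ≤ c n) (m M : ℕ)
    (i : Fin (m + 1)) : partialAggregate m M i c ∈ Set.Icc 0 (aggregate c m i) := by
  have h1 : ∀ n, 0 ≤ if cell m n = i then c n else (0 : ℝ) := fun n => by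
    split_ifs
    exacts [h0 n, le_rfl]
  exact ⟨Finset.sum_nonneg fun n _ => h1 n, sum_le_hasSum _ (fun n _ => h1 n)
    (hasSum_aggregate hc m i)⟩

theorem partialAggregate_coords_mem (x : InfSimplex) (m M : ℕ) :
    (fun i => partialAggregate m M i (coords x)) ∈
      Set.univ.pi fun _ : Fin (m + 1) => Set.Icc (0 : ℝ) 1 := fun i _ =>
  have h := partialAggregate_mem_Icc (summable_coords x) (coords_nonneg x) m M i
  ⟨h.1, h.2.trans (mem_Icc_of_mem_finSimplex (aggregate_mem x m) i).2⟩

theorem tendsto_toL2_partialPoly (m : ℕ) (p : MvPolynomial (Fin (m + 1)) ℝ) :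
    Tendsto (fun M => toL2 2 μ ⟨_, partialPoly_mem_FC m M p⟩) atTop (𝓝 (polyClass μ m p)) := by
  have hK : IsCompact (Set.univ.pi fun _ : Fin (m + 1) => Set.Icc (0 : ℝ) 1) :=
    isCompact_univ_pi fun _ => isCompact_Icc
  obtain ⟨C, hC⟩ := hK.exists_bound_of_continuousOn (MvPolynomial.continuous_eval p).continuousOn
  simp only [toL2_eq_classL2, polyClass_apply]
  refine tendsto_classL2 (C := C)
    (fun M => (FC.continuous_coords (partialPoly_mem_FC (r := 0) m M p)).aestronglyMeasurable)
    (fun M x => hC _ (partialAggregate_coords_mem x m M)) fun x => ?_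
  exact ((MvPolynomial.continuous_eval p).tendsto _).comp
    (tendsto_partialAggregate (summable_coords x) m)

theorem tendsto_polyExpr {m : ℕ} (p : MvPolynomial (Fin (m + 1)) ℝ)
    {A y : ℕ → Fin (m + 1) → ℝ} {A' y' : Fin (m + 1) → ℝ} (hA : Tendsto A atTop (𝓝 A'))
    (hy : Tendsto y atTop (𝓝 y')) (s : ℝ) :
    Tendsto (fun M => polyExpr β p (A M) (y M) s) atTop (𝓝 (polyExpr β p A' y' s)) := by
  have hA' := tendsto_pi_nhds.1 hA
  have hy' := tendsto_pi_nhds.1 hy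
  have h : ∀ q : MvPolynomial (Fin (m + 1)) ℝ,
      Tendsto (fun M => eval (y M) q) atTop (𝓝 (eval y' q)) := fun q =>
    ((MvPolynomial.continuous_eval q).tendsto y').comp hy
  exact tendsto_finsetSum _ fun i _ => ((((hy' i).mul_const s).mul (h _))).add
    ((((hA' i).mul_const s).sub ((hy' i).const_mul β)).mul (h _))

theorem tendsto_classL2_genExpr_partialPoly (hα : ∀ i, 0 < α i) (hsum : Summable α) (m : ℕ)
    (p : MvPolynomial (Fin (m + 1)) ℝ) :
    Tendsto (fun M => classL2 μ fun x => genExpr α β (partialPoly m M p) (coords x)) atTop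
      (𝓝 (polyClass μ m (polyGen (aggregate α m) β p))) := by
  have hKy : IsCompact (Set.univ.pi fun _ : Fin (m + 1) => Set.Icc (0 : ℝ) 1) :=
    isCompact_univ_pi fun _ => isCompact_Icc
  have hKA : IsCompact (Set.univ.pi fun i : Fin (m + 1) => Set.Icc 0 (aggregate α m i)) :=
    isCompact_univ_pi fun _ => isCompact_Icc
  obtain ⟨D, hD⟩ := (hKA.prod (hKy.prod (isCompact_Icc (a := (0 : ℝ)) (b := 1)))
    ).exists_bound_of_continuousOn (continuous_polyExpr β p).continuousOn
  rw [polyClass_apply]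
  refine tendsto_classL2 (C := D)
    (fun M => (continuous_genExpr α β (partialPoly_mem_FC m M p)).aestronglyMeasurable)
    (fun M x => ?_) fun x => ?_
  · rw [genExpr_partialPoly]
    refine hD (fun i => partialAggregate m M i α, fun i => partialAggregate m M i (coords x),
      1 - ∑' i, coords x i) ⟨fun i _ => ?_, partialAggregate_coords_mem x m M, ?_⟩
    · exact partialAggregate_mem_Icc hsum (fun n => (hα n).le) m M i
    · exact ⟨by linarith [tsum_coords_le_one x], by linarith [tsum_coords_nonneg x]⟩
  · simp only [genExpr_partialPoly]
    rw [← polyExpr_eq_eval_polyGen, sum_aggregate_coords]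
    exact tendsto_polyExpr p (tendsto_partialAggregate hsum m)
      (tendsto_partialAggregate (summable_coords x) m) _

/-- The generator acts on polynomials in finitely many coordinates and the tail as the
finite-dimensional generator: these polynomials are limits of cylinder functions. -/
theorem polyClass_mem_genRelation (hα : ∀ i, 0 < α i) (hsum : Summable α) (m : ℕ)
    (p : MvPolynomial (Fin (m + 1)) ℝ) :
    (polyClass μ m p, polyClass μ m (polyGen (aggregate α m) β p)) ∈ genRelation α β μ :=
  isClosed_genRelation.mem_of_tendsto
    ((tendsto_toL2_partialPoly m p).prodMk_nhds (tendsto_classL2_genExpr_partialPoly hα hsum m p))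
    (Eventually.of_forall fun M => mem_genRelation ⟨_, partialPoly_mem_FC m M p⟩)

variable (α β μ) in
/-- The polynomial eigenfunctions of the generator for the eigenvalue `-κ`. -/
def polyEigenfunctions (κ : ℝ) : Set (Lp ℝ 2 μ) :=
  {u | ∃ m p, polyGen (aggregate α m) β p = -(κ • p) ∧ u = polyClass μ m p}

/-- Every polynomial is a linear combination of polynomial eigenfunctions, because the generator
is symmetric and leaves the finite-dimensional spaces of polynomials of bounded degree
invariant. -/
theorem polyClass_mem_span (hα : ∀ i, 0 < α i) (hsum : Summable α) (hβ : 0 < β)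
    (hμ : ∀ k, μ.map (fun x => aggregate (coords x) k) = dirichlet (aggregate α k) β) (m : ℕ)
    (p : MvPolynomial (Fin (m + 1)) ℝ) :
    polyClass μ m p ∈ Submodule.span ℝ (⋃ κ, polyEigenfunctions α β μ κ) := by
  let L : MvPolynomial (Fin (m + 1)) ℝ →ₗ[ℝ] MvPolynomial (Fin (m + 1)) ℝ :=
    LinearMap.mulLeft ℝ (1 - ∑ i, X i) ∘ₗ polyLower (aggregate α m) - β • polyEuler
  have hL : ∀ q, L q = polyGen (aggregate α m) β q := fun q => rfl
  refine Submodule.span_mono ?_ (mem_span_eigenvectors (polyClass μ m)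
    (polyClass_injective hα hsum hβ hμ m) L (fun q q' => ?_)
    (W := restrictTotalDegree (Fin (m + 1)) ℝ p.totalDegree) (fun q hq => ?_) (p := p) ?_)
  · rintro _ ⟨q, κ, hq, rfl⟩
    refine Set.mem_iUnion.2 ⟨-κ, m, q, ?_, rfl⟩
    rw [← hL, hq, neg_smul, neg_neg]
  · exact genRelation_symm hα hsum hβ hμ _ (polyClass_mem_genRelation hα hsum m q) _
      (polyClass_mem_genRelation hα hsum m q')
  · rw [mem_restrictTotalDegree] at hq ⊢
    exact (totalDegree_polyGen_le _ β q).trans hq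
  · rw [mem_restrictTotalDegree]

/-- There is a Hilbert basis of eigenfunctions of the generator. Apart from the constants, for the
eigenvalue zero, the eigenvalues of `-L` are at least `β`. -/
theorem exists_eigenbasis_genRelation (hα : ∀ i, 0 < α i) (hsum : Summable α) (hβ : 0 < β)
    (hμ : ∀ k, μ.map (fun x => aggregate (coords x) k) = dirichlet (aggregate α k) β) :
    ∃ (ι : Type) (b : HilbertBasis ι ℝ (Lp ℝ 2 μ)) (l : ι → ℝ),
      (∀ i, β ≤ l i ∨ (l i = 0 ∧ ∃ c : ℝ, b i = c • Lp.const 2 μ (1 : ℝ))) ∧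
      ∀ i, (b i, -(l i • b i)) ∈ genRelation α β μ := by
  obtain ⟨ι, b, l, h⟩ := exists_eigenbasis (genRelation α β μ) isClosed_genRelation
    (genRelation_symm hα hsum hβ hμ) (polyEigenfunctions α β μ) (by
      rintro κ _ ⟨m, p, hp, rfl⟩
      have := polyClass_mem_genRelation (β := β) (μ := μ) hα hsum m p
      rwa [hp, map_neg, map_smul] at this) (by
      rw [Submodule.eq_top_iff']
      refine fun u => Metric.mem_closure_iff.2 fun ε hε => ?_
      obtain ⟨m, p, hp⟩ := exists_polyClass_near u hε
      exact ⟨_, polyClass_mem_span hα hsum hβ hμ m p, hp⟩)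
  refine ⟨ι, b, l, fun i => ?_, fun i => (h i).2⟩
  rcases le_or_gt β (l i) with hi | hi
  · exact Or.inl hi
  right
  have hconst : ∀ u ∈ polyEigenfunctions α β μ (l i), u ≠ 0 →
      l i = 0 ∧ ∃ c : ℝ, u = c • Lp.const 2 μ (1 : ℝ) := by
    rintro _ ⟨m, p, hp, rfl⟩ h0
    have hp0 : p ≠ 0 := by
      rintro rfl
      exact h0 (map_zero _)
    rcases polyGen_eigenvalue _ (fun j => (aggregate_pos hα hsum m j).le) hβ hp0 hp with h1 | h1
    · exact absurd h1 hi.not_ge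
    · obtain ⟨h1, c, rfl⟩ := h1
      refine ⟨h1, c, ?_⟩
      rw [polyClass_apply, ← classL2_const, ← classL2_const_mul c (memLp_const 1)]
      simp
  have hb0 : b i ≠ 0 := b.orthonormal.ne_zero i
  have hex : ∃ u ∈ polyEigenfunctions α β μ (l i), u ≠ 0 := by
    by_contra! hall
    have : Submodule.span ℝ (polyEigenfunctions α β μ (l i)) = ⊥ := Submodule.span_eq_bot.2 hall
    have h1 := (h i).1
    rw [this, (Submodule.closed_of_finiteDimensional _).submodule_topologicalClosure_eq,
      Submodule.mem_bot] at h1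
    exact hb0 h1
  obtain ⟨u, hu, hu0⟩ := hex
  refine ⟨(hconst u hu hu0).1, ?_⟩
  have hle : (Submodule.span ℝ (polyEigenfunctions α β μ (l i))).topologicalClosure ≤
      Submodule.span ℝ {Lp.const 2 μ (1 : ℝ)} := by
    refine Submodule.topologicalClosure_minimal _ (Submodule.span_le.2 fun v hv => ?_)
      (Submodule.closed_of_finiteDimensional _)
    by_cases hv0 : v = 0
    · rw [hv0]
      exact Submodule.zero_mem _
    · obtain ⟨c, rfl⟩ := (hconst v hv hv0).2
      exact Submodule.smul_mem _ _ (Submodule.mem_span_singleton_self _)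
  obtain ⟨c, hc⟩ := Submodule.mem_span_singleton.1 (hle (h i).1)
  exact ⟨c, hc.symm⟩

end Eigenfunctions

/-! ### Closed forms and cores of diagonal forms -/

section ClosedForms

variable {H : Type*} [NormedAddCommGroup H] [InnerProductSpace ℝ H]

namespace SymmForm

variable (E : SymmForm H)

theorem form_sq_le (u v : E.domain) : E.form u v ^ 2 ≤ E.form u u * E.form v v :=
  LinearMap.BilinForm.apply_sq_le_of_symm E.form E.nonneg ⟨fun u v => E.symm u v⟩ u v

theorem form_sub_self (u v : E.domain) : E.form (u - v) (u - v) =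
    E.form (v - u) (v - u) := by
  rw [← neg_sub u v]
  simp only [map_neg, LinearMap.neg_apply, neg_neg]

/-- A form is continuous in each variable for its own seminorm. -/
theorem tendsto_form_left {τ : Type*} {l : Filter τ} {u : τ → E.domain} {v : E.domain}
    (h : Tendsto (fun t => E.form (u t - v) (u t - v)) l (𝓝 0)) (w : E.domain) :
    Tendsto (fun t => E.form (u t) w) l (𝓝 (E.form v w)) := by
  rw [tendsto_iff_norm_sub_tendsto_zero]
  have h1 := (h.mul_const (E.form w w)).sqrt
  rw [zero_mul, Real.sqrt_zero] at h1
  refine squeeze_zero (fun _ => norm_nonneg _) (fun t => ?_) h1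
  rw [Real.norm_eq_abs, ← LinearMap.sub_apply, ← map_sub]
  exact Real.abs_le_sqrt (E.form_sq_le _ _)

theorem tendsto_form_self {τ : Type*} {l : Filter τ} {u : τ → E.domain} {v : E.domain}
    (h : Tendsto (fun t => E.form (u t - v) (u t - v)) l (𝓝 0)) :
    Tendsto (fun t => E.form (u t) (u t)) l (𝓝 (E.form v v)) := by
  have h1 := (h.add ((E.tendsto_form_left h v).const_mul 2)).sub_const (E.form v v)
  have e : ∀ t, E.form (u t - v) (u t - v) + 2 * E.form (u t) v - E.form v v =
      E.form (u t) (u t) := fun t => by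
    simp only [map_sub, LinearMap.sub_apply, E.symm v (u t)]
    ring
  simp only [e] at h1
  convert h1 using 2
  ring

variable {E} in
theorem tendsto_of_tendsto_normSq {τ : Type*} {l : Filter τ} {u : τ → E.domain} {v : E.domain}
    (h : Tendsto (fun t => E.normSq (u t - v)) l (𝓝 0)) :
    Tendsto (fun t => (u t : H)) l (𝓝 v) ∧
      Tendsto (fun t => E.form (u t - v) (u t - v)) l (𝓝 0) := by
  constructor
  · rw [tendsto_iff_norm_sub_tendsto_zero]
    have h1 := h.sqrt
    rw [Real.sqrt_zero] at h1
    refine squeeze_zero (fun _ => norm_nonneg _) (fun t => ?_) h1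
    refine Real.le_sqrt_of_sq_le ?_
    have h2 := E.nonneg (u t - v)
    have h3 : ((u t - v : E.domain) : H) = (u t : H) - v := rfl
    rw [normSq, h3]
    linarith
  · refine squeeze_zero (fun _ => E.nonneg _) (fun t => ?_) h
    rw [normSq]
    linarith [sq_nonneg ‖((u t - v : E.domain) : H)‖]

/-- A form with a closed extension is closable. -/
theorem isClosable_of_isClosed (hE : E.IsClosed) {V : Type*} [AddCommGroup V] [Module ℝ V]
    {ι : V →ₗ[ℝ] H} {e : V → V → ℝ} (mem : ∀ f, ι f ∈ E.domain)
    (heq : ∀ f, E.form ⟨ι f, mem f⟩ ⟨ι f, mem f⟩ = e f f) : IsClosable ι e := by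
  intro f hf hcauchy
  set u : ℕ → E.domain := fun n => ⟨ι (f n), mem (f n)⟩ with hu
  have h1 : Tendsto (fun p : ℕ × ℕ => ‖ι (f p.1) - ι (f p.2)‖ ^ 2) atTop (𝓝 0) := by
    rw [← prod_atTop_atTop_eq]
    have := ((hf.comp tendsto_fst).sub (hf.comp tendsto_snd) :
      Tendsto (fun p : ℕ × ℕ => ι (f p.1) - ι (f p.2)) (atTop ×ˢ atTop) _).norm.pow 2
    simpa using this
  have h2 : ∀ p : ℕ × ℕ, E.normSq (u p.1 - u p.2) =
      ‖ι (f p.1) - ι (f p.2)‖ ^ 2 + e (f p.1 - f p.2) (f p.1 - f p.2) := fun p => by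
    have h3 : u p.1 - u p.2 = ⟨ι (f p.1 - f p.2), mem _⟩ := Subtype.ext (map_sub ι _ _).symm
    rw [normSq, h3, heq]
    simp only [map_sub]
  obtain ⟨v, hv⟩ := hE u (by simpa only [h2, add_zero] using h1.add hcauchy)
  obtain ⟨h4, h5⟩ := tendsto_of_tendsto_normSq hv
  have hv0 : v = 0 := Subtype.ext (tendsto_nhds_unique h4 hf)
  have h6 := E.tendsto_form_self h5
  rw [hv0] at h6
  simpa [hu, heq] using h6

end SymmForm

variable {ι : Type*} (b : HilbertBasis ι ℝ H) {l : ι → ℝ} (hl : ∀ i, 0 ≤ l i)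

theorem abs_inv_sqrt_one_add_le_one {s : ℝ} (hs : 0 ≤ s) : |(√(1 + s))⁻¹| ≤ 1 := by
  rw [abs_of_nonneg (by positivity)]
  exact inv_le_one_of_one_le₀ (Real.one_le_sqrt.2 (by linarith))

/-- The isometry `(1 + l)^{-1/2}` from the Hilbert space onto the domain of the form with the form
norm. -/
def diagIsometry : H →L[ℝ] H :=
  diagOp b (fun i => (√(1 + l i))⁻¹) 1 fun i => abs_inv_sqrt_one_add_le_one (hl i)

theorem inner_diagIsometry (i : ι) (u : H) :
    inner ℝ (b i) (diagIsometry b hl u) = (√(1 + l i))⁻¹ * inner ℝ (b i) u :=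
  inner_diagOp ..

theorem normSq_diagIsometry (z : H) : ∃ h : diagIsometry b hl z ∈ (diagForm b l hl).domain,
    (diagForm b l hl).normSq ⟨_, h⟩ = ‖z‖ ^ 2 := by
  have hpos : ∀ i, 0 < 1 + l i := fun i => by linarith [hl i]
  have e : ∀ i, inner ℝ (b i) (diagIsometry b hl z) ^ 2 +
      l i * inner ℝ (b i) (diagIsometry b hl z) ^ 2 = inner ℝ (b i) z ^ 2 := fun i => by
    rw [inner_diagIsometry, mul_pow, inv_pow, Real.sq_sqrt (hpos i).le]
    have := (hpos i).ne'
    field_simp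
  have h : diagIsometry b hl z ∈ (diagForm b l hl).domain := by
    rw [mem_diagForm_domain]
    refine Summable.of_nonneg_of_le (fun i => mul_nonneg (hl i) (sq_nonneg _)) (fun i => ?_)
      (hasSum_inner_sq b z).summable
    rw [← e i]
    linarith [sq_nonneg (inner ℝ (b i) (diagIsometry b hl z))]
  refine ⟨h, HasSum.unique ((hasSum_inner_sq b (diagIsometry b hl z)).add
    (hasSum_diagForm_self b hl ⟨_, h⟩)) ?_⟩
  simpa only [e] using hasSum_inner_sq b z

theorem exists_diagIsometry_eq (u : (diagForm b l hl).domain) :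
    ∃ z, diagIsometry b hl z = u := by
  have hpos : ∀ i, 0 < 1 + l i := fun i => by linarith [hl i]
  obtain ⟨z, hz⟩ := exists_forall_inner_eq b (fun i => √(1 + l i) * inner ℝ (b i) (u : H)) (by
    refine ((hasSum_inner_sq b (u : H)).summable.add
      (hasSum_diagForm_self b hl u).summable).congr fun i => ?_
    rw [mul_pow, Real.sq_sqrt (hpos i).le]
    ring)
  refine ⟨z, hilbertBasis_ext b fun i => ?_⟩
  rw [inner_diagIsometry, hz]
  have := (Real.sqrt_pos.2 (hpos i)).ne'
  field_simp

/-- If the generator restricted to the image of `V` has, up to closure as a relation, all the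
eigenvectors, then the image of `V` is dense in the domain for the form norm. -/
theorem diagForm_core {V : Type*} [AddCommGroup V] [Module ℝ V] (T : V →ₗ[ℝ] H) {S : Set (H × H)}
    (hS : ∀ P ∈ S, (∃ f, T f = P.1) ∧ P ∈ (diagForm b l hl).generatorGraph)
    (hb : ∀ i, (b i, -(l i • b i)) ∈ (Submodule.span ℝ S).topologicalClosure)
    (u : (diagForm b l hl).domain) : ∃ (f : ℕ → V), ∀ mem : ∀ n, T (f n) ∈ (diagForm b l hl).domain,
      Tendsto (fun n => (diagForm b l hl).normSq (⟨T (f n), mem n⟩ - u)) atTop (𝓝 0) := by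
  have hpos : ∀ i, 0 < 1 + l i := fun i => by linarith [hl i]
  set R := diagIsometry b hl with hR
  set K : Submodule ℝ H := (LinearMap.range T).comap R.toLinearMap with hK
  -- `R (u - w)` lies in `K` for `(u, w) ∈ S`, because `R² (1 - L) = 1`
  have h1 : (Submodule.span ℝ S).topologicalClosure ≤ K.topologicalClosure.comap
      (R.toLinearMap ∘ₗ (LinearMap.fst ℝ H H - LinearMap.snd ℝ H H)) := by
    refine Submodule.topologicalClosure_minimal _ (Submodule.span_le.2 ?_) ?_
    · rintro ⟨v, w⟩ hP
      obtain ⟨⟨f, hf⟩, hvw⟩ := hS _ hP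
      rw [mem_generatorGraph_diagForm] at hvw
      refine Submodule.le_topologicalClosure _ ⟨f, hf.trans (hilbertBasis_ext b fun i => ?_)⟩
      change inner ℝ (b i) v = inner ℝ (b i) (R (R (v - w)))
      rw [hR, inner_diagIsometry, inner_diagIsometry, inner_sub_right, hvw, ← mul_assoc, ← mul_inv,
        Real.mul_self_sqrt (hpos i).le]
      have := (hpos i).ne'
      field_simp
      ring
    · exact (Submodule.isClosed_topologicalClosure K).preimage
        (f := fun P : H × H => R (P.1 - P.2)) (by fun_prop)
  have h2 : ∀ i, b i ∈ K.topologicalClosure := fun i => by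
    classical
    have h3 : R (b i - -(l i • b i)) ∈ K.topologicalClosure := h1 (hb i)
    have h4 : R (b i - -(l i • b i)) = √(1 + l i) • b i := hilbertBasis_ext b fun j => by
      rw [hR, inner_diagIsometry, sub_neg_eq_add, inner_add_right, real_inner_smul_right,
        real_inner_smul_right, hilbertBasis_inner_eq]
      split_ifs with hj
      · subst hj
        rw [mul_one, mul_one, inv_mul_eq_div, Real.div_sqrt]
      · simp
    rw [h4] at h3
    have := Submodule.smul_mem _ (√(1 + l i))⁻¹ h3
    rwa [smul_smul, inv_mul_cancel₀ (Real.sqrt_pos.2 (hpos i)).ne', one_smul] at this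
  have h3 : K.topologicalClosure = ⊤ := by
    rw [eq_top_iff, ← b.dense_span]
    exact Submodule.topologicalClosure_minimal _
      (Submodule.span_le.2 (Set.range_subset_iff.2 h2)) (Submodule.isClosed_topologicalClosure _)
  obtain ⟨z, hz⟩ := exists_diagIsometry_eq b hl u
  have h4 : z ∈ closure (K : Set H) := by
    rw [← Submodule.topologicalClosure_coe, h3]
    trivial
  obtain ⟨y, hyK, hy⟩ := mem_closure_iff_seq_limit.1 h4
  choose f hf using hyK
  refine ⟨f, fun mem => ?_⟩
  have h5 : ∀ n, (diagForm b l hl).normSq (⟨T (f n), mem n⟩ - u) = ‖y n - z‖ ^ 2 := fun n => by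
    obtain ⟨h, h'⟩ := normSq_diagIsometry b hl (y n - z)
    rw [← h']
    congr 1
    refine Subtype.ext ?_
    have h6 : T (f n) = R (y n) := hf n
    change T (f n) - (u : H) = R (y n - z)
    rw [map_sub, h6, hR, hz]
  simp only [h5]
  have := (tendsto_iff_norm_sub_tendsto_zero.1 hy).pow 2
  simpa using this

end ClosedForms

/-! ### The diagonal form is the closure of the energy -/

section DiagonalEnergy

variable {α : ℕ → ℝ} {β : ℝ} {μ : Measure InfSimplex} [IsProbabilityMeasure μ]
  {ι : Type*} (b : HilbertBasis ι ℝ (Lp ℝ 2 μ)) {l : ι → ℝ} (hl : ∀ i, 0 ≤ l i)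

theorem genRelation_le_generatorGraph (hα : ∀ i, 0 < α i) (hsum : Summable α) (hβ : 0 < β)
    (hμ : ∀ k, μ.map (fun x => aggregate (coords x) k) = dirichlet (aggregate α k) β)
    (hb : ∀ i, (b i, -(l i • b i)) ∈ genRelation α β μ) :
    genRelation α β μ ≤ (diagForm b l hl).generatorGraph := by
  rintro ⟨u, w⟩ h
  rw [mem_generatorGraph_diagForm]
  intro i
  have h1 := genRelation_symm hα hsum hβ hμ _ h _ (hb i)
  rw [real_inner_comm, h1, inner_neg_right, real_inner_smul_right, real_inner_comm]

theorem mem_domain_FC_two (hα : ∀ i, 0 < α i) (hsum : Summable α) (hβ : 0 < β)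
    (hμ : ∀ k, μ.map (fun x => aggregate (coords x) k) = dirichlet (aggregate α k) β)
    (hb : ∀ i, (b i, -(l i • b i)) ∈ genRelation α β μ) (f : FC 1) (hf : f.1 ∈ FC 2) :
    ∃ h : toL2 1 μ f ∈ (diagForm b l hl).domain,
      ∀ (g : FC 1) (hg : toL2 1 μ g ∈ (diagForm b l hl).domain),
        (diagForm b l hl).form ⟨_, h⟩ ⟨_, hg⟩ = energy μ f g := by
  obtain ⟨h, h'⟩ := genRelation_le_generatorGraph b hl hα hsum hβ hμ hb
    (mem_genRelation ⟨f.1, hf⟩)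
  exact ⟨h, fun g hg => (h' ⟨_, hg⟩).trans (energy_eq_neg_inner hα hsum hβ hμ ⟨f.1, hf⟩ g).symm⟩

theorem form_le_energy (hα : ∀ i, 0 < α i) (hsum : Summable α) (hβ : 0 < β)
    (hμ : ∀ k, μ.map (fun x => aggregate (coords x) k) = dirichlet (aggregate α k) β)
    (hb : ∀ i, (b i, -(l i • b i)) ∈ genRelation α β μ) (f : FC 1) :
    ∃ h : toL2 1 μ f ∈ (diagForm b l hl).domain,
      (diagForm b l hl).form ⟨_, h⟩ ⟨_, h⟩ ≤ energy μ f f := by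
  obtain ⟨F, hF, h1, h2, -, -⟩ := exists_seq_FC_two (μ := μ) f
  choose h h' using fun k => mem_domain_FC_two b hl hα hsum hβ hμ hb (F k) (hF k)
  exact diagForm_le_of_tendsto b hl (v := fun k => ⟨_, h k⟩) h1 h2
    (Eventually.of_forall fun k => (h' k (F k) (h k)).le)

theorem mem_domain_FC_one (hα : ∀ i, 0 < α i) (hsum : Summable α) (hβ : 0 < β)
    (hμ : ∀ k, μ.map (fun x => aggregate (coords x) k) = dirichlet (aggregate α k) β)
    (hb : ∀ i, (b i, -(l i • b i)) ∈ genRelation α β μ) (f : FC 1) :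
    toL2 1 μ f ∈ (diagForm b l hl).domain := (form_le_energy b hl hα hsum hβ hμ hb f).1

theorem form_eq_energy (hα : ∀ i, 0 < α i) (hsum : Summable α) (hβ : 0 < β)
    (hμ : ∀ k, μ.map (fun x => aggregate (coords x) k) = dirichlet (aggregate α k) β)
    (hb : ∀ i, (b i, -(l i • b i)) ∈ genRelation α β μ) (f g : FC 1) :
    (diagForm b l hl).form ⟨_, mem_domain_FC_one b hl hα hsum hβ hμ hb f⟩
      ⟨_, mem_domain_FC_one b hl hα hsum hβ hμ hb g⟩ = energy μ f g := by
  set mem := mem_domain_FC_one b hl hα hsum hβ hμ hb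
  obtain ⟨F, hF, -, -, h3, h4⟩ := exists_seq_FC_two (μ := μ) f
  have h5 : Tendsto (fun k => (diagForm b l hl).form (⟨_, mem (F k)⟩ - ⟨_, mem f⟩)
      (⟨_, mem (F k)⟩ - ⟨_, mem f⟩)) atTop (𝓝 0) := by
    refine squeeze_zero (fun _ => (diagForm b l hl).nonneg _) (fun k => ?_) h4
    obtain ⟨h, h'⟩ := form_le_energy b hl hα hsum hβ hμ hb (f - F k)
    rw [SymmForm.form_sub_self]
    have e : (⟨_, mem f⟩ - ⟨_, mem (F k)⟩ : (diagForm b l hl).domain) = ⟨_, h⟩ :=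
      Subtype.ext (map_sub (toL2 1 μ) f (F k)).symm
    rw [e]
    exact h'
  refine tendsto_nhds_unique ((diagForm b l hl).tendsto_form_left h5 ⟨_, mem g⟩) ?_
  refine (h3 g).congr fun k => ?_
  obtain ⟨h, h'⟩ := mem_domain_FC_two b hl hα hsum hβ hμ hb (F k) (hF k)
  exact (h' g (mem g)).symm

theorem diagForm_isClosureOf (hα : ∀ i, 0 < α i) (hsum : Summable α) (hβ : 0 < β)
    (hμ : ∀ k, μ.map (fun x => aggregate (coords x) k) = dirichlet (aggregate α k) β)
    (hb : ∀ i, (b i, -(l i • b i)) ∈ genRelation α β μ) :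
    (diagForm b l hl).IsClosureOf (toL2 1 μ) (energy μ) where
  mem_domain := mem_domain_FC_one b hl hα hsum hβ hμ hb
  form_eq := form_eq_energy b hl hα hsum hβ hμ hb
  closed := diagForm_isClosed b hl
  dense u := by
    obtain ⟨f, hf⟩ := diagForm_core b hl (toL2 1 μ) (S := genPairs α β μ) (by
      rintro _ ⟨f, rfl⟩
      exact ⟨⟨⟨f.1, FC.mono one_le_two f.2⟩, rfl⟩,
        genRelation_le_generatorGraph b hl hα hsum hβ hμ hb (mem_genRelation f)⟩) hb u
    exact ⟨f, hf _⟩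

/-- The generator of the diagonal form on `C²` cylinder functions. -/
theorem generator_FC_two (hα : ∀ i, 0 < α i) (hsum : Summable α) (hβ : 0 < β)
    (hμ : ∀ k, μ.map (fun x => aggregate (coords x) k) = dirichlet (aggregate α k) β)
    (hb : ∀ i, (b i, -(l i • b i)) ∈ genRelation α β μ) (f : FC 2) :
    ∃ h : toL2 2 μ f ∈ (diagForm b l hl).generator.domain,
      (diagForm b l hl).generator ⟨toL2 2 μ f, h⟩ =ᵐ[μ] fun x => genExpr α β f.1 (coords x) := by
  have h1 := genRelation_le_generatorGraph b hl hα hsum hβ hμ hb (mem_genRelation f)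
  rw [← diagForm_generator_graph, LinearPMap.mem_graph_iff] at h1
  obtain ⟨y, hy, hy'⟩ := h1
  dsimp only at hy hy'
  refine ⟨hy ▸ y.2, ?_⟩
  have e : (⟨toL2 2 μ f, hy ▸ y.2⟩ : (diagForm b l hl).generator.domain) = y :=
    Subtype.ext hy.symm
  rw [e, hy']
  exact coeFn_classL2 (memLp_genExpr α β f.2)

/-! ### Contraction properties -/

theorem integrable_energy (f : FC 1) : Integrable (fun x : InfSimplex =>
    (1 - ∑' n, coords x n) * ∑' n, coords x n * (pd n f.1 (coords x) * pd n f.1 (coords x))) μ := by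
  obtain ⟨m, hm⟩ := FC.exists_pd_eq_zero f.2
  simp only [energy_integrand_eq hm]
  have hp : ∀ n, pd n f.1 ∈ FC 0 := fun n => FC.pd_mem f.2 n
  exact integrable_finsetSum _ fun n _ =>
    integrable_weight_mul (f := fun y => pd n f.1 y * pd n f.1 y) n (FC.mul (hp n) (hp n))

/-- The energy decreases under composition with a contraction of the line. -/
theorem energy_comp_le {ψ : ℝ → ℝ} (hψ : ContDiff ℝ 1 ψ) (hψ1 : ∀ t, |deriv ψ t| ≤ 1) (f : FC 1) :
    energy μ ⟨fun x => ψ (f.1 x), FC.comp hψ f.2⟩ ⟨fun x => ψ (f.1 x), FC.comp hψ f.2⟩ ≤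
      energy μ f f := by
  refine integral_mono (integrable_energy ⟨fun x => ψ (f.1 x), FC.comp hψ f.2⟩)
    (integrable_energy f) fun x => ?_
  obtain ⟨m, hm⟩ := FC.exists_pd_eq_zero f.2
  have hm' : ∀ n ≥ m, ∀ x, pd n (fun x => ψ (f.1 x)) x = 0 := fun n hn x => by
    rw [pd_comp hψ f.2, hm n hn, mul_zero]
  simp only [energy_integrand_eq hm, energy_integrand_eq hm']
  refine Finset.sum_le_sum fun n _ => mul_le_mul_of_nonneg_left ?_ (mul_nonneg
    (coords_nonneg x n) (sub_nonneg.2 (tsum_coords_le_one x)))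
  rw [pd_comp hψ f.2, ← sq, ← sq, mul_pow]
  exact mul_le_of_le_one_left (sq_nonneg _) ((sq_le_one_iff_abs_le_one _).2 (hψ1 _))

/-- The form decreases under a contraction of the line that is a uniform limit of `C¹`
contractions. -/
theorem form_contraction_le (hα : ∀ i, 0 < α i) (hsum : Summable α) (hβ : 0 < β)
    (hμ : ∀ k, μ.map (fun x => aggregate (coords x) k) = dirichlet (aggregate α k) β)
    (hb : ∀ i, (b i, -(l i • b i)) ∈ genRelation α β μ) {τ : ℝ → ℝ}
    {Φ : Lp ℝ 2 μ → Lp ℝ 2 μ} (hΦ : ∀ u, Φ u =ᵐ[μ] fun x => τ (u x))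
    (hΦ1 : ∀ u v, ‖Φ u - Φ v‖ ≤ ‖u - v‖) {ψ : ℝ → ℝ → ℝ}
    (hψ : ∀ ε > 0, ContDiff ℝ 1 (ψ ε) ∧ (∀ t, |deriv (ψ ε) t| ≤ 1) ∧ ∀ t, |ψ ε t - τ t| ≤ ε)
    (u : (diagForm b l hl).domain) : ∃ h : Φ u ∈ (diagForm b l hl).domain,
      (diagForm b l hl).form ⟨_, h⟩ ⟨_, h⟩ ≤ (diagForm b l hl).form u u := by
  have hcl := diagForm_isClosureOf b hl hα hsum hβ hμ hb
  obtain ⟨f, hf⟩ := hcl.dense u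
  obtain ⟨h1, h2⟩ := SymmForm.tendsto_of_tendsto_normSq hf
  have hε : ∀ n : ℕ, (0 : ℝ) < 1 / ((n : ℝ) + 1) := fun n => by positivity
  have hlim : Tendsto (fun n : ℕ => 1 / ((n : ℝ) + 1)) atTop (𝓝 0) :=
    tendsto_one_div_add_atTop_nhds_zero_nat
  let g : ℕ → FC 1 := fun n =>
    ⟨fun x => ψ (1 / ((n : ℝ) + 1)) ((f n).1 x), FC.comp (hψ _ (hε n)).1 (f n).2⟩
  have h3 : ∀ n, ‖toL2 1 μ (g n) - Φ (toL2 1 μ (f n))‖ ≤ 1 / ((n : ℝ) + 1) := fun n => by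
    have := Lp.norm_le_of_ae_bound (f := toL2 1 μ (g n) - Φ (toL2 1 μ (f n))) (hε n).le (by
      have e1 := coeFn_classL2 (memLp_cylinder (g n) μ)
      have e2 := coeFn_classL2 (memLp_cylinder (f n) μ)
      rw [← toL2_eq_classL2] at e1 e2
      filter_upwards [Lp.coeFn_sub (toL2 1 μ (g n)) (Φ (toL2 1 μ (f n))), e1, e2,
        hΦ (toL2 1 μ (f n))] with x k1 k2 k3 k4
      rw [k1, Pi.sub_apply, k2, k4, k3]
      exact (hψ _ (hε n)).2.2 _)
    have hμ1 : measureUnivNNReal μ = 1 := by simp [measureUnivNNReal]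
    simpa [hμ1] using this
  have h4 : Tendsto (fun n => toL2 1 μ (g n)) atTop (𝓝 (Φ u)) := by
    rw [tendsto_iff_norm_sub_tendsto_zero]
    have h5 := hlim.add (tendsto_iff_norm_sub_tendsto_zero.1 h1)
    rw [add_zero] at h5
    refine squeeze_zero (fun _ => norm_nonneg _) (fun n => ?_) h5
    calc _ ≤ ‖toL2 1 μ (g n) - Φ (toL2 1 μ (f n))‖ + ‖Φ (toL2 1 μ (f n)) - Φ u‖ :=
          norm_sub_le_norm_sub_add_norm_sub _ _ _
      _ ≤ _ := add_le_add (h3 n) (hΦ1 _ _)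
  refine diagForm_le_of_tendsto b hl (v := fun n => ⟨_, hcl.mem_domain (g n)⟩) h4
    ((diagForm b l hl).tendsto_form_self h2) (Eventually.of_forall fun n => ?_)
  rw [hcl.form_eq, hcl.form_eq]
  exact energy_comp_le (hψ _ (hε n)).1 (hψ _ (hε n)).2.1 (f n)

/-- A smooth approximation of the positive part. -/
def smoothPos (ε t : ℝ) : ℝ := (t + √(t ^ 2 + ε ^ 2)) / 2

theorem contDiff_smoothPos {ε : ℝ} (hε : 0 < ε) : ContDiff ℝ 1 (smoothPos ε) := by
  unfold smoothPos
  refine (contDiff_id.add (ContDiff.sqrt (by fun_prop) fun t => ?_)).div_const 2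
  positivity

theorem hasDerivAt_smoothPos {ε : ℝ} (hε : 0 < ε) (t : ℝ) :
    HasDerivAt (smoothPos ε) ((1 + t / √(t ^ 2 + ε ^ 2)) / 2) t := by
  have hne : t ^ 2 + ε ^ 2 ≠ 0 := by positivity
  have h1 : HasDerivAt (fun t : ℝ => t ^ 2 + ε ^ 2) (2 * t) t := by
    simpa using (hasDerivAt_pow 2 t).add_const (ε ^ 2)
  have h2 := ((hasDerivAt_id' t).add (h1.sqrt hne)).div_const 2
  refine h2.congr_deriv ?_
  rw [mul_div_mul_left _ _ two_ne_zero]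

theorem deriv_smoothPos_mem {ε : ℝ} (hε : 0 < ε) (t : ℝ) :
    deriv (smoothPos ε) t ∈ Set.Icc (0 : ℝ) 1 := by
  rw [(hasDerivAt_smoothPos hε t).deriv]
  have hpos : 0 < √(t ^ 2 + ε ^ 2) := Real.sqrt_pos.2 (by positivity)
  have h : |t / √(t ^ 2 + ε ^ 2)| ≤ 1 := by
    rw [abs_div, abs_of_pos hpos, div_le_one hpos]
    exact Real.abs_le_sqrt (by linarith [sq_nonneg ε])
  obtain ⟨h1, h2⟩ := abs_le.1 h
  constructor <;> linarith

theorem smoothPos_sub_mem {ε : ℝ} (hε : 0 < ε) (t : ℝ) :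
    smoothPos ε t - max t 0 ∈ Set.Icc 0 (ε / 2) := by
  have h1 : |t| ≤ √(t ^ 2 + ε ^ 2) := Real.abs_le_sqrt (by linarith [sq_nonneg ε])
  have h2 : √(t ^ 2 + ε ^ 2) ≤ |t| + ε := by
    rw [Real.sqrt_le_left (by positivity)]
    nlinarith [sq_abs t, mul_nonneg (abs_nonneg t) hε.le]
  have h3 : max t 0 = (t + |t|) / 2 := by
    rcases le_total 0 t with h | h
    · rw [max_eq_left h, abs_of_nonneg h]
      ring
    · rw [max_eq_right h, abs_of_nonpos h]
      ring
  rw [h3, smoothPos]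
  constructor <;> linarith

omit [IsProbabilityMeasure μ] in
theorem coeFn_sup_zero (u : Lp ℝ 2 μ) : (u ⊔ 0 : Lp ℝ 2 μ) =ᵐ[μ] fun x => max (u x) 0 := by
  filter_upwards [Lp.coeFn_sup u 0, Lp.coeFn_zero ℝ 2 μ] with x h1 h2
  rw [h1, Pi.sup_apply, h2]
  rfl

/-- The positive part operates on the form. -/
theorem form_sup_zero_le (hα : ∀ i, 0 < α i) (hsum : Summable α) (hβ : 0 < β)
    (hμ : ∀ k, μ.map (fun x => aggregate (coords x) k) = dirichlet (aggregate α k) β)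
    (hb : ∀ i, (b i, -(l i • b i)) ∈ genRelation α β μ) (u : (diagForm b l hl).domain) :
    ∃ h : ((u : Lp ℝ 2 μ) ⊔ 0) ∈ (diagForm b l hl).domain,
      (diagForm b l hl).form ⟨_, h⟩ ⟨_, h⟩ ≤ (diagForm b l hl).form u u := by
  refine form_contraction_le b hl hα hsum hβ hμ hb (τ := fun t => max t 0) (Φ := fun u => u ⊔ 0)
    coeFn_sup_zero (fun u v => norm_sup_sub_sup_le_norm u v 0) (ψ := smoothPos)
    (fun ε hε => ⟨contDiff_smoothPos hε, fun t => ?_, fun t => ?_⟩) u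
  · obtain ⟨h1, h2⟩ := deriv_smoothPos_mem hε t
    rwa [abs_of_nonneg h1]
  · obtain ⟨h1, h2⟩ := smoothPos_sub_mem hε t
    rw [abs_of_nonneg h1]
    linarith

/-- The unit contraction operates on the form. -/
theorem form_unit_contraction_le (hα : ∀ i, 0 < α i) (hsum : Summable α) (hβ : 0 < β)
    (hμ : ∀ k, μ.map (fun x => aggregate (coords x) k) = dirichlet (aggregate α k) β)
    (hb : ∀ i, (b i, -(l i • b i)) ∈ genRelation α β μ) (u : (diagForm b l hl).domain) :
    ∃ h : ((u : Lp ℝ 2 μ) ⊔ 0) ⊓ Lp.const 2 μ (1 : ℝ) ∈ (diagForm b l hl).domain,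
      (diagForm b l hl).form ⟨_, h⟩ ⟨_, h⟩ ≤ (diagForm b l hl).form u u := by
  refine form_contraction_le b hl hα hsum hβ hμ hb (τ := fun t => min (max t 0) 1)
    (Φ := fun u => (u ⊔ 0) ⊓ Lp.const 2 μ (1 : ℝ)) (fun u => ?_)
    (fun u v => (norm_inf_sub_inf_le_norm _ _ _).trans (norm_sup_sub_sup_le_norm u v 0))
    (ψ := fun ε t => smoothPos ε t - smoothPos ε (t - 1))
    (fun ε hε => ⟨?_, fun t => ?_, fun t => ?_⟩) u
  · filter_upwards [Lp.coeFn_inf (u ⊔ 0) (Lp.const 2 μ (1 : ℝ)), coeFn_sup_zero u,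
      Lp.coeFn_const (p := 2) (μ := μ) (1 : ℝ)] with x h1 h2 h3
    rw [h1, Pi.inf_apply, h2, h3]
    rfl
  · exact (contDiff_smoothPos hε).sub ((contDiff_smoothPos hε).comp (by fun_prop))
  · have h1 := (hasDerivAt_smoothPos hε t).sub
      ((hasDerivAt_smoothPos hε (t - 1)).comp_sub_const t 1)
    have h2 : deriv (fun t => smoothPos ε t - smoothPos ε (t - 1)) t =
        deriv (smoothPos ε) t - deriv (smoothPos ε) (t - 1) := by
      rw [(hasDerivAt_smoothPos hε t).deriv, (hasDerivAt_smoothPos hε (t - 1)).deriv]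
      exact h1.deriv
    rw [h2]
    obtain ⟨h3, h4⟩ := deriv_smoothPos_mem hε t
    obtain ⟨h5, h6⟩ := deriv_smoothPos_mem hε (t - 1)
    exact abs_le.2 ⟨by linarith, by linarith⟩
  · have h1 : min (max t 0) 1 = max t 0 - max (t - 1) 0 := by
      rcases le_total t 0 with h | h
      · rw [max_eq_right h, max_eq_right (by linarith), min_eq_left zero_le_one, sub_zero]
      · rcases le_total t 1 with h' | h'
        · rw [max_eq_left h, max_eq_right (by linarith), min_eq_left h', sub_zero]
        · rw [max_eq_left h, max_eq_left (by linarith), min_eq_right h']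
          ring
    obtain ⟨h3, h4⟩ := smoothPos_sub_mem hε t
    obtain ⟨h5, h6⟩ := smoothPos_sub_mem hε (t - 1)
    rw [h1]
    exact abs_le.2 ⟨by linarith, by linarith⟩

theorem diagForm_isDirichletForm (hα : ∀ i, 0 < α i) (hsum : Summable α) (hβ : 0 < β)
    (hμ : ∀ k, μ.map (fun x => aggregate (coords x) k) = dirichlet (aggregate α k) β)
    (hb : ∀ i, (b i, -(l i • b i)) ∈ genRelation α β μ) :
    IsDirichletForm (diagForm b l hl) where
  dense := diagForm_dense b hl
  closed := diagForm_isClosed b hl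
  markov := form_unit_contraction_le b hl hα hsum hβ hμ hb

/-! ### The Markov property of the semigroup -/

/-- The resolvent preserves positivity: the positive part of the minimizer is a minimizer. -/
theorem diagResolvent_nonneg (hα : ∀ i, 0 < α i) (hsum : Summable α) (hβ : 0 < β)
    (hμ : ∀ k, μ.map (fun x => aggregate (coords x) k) = dirichlet (aggregate α k) β)
    (hb : ∀ i, (b i, -(l i • b i)) ∈ genRelation α β μ) (s : ℝ≥0) {u : Lp ℝ 2 μ} (hu : 0 ≤ u) :
    0 ≤ diagResolvent b hl s u := by
  by_cases hs : s = 0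
  · have : diagResolvent b hl s u = u := hilbertBasis_ext b fun i => by
      rw [inner_diagResolvent, hs]
      simp
    rwa [this]
  · obtain ⟨h, -⟩ := diagResolvent_weak b hl s hs u
    obtain ⟨h', h''⟩ := form_sup_zero_le b hl hα hsum hβ hμ hb ⟨_, h⟩
    rw [← diagResolvent_eq_of_le b hl s hs u _ h h' h'' ?_]
    · exact le_sup_right
    · have := norm_sup_sub_sup_le_norm (diagResolvent b hl s u) u 0
      rwa [sup_eq_left.2 hu] at this

theorem diagSemigroup_nonneg (hα : ∀ i, 0 < α i) (hsum : Summable α) (hβ : 0 < β)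
    (hμ : ∀ k, μ.map (fun x => aggregate (coords x) k) = dirichlet (aggregate α k) β)
    (hb : ∀ i, (b i, -(l i • b i)) ∈ genRelation α β μ) (t : ℝ≥0) {u : Lp ℝ 2 μ} (hu : 0 ≤ u) :
    0 ≤ diagSemigroup b hl t u := by
  refine ge_of_tendsto' (tendsto_diagResolvent_pow b hl t u) fun n => ?_
  generalize t / (n : ℝ≥0) = s
  induction n with
  | zero => simpa using hu
  | succ n ih =>
    rw [pow_succ', mul_apply_eq_comp]
    exact diagResolvent_nonneg b hl hα hsum hβ hμ hb s ih

theorem norm_const_one : ‖Lp.const 2 μ (1 : ℝ)‖ = 1 := by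
  rw [Lp.norm_const] <;> simp

theorem mul_inner_const_one (hα : ∀ i, 0 < α i) (hsum : Summable α) (hβ : 0 < β)
    (hμ : ∀ k, μ.map (fun x => aggregate (coords x) k) = dirichlet (aggregate α k) β)
    (hb : ∀ i, (b i, -(l i • b i)) ∈ genRelation α β μ) (i : ι) :
    l i * inner ℝ (b i) (Lp.const 2 μ (1 : ℝ)) = 0 := by
  have h1 := polyClass_mem_genRelation (β := β) (μ := μ) hα hsum 0 (MvPolynomial.C 1)
  have h2 : polyGen (aggregate α 0) β (MvPolynomial.C 1) = 0 := by
    rw [polyGen, polyLower_apply, polyEuler_apply]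
    simp
  have h3 : polyClass μ 0 (MvPolynomial.C 1) = Lp.const 2 μ (1 : ℝ) := by
    rw [polyClass_apply, ← classL2_const]
    simp
  rw [h2, map_zero, h3] at h1
  have h4 := genRelation_symm hα hsum hβ hμ _ h1 _ (hb i)
  rw [inner_zero_left, inner_neg_right, real_inner_smul_right, real_inner_comm] at h4
  linarith

theorem diagSemigroup_isMarkov (hα : ∀ i, 0 < α i) (hsum : Summable α) (hβ : 0 < β)
    (hμ : ∀ k, μ.map (fun x => aggregate (coords x) k) = dirichlet (aggregate α k) β)
    (hb : ∀ i, (b i, -(l i • b i)) ∈ genRelation α β μ) : IsMarkov (diagSemigroup b hl) := by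
  refine fun t => ⟨fun u hu => diagSemigroup_nonneg b hl hα hsum hβ hμ hb t hu,
    hilbertBasis_ext b fun i => ?_⟩
  rw [inner_diagSemigroup]
  rcases mul_eq_zero.1 (mul_inner_const_one b hα hsum hβ hμ hb i) with h | h
  · simp [h]
  · simp [h]

/-! ### The spectral gap -/

/-- For a basis of eigenfunctions as in `exists_eigenbasis_genRelation`, the mean only involves the
constant eigenfunctions. -/
theorem eigenfunction_dichotomy (hα : ∀ i, 0 < α i) (hsum : Summable α) (hβ : 0 < β)
    (hμ : ∀ k, μ.map (fun x => aggregate (coords x) k) = dirichlet (aggregate α k) β)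
    (hb : ∀ i, (b i, -(l i • b i)) ∈ genRelation α β μ)
    (hgap : ∀ i, β ≤ l i ∨ (l i = 0 ∧ ∃ c : ℝ, b i = c • Lp.const 2 μ (1 : ℝ))) (i : ι) :
    (β ≤ l i ∧ inner ℝ (b i) (Lp.const 2 μ (1 : ℝ)) = 0) ∨
      (l i = 0 ∧ ∀ u, inner ℝ (b i) (meanOp μ u) = inner ℝ (b i) u) := by
  rcases hgap i with h | ⟨h, c, hc⟩
  · left
    exact ⟨h, (mul_eq_zero.1 (mul_inner_const_one b hα hsum hβ hμ hb i)).resolve_left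
      (hβ.trans_le h).ne'⟩
  · right
    refine ⟨h, fun u => ?_⟩
    rw [hc, real_inner_smul_left, real_inner_smul_left]
    congr 1
    change inner ℝ _ (inner ℝ (Lp.const 2 μ (1 : ℝ)) u • Lp.const 2 μ (1 : ℝ)) = _
    rw [real_inner_smul_right, real_inner_self_eq_norm_sq, norm_const_one]
    ring

theorem norm_diagSemigroup_sub_meanOp_le (hα : ∀ i, 0 < α i) (hsum : Summable α) (hβ : 0 < β)
    (hμ : ∀ k, μ.map (fun x => aggregate (coords x) k) = dirichlet (aggregate α k) β)
    (hb : ∀ i, (b i, -(l i • b i)) ∈ genRelation α β μ)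
    (hgap : ∀ i, β ≤ l i ∨ (l i = 0 ∧ ∃ c : ℝ, b i = c • Lp.const 2 μ (1 : ℝ))) (t : ℝ≥0) :
    ‖diagSemigroup b hl t - meanOp μ‖ ≤ Real.exp (-β * t) := by
  refine ContinuousLinearMap.opNorm_le_bound _ (Real.exp_pos _).le fun u =>
    norm_le_of_abs_inner_le b (Real.exp_pos _).le fun i => ?_
  rw [_root_.sub_apply, inner_sub_right, inner_diagSemigroup]
  rcases eigenfunction_dichotomy b hα hsum hβ hμ hb hgap i with ⟨h1, h2⟩ | ⟨h1, h2⟩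
  · have h3 : inner ℝ (b i) (meanOp μ u) = 0 := by
      change inner ℝ (b i) (inner ℝ (Lp.const 2 μ (1 : ℝ)) u • Lp.const 2 μ (1 : ℝ)) = 0
      rw [real_inner_smul_right, h2, mul_zero]
    rw [h3, sub_zero, abs_mul, abs_of_pos (Real.exp_pos _)]
    refine mul_le_mul_of_nonneg_right (Real.exp_le_exp.2 ?_) (abs_nonneg _)
    nlinarith [t.2, mul_le_mul_of_nonneg_left h1 t.2]
  · rw [h2, h1]
    simp
    positivity

/-- The Poincaré inequality on the domain of the form. -/
theorem poincare (hα : ∀ i, 0 < α i) (hsum : Summable α) (hβ : 0 < β)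
    (hμ : ∀ k, μ.map (fun x => aggregate (coords x) k) = dirichlet (aggregate α k) β)
    (hb : ∀ i, (b i, -(l i • b i)) ∈ genRelation α β μ)
    (hgap : ∀ i, β ≤ l i ∨ (l i = 0 ∧ ∃ c : ℝ, b i = c • Lp.const 2 μ (1 : ℝ)))
    (u : (diagForm b l hl).domain) (hu : ∫ x, (u : Lp ℝ 2 μ) x ∂μ = 0) :
    β * ‖(u : Lp ℝ 2 μ)‖ ^ 2 ≤ (diagForm b l hl).form u u := by
  refine hasSum_le (fun i => ?_) ((hasSum_inner_sq b (u : Lp ℝ 2 μ)).mul_left β)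
    (hasSum_diagForm_self b hl u)
  rcases eigenfunction_dichotomy b hα hsum hβ hμ hb hgap i with ⟨h1, -⟩ | ⟨h1, h2⟩
  · exact mul_le_mul_of_nonneg_right h1 (sq_nonneg _)
  · have h3 : meanOp μ (u : Lp ℝ 2 μ) = 0 := by
      rw [meanOp_apply, hu]
      exact map_zero (Lp.constₗ 2 μ ℝ (E := ℝ))
    rw [← h2, h3]
    simp

end DiagonalEnergy

/-! ### The extremal function -/

section Extremal

variable {α : ℕ → ℝ} {β : ℝ} {μ : Measure InfSimplex} [IsProbabilityMeasure μ]

/-- There is an eigenfunction for the eigenvalue `-β`, namely `x_0 / α_0 - x_1 / α_1`: the drift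
terms `α_n (1 - |x|)` cancel. -/
theorem exists_extremal (hα : ∀ i, 0 < α i) (hsum : Summable α) (hβ : 0 < β)
    (hμ : ∀ k, μ.map (fun x => aggregate (coords x) k) = dirichlet (aggregate α k) β) :
    ∃ f : FC 1, 0 < ‖toL2 1 μ f‖ ∧ ∫ x, f.1 (coords x) ∂μ = 0 ∧
      energy μ f f = β * ‖toL2 1 μ f‖ ^ 2 := by
  set F : (ℕ → ℝ) → ℝ := fun x => (α 0)⁻¹ * x 0 + -(α 1)⁻¹ * x 1 with hF
  have hF2 : F ∈ FC 2 := (FC 2).add_mem (FC.mul (FC.const _) (FC.coord 0))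
    (FC.mul (FC.const _) (FC.coord 1))
  have hpd : ∀ n, pd n F = fun _ => if n = 0 then (α 0)⁻¹ else if n = 1 then -(α 1)⁻¹ else 0 := by
    intro n
    ext x
    have h0 : ∀ (k : ℕ), HasDerivAt (fun t => Function.update x n t k)
        (if n = k then 1 else 0) (x n) := fun k => by
      by_cases h : n = k
      · subst h
        simpa using hasDerivAt_id' (x n)
      · simpa [h, Ne.symm h] using hasDerivAt_const (x n) (x k)
    have h1 := (((h0 0).const_mul (α 0)⁻¹).add ((h0 1).const_mul (-(α 1)⁻¹))).deriv
    refine h1.trans ?_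
    rcases n with _ | _ | n <;> simp
  have hgen : ∀ x : ℕ → ℝ, genExpr α β F x = -β * F x := fun x => by
    have hm : ∀ n ≥ 2, ∀ x, pd n F x = 0 := fun n hn x => by
      rw [hpd, if_neg (by omega), if_neg (by omega)]
    rw [genExpr_eq_sum hm, Finset.sum_range_succ, Finset.sum_range_one, hpd, hpd]
    have h1 := (hα 0).ne'
    have h2 := (hα 1).ne'
    simp only [hF, pd, deriv_const, mul_zero, if_true, one_ne_zero, if_false]
    field_simp
    ring
  have hFC1 : F ∈ FC 1 := FC.mono one_le_two hF2
  set f : FC 1 := ⟨F, hFC1⟩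
  have hint : ∀ g : FC 1, energy μ f g = β * ∫ x, F (coords x) * g.1 (coords x) ∂μ := fun g => by
    rw [energy_eq_neg_integral hα hsum hβ hμ f g hF2, ← integral_const_mul, ← integral_neg]
    refine integral_congr_ae (Eventually.of_forall fun x => ?_)
    simp only [f, hgen]
    ring
  have hnorm : ‖toL2 1 μ f‖ ^ 2 = ∫ x, F (coords x) * F (coords x) ∂μ := by
    rw [toL2_eq_classL2, norm_classL2_sq (memLp_cylinder f μ)]
    simp only [sq, f]
  refine ⟨f, norm_pos_iff.2 fun h0 => ?_, ?_, ?_⟩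
  · have e : toL2 1 μ f = polyClass μ 2 (MvPolynomial.C (α 0)⁻¹ * MvPolynomial.X 0 +
        MvPolynomial.C (-(α 1)⁻¹) * MvPolynomial.X 1) := by
      rw [toL2_eq_classL2, polyClass_apply]
      congr 1
      ext x
      simp [f, hF, aggregate]
    rw [e] at h0
    have h1 := polyClass_injective hα hsum hβ hμ 2 (h0.trans (map_zero _).symm)
    have h2 := congrArg (MvPolynomial.eval (Pi.single 0 1)) h1
    simp only [map_add, map_mul, MvPolynomial.eval_C, MvPolynomial.eval_X, Pi.single_eq_same,
      map_zero, mul_one] at h2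
    rw [Pi.single_eq_of_ne (by decide), mul_zero, add_zero] at h2
    exact (inv_pos.2 (hα 0)).ne' h2
  · have h1 := hint ⟨fun _ => 1, FC.const 1⟩
    have h2 : energy μ f ⟨fun _ => 1, FC.const 1⟩ = 0 := by
      have : ∀ n x, pd n (fun _ : ℕ → ℝ => (1 : ℝ)) x = 0 := fun n x => by simp [pd]
      simp only [energy, this, mul_zero, tsum_zero, integral_zero]
    rw [h2] at h1
    simpa [hβ.ne'] using h1.symm
  · rw [hint, hnorm]

theorem integral_toL2 (g : FC 1) : ∫ x, toL2 1 μ g x ∂μ = ∫ x, g.1 (coords x) ∂μ :=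
  integral_congr_ae (by
    rw [toL2_eq_classL2]
    exact coeFn_classL2 (memLp_cylinder g μ))

theorem norm_toL2_sq (g : FC 1) : ‖toL2 1 μ g‖ ^ 2 = ∫ x, g.1 (coords x) ^ 2 ∂μ := by
  rw [toL2_eq_classL2, norm_classL2_sq (memLp_cylinder g μ)]

theorem spectralGap_diagForm {ι : Type*} (b : HilbertBasis ι ℝ (Lp ℝ 2 μ)) {l : ι → ℝ}
    (hl : ∀ i, 0 ≤ l i) (hα : ∀ i, 0 < α i) (hsum : Summable α) (hβ : 0 < β)
    (hμ : ∀ k, μ.map (fun x => aggregate (coords x) k) = dirichlet (aggregate α k) β)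
    (hb : ∀ i, (b i, -(l i • b i)) ∈ genRelation α β μ)
    (hgap : ∀ i, β ≤ l i ∨ (l i = 0 ∧ ∃ c : ℝ, b i = c • Lp.const 2 μ (1 : ℝ))) :
    spectralGap (diagForm b l hl) = β := by
  have hcl := diagForm_isClosureOf b hl hα hsum hβ hμ hb
  obtain ⟨f, hf0, hf1, hf2⟩ := exists_extremal hα hsum hβ hμ
  refine IsLeast.csInf_eq ⟨?_, ?_⟩
  · -- the normalized extremal function attains the infimum
    set c := ‖toL2 1 μ f‖⁻¹ with hc
    have hcn : c * ‖toL2 1 μ f‖ = 1 := inv_mul_cancel₀ hf0.ne'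
    set u : (diagForm b l hl).domain := c • ⟨toL2 1 μ f, hcl.mem_domain f⟩ with hu
    have hu' : (u : Lp ℝ 2 μ) = c • toL2 1 μ f := rfl
    refine ⟨u, ?_, ?_, ?_⟩
    · rw [← inner_const_one, hu', real_inner_smul_right, inner_const_one, integral_toL2, hf1,
        mul_zero]
    · rw [← norm_sq_eq_integral, hu', norm_smul, Real.norm_eq_abs, abs_of_pos (inv_pos.2 hf0), hcn,
        one_pow]
    · rw [hu, map_smul, map_smul, LinearMap.smul_apply, hcl.form_eq, hf2, smul_eq_mul, smul_eq_mul]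
      calc β = β * (c * ‖toL2 1 μ f‖) ^ 2 := by rw [hcn, one_pow, mul_one]
        _ = _ := by ring
  · rintro r ⟨u, hu0, hu1, rfl⟩
    have h := poincare b hl hα hsum hβ hμ hb hgap u hu0
    rwa [norm_sq_eq_integral, hu1, mul_one] at h

end Extremal

end InfDirichlet

end

theorem theorem1p2 (α : ℕ → ℝ) (β : ℝ) (hα : ∀ i, 0 < α i) (hsum : Summable α) (hβ : 0 < β) :
    ∃ hprob : ∀ k, IsProbabilityMeasure (projDirichlet α β k),
    ∃ μ : ProbabilityMeasure InfSimplex,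
      -- (1) weak convergence
      Tendsto (β := ProbabilityMeasure InfSimplex) (fun k => ⟨projDirichlet α β k, hprob k⟩) atTop
        (𝓝 μ) ∧
      -- (2) closability, Dirichlet form, generator
      IsClosable (toL2 1 (μ : Measure InfSimplex)) (energy (μ : Measure InfSimplex)) ∧
      ∃ E : SymmForm (Lp ℝ 2 (μ : Measure InfSimplex)),
        E.IsClosureOf (toL2 1 (μ : Measure InfSimplex)) (energy (μ : Measure InfSimplex)) ∧
        IsDirichletForm E ∧
        (∀ f : FC 2, ∃ h : toL2 2 (μ : Measure InfSimplex) f ∈ E.generator.domain,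
          ∀ᵐ x ∂(μ : Measure InfSimplex),
            E.generator ⟨toL2 2 (μ : Measure InfSimplex) f, h⟩ x =
              genExpr α β f.1 (coords x)) ∧
        -- (3) spectral gap, exponential convergence, sharp Poincaré inequality
        spectralGap E = β ∧
        (∃ P : ℝ≥0 → Lp ℝ 2 (μ : Measure InfSimplex) →L[ℝ] Lp ℝ 2 (μ : Measure InfSimplex),
          IsSemigroupOf P E.generator ∧ IsMarkov P ∧
          ∀ t : ℝ≥0, ‖P t - meanOp (μ : Measure InfSimplex)‖ ≤ Real.exp (-β * t)) ∧
        (∀ f : FC 1, ∫ x, f.1 (coords x) ∂(μ : Measure InfSimplex) = 0 →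
          ∫ x, f.1 (coords x) ^ 2 ∂(μ : Measure InfSimplex) ≤
            1 / β * energy (μ : Measure InfSimplex) f f) ∧
        (∀ C : ℝ, (∀ f : FC 1, ∫ x, f.1 (coords x) ∂(μ : Measure InfSimplex) = 0 →
          ∫ x, f.1 (coords x) ^ 2 ∂(μ : Measure InfSimplex) ≤
            C * energy (μ : Measure InfSimplex) f f) → 1 / β ≤ C) := by
  obtain ⟨μ, hμ1, hμ⟩ := exists_infiniteDirichlet hα hsum hβ
  have hprob := isProbabilityMeasure_projDirichlet hμ
  obtain ⟨ι, b, l, hgap, hb⟩ := exists_eigenbasis_genRelation hα hsum hβ hμ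
  have hl : ∀ i, 0 ≤ l i := fun i => (hgap i).elim (fun h => hβ.le.trans h) fun h => h.1.ge
  have hcl := diagForm_isClosureOf b hl hα hsum hβ hμ hb
  refine ⟨hprob, ⟨μ, hμ1⟩, tendsto_projDirichlet ⟨μ, hμ1⟩ hμ hprob,
    SymmForm.isClosable_of_isClosed _ hcl.closed hcl.mem_domain fun g => hcl.form_eq g g,
    diagForm b l hl, hcl, diagForm_isDirichletForm b hl hα hsum hβ hμ hb,
    generator_FC_two b hl hα hsum hβ hμ hb,
    spectralGap_diagForm b hl hα hsum hβ hμ hb hgap,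
    ⟨diagSemigroup b hl, diagSemigroup_isSemigroupOf b hl,
      diagSemigroup_isMarkov b hl hα hsum hβ hμ hb,
      norm_diagSemigroup_sub_meanOp_le b hl hα hsum hβ hμ hb hgap⟩, fun g hg => ?_,
    fun C hC => ?_⟩
  · have h := poincare b hl hα hsum hβ hμ hb hgap ⟨_, hcl.mem_domain g⟩ ((integral_toL2 g).trans hg)
    rw [hcl.form_eq] at h
    rw [one_div, ← div_eq_inv_mul, le_div_iff₀ hβ, mul_comm]
    exact (congrArg (β * ·) (norm_toL2_sq (μ := μ) g)).symm.trans_le h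
  · obtain ⟨f, hf0, hf1, hf2⟩ := exists_extremal hα hsum hβ hμ
    have h := hC f hf1
    have h1 : ‖toL2 1 μ f‖ ^ 2 ≤ C * (β * ‖toL2 1 μ f‖ ^ 2) := by
      rw [← hf2, norm_toL2_sq]
      exact h
    rw [div_le_iff₀ hβ]
    have h2 : 0 < ‖toL2 1 μ f‖ ^ 2 := pow_pos hf0 2
    nlinarith
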